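/- Conventions. $\mathbb N=\{1,2,\dots\}$. For finite sets $F,G\subseteq\mathbb N$, $F<G$ means $\max F<\min G$ or one of them is empty, and $n\le F$ means $n\le\min F$ or $F=\emptyset$. For families $\mathcal F,\mathcal G$ of finite subsets of $\mathbb N$, $\mathcal F[\mathcal G]$ is the family of all unions $G_1\cup\dots\cup G_n$ with $G_1<\dots<G_n$ nonempty members of $\mathcal G$ and $\{\min G_1,\dots,\min G_n\}\in\mathcal F$. The Schreier families are $\mathcal S_0=\{\emptyset\}\cup\{\{n\}:n\in\mathbb N\}$, $\mathcal S_1=\{\emptyset\}\cup\{F:|F|\le\min F\}$, $\mathcal S_{\alpha+1}=\mathcal S_1[\mathcal S_\alpha]$ and, for a limit ordinal $\alpha<\omega_1$, $\mathcal S_\alpha=\{F: n\le F\in\mathcal S_{\alpha_n}\text{ for some }n\in\mathbb N\}$, where $(\alpha_n)$ is a chosen strictly increasing sequence of ordinals with supremum $\alpha$. The theorem holds for every choice of these sequences. Let $X$ be a real Banach space with a Schauder basis $(e_i)_{i\ge1}$. A sequence $(v_j)$ of nonzero vectors is a block basis of $(u_i)$, written $(v_j)\prec(u_i)$, if $v_j=\sum_{i=p_j}^{p_{j+1}-1}a_iu_i$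 for some integers $1\le p_1<p_2<\cdots$ and real scalars $a_i$. $X$ is asymptotic $\ell_1$ (with respect to $(e_i)$) if there is $C>0$ such that $\|\sum_{i=1}^n x_i\|\ge\frac1C\sum_{i=1}^n\|x_i\|$ for all $n$ and all $x_1,\dots,x_n$ in the linear span of $(e_i)$ whose supports with respect to $(e_i)$ satisfy $n\le\operatorname{supp}x_i$ for all $i$ and $\operatorname{supp}x_i<\operatorname{supp}x_j$ for $i<j$. $X$ is of $D$-bounded distortion, $D\in\mathbb R$, if for every equivalent norm $|\cdot|$ on $X$ and every closed infinite-dimensional subspace $Y$ of $X$, $$\inf_Z\ \sup\{|x|/|y| : x,y\in Z,\ \|x\|=\|y\|=1\}\le D,$$ the infimum being over all closed infinite-dimensional subspaces $Z$ of $Y$. For $(w_i)\prec(e_i)$, $x=\sum_i a_iw_i$ in the closed linear span $[w_i]$ and a finite interval $E\subseteq\mathbb N$, put $Ex=\sum_{i\in E}a_iw_i$. A finite sequence of nonempty finite intervals $E_1<\dots<E_m$ of $\mathbb N$ is $\beta$-admissible if $\{\min E_1,\dots,\min E_m\}\in\mathcal S_\beta$. Let $[z_i]_k^\infty$ denote the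 closed linear span of $\{z_i:i\ge k\}$. **Theorem.** Let $X$ be an asymptotic $\ell_1$ space (with respect to a Schauder basis $(e_i)$) of $D$-bounded distortion, no subspace of which is isomorphic to $\ell_1$. Then there exist $(w_i)\prec(e_i)$, an ordinal $\alpha=\omega^{\beta_0}$ with $\beta_0<\omega_1$, a number $0<\theta<1$ and $(z_i)\prec(w_i)$ such that for every $k\in\mathbb N$ and every $z\in[z_i]_k^\infty$, $$\frac1{4D}\,\sup_{1\le n\le k}\,\sup\Bigl\{\theta^n\sum_i\|E_iz\| : (E_i)\text{ is }\alpha\cdot n\text{-admissible}\Bigr\}\ \le\ \|z\|\ \le\ 4D\,\inf_{1\le n\le k}\,\sup\Bigl\{\theta^n\sum_i\|E_iz\| : (E_i)\text{ is }\alpha\cdot n\text{-admissible}\Bigr\},$$ where the restrictions $E_iz$ are taken with respect to $(w_i)$. -/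

import Mathlib

open scoped ENNReal

noncomputable section

namespace AsymptoticEll1

/-! ### Schreier families

Members of the families are finite sets of positive integers. -/

/-- The operation `𝓕[𝓖]`: unions of successive nonempty members `G 1 < ⋯ < G n` of `𝓖`
whose set of minima belongs to `𝓕`. -/
def familyProd (𝓕 𝓖 : Set (Finset ℕ)) : Set (Finset ℕ) :=
  {E | ∃ (n : ℕ) (G : Fin n → Finset ℕ) (hG : ∀ i, (G i).Nonempty),
    (∀ i, G i ∈ 𝓖) ∧ (∀ i j, i < j → ∀ x ∈ G i, ∀ y ∈ G j, x < y) ∧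
    Finset.univ.image (fun i => (G i).min' (hG i)) ∈ 𝓕 ∧ E = Finset.univ.biUnion G}

/-- `𝓢₀`: the empty set and the singletons of positive integers. -/
def schreierZero : Set (Finset ℕ) := {F | F = ∅ ∨ ∃ n, 1 ≤ n ∧ F = {n}}

/-- `𝓢₁`: the empty set and the sets `F` of positive integers with `|F| ≤ min F`. -/
def schreierOne : Set (Finset ℕ) := {F | ∀ n ∈ F, F.card ≤ n}

/-- A choice, for every countable limit ordinal `l`, of a strictly increasing sequence of
ordinals with supremum `l` (the term `s l n` is the one with number `n + 1`). -/
def IsLadder (s : Ordinal.{0} → ℕ → Ordinal.{0}) : Prop :=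
  ∀ l : Ordinal.{0}, Order.IsSuccLimit l → l < Ordinal.omega 1 →
    StrictMono (s l) ∧ (∀ n, s l n < l) ∧ ∀ b < l, ∃ n, b < s l n

/-- The Schreier family `𝓢_α`, built along the sequences `s` at limit ordinals. At a limit `l` it
consists of the sets `F ≥ n + 1` that belong to the family of the ordinal `s l n`, for some `n`. -/
def schreier (s : Ordinal.{0} → ℕ → Ordinal.{0}) (a : Ordinal.{0}) : Set (Finset ℕ) :=
  Ordinal.limitRecOn a schreierZero (fun _ 𝓢 => familyProd schreierOne 𝓢)
    (fun l _ 𝓢 => {F | ∃ (n : ℕ) (h : s l n < l), F ∈ 𝓢 (s l n) h ∧ ∀ i ∈ F, n + 1 ≤ i})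

theorem schreier_zero (s : Ordinal.{0} → ℕ → Ordinal.{0}) : schreier s 0 = schreierZero :=
  Ordinal.limitRecOn_zero ..

theorem schreier_succ (s : Ordinal.{0} → ℕ → Ordinal.{0}) (a : Ordinal.{0}) :
    schreier s (a + 1) = familyProd schreierOne (schreier s a) :=
  Ordinal.limitRecOn_add_one ..

theorem schreier_limit (s : Ordinal.{0} → ℕ → Ordinal.{0}) (hs : IsLadder s) (l : Ordinal.{0})
    (hl : Order.IsSuccLimit l) (hl1 : l < Ordinal.omega 1) :
    schreier s l = {F | ∃ n : ℕ, F ∈ schreier s (s l n) ∧ ∀ i ∈ F, n + 1 ≤ i} := by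
  have h : schreier s l =
      {F | ∃ (n : ℕ) (_ : s l n < l), F ∈ schreier s (s l n) ∧ ∀ i ∈ F, n + 1 ≤ i} :=
    Ordinal.limitRecOn_limit _ _ _ _ hl
  rw [h]
  ext F
  constructor
  · rintro ⟨n, _, hn⟩
    exact ⟨n, hn⟩
  · rintro ⟨n, hn⟩
    exact ⟨n, (hs l hl hl1).2.1 n, hn⟩

/-! ### Distortion -/

section Distortion

variable {X : Type*} [NormedAddCommGroup X] [NormedSpace ℝ X]

/-- `N` is an equivalent norm on `X`. -/
def IsEquivNorm (N : Seminorm ℝ X) : Prop :=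
  ∃ c C : ℝ, 0 < c ∧ 0 < C ∧ ∀ x, c * ‖x‖ ≤ N x ∧ N x ≤ C * ‖x‖

/-- `Y` is a closed infinite-dimensional subspace. -/
def IsSubspace (Y : Submodule ℝ X) : Prop :=
  IsClosed (Y : Set X) ∧ ¬ FiniteDimensional ℝ Y

/-- The distortion `d(Y, N)`: the infimum, over the closed infinite-dimensional subspaces `Z`
of `Y`, of the supremum of `N x / N y` over the unit vectors `x, y` of `Z`. -/
def distortion (Y : Submodule ℝ X) (N : Seminorm ℝ X) : ℝ≥0∞ :=
  ⨅ (Z : Submodule ℝ X) (_ : IsSubspace Z) (_ : Z ≤ Y),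
    ⨆ (x ∈ Z) (y ∈ Z) (_ : ‖x‖ = 1) (_ : ‖y‖ = 1), ENNReal.ofReal (N x / N y)

variable (X) in
/-- `X` is of `D`-bounded distortion. -/
def BoundedDistortion (D : ℝ) : Prop :=
  ∀ N : Seminorm ℝ X, IsEquivNorm N → ∀ Y : Submodule ℝ X, IsSubspace Y →
    distortion Y N ≤ ENNReal.ofReal D

variable (X) in
/-- Some subspace of `X` is isomorphic to `ℓ₁`. -/
def ContainsEll1 : Prop :=
  ∃ Y : Submodule ℝ X, Nonempty (Y ≃L[ℝ] lp (fun _ : ℕ => ℝ) 1)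

end Distortion

/-! ### Bases, blocks and restrictions

Sequences are indexed by `ℕ`, so the term with Lean index `i` has number `i + 1` in the usual
enumeration by positive integers. -/

section Blocks

variable {X : Type*} [NormedAddCommGroup X] [NormedSpace ℝ X]

/-- The set of Lean indices of the nonzero coordinates of `x`. -/
def supp (e : SchauderBasis ℝ X) (x : X) : Set ℕ := {i | e.coord i x ≠ 0}

/-- `X` is an asymptotic `ℓ₁` space with respect to the basis `e`: for some `C`, all `n` and all
finitely supported `e_n ≤ x 1 < ⋯ < x n`, one has `‖∑ x i‖ ≥ (1 / C) ∑ ‖x i‖`. -/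
def IsAsymptoticEll1 (e : SchauderBasis ℝ X) : Prop :=
  ∃ C : ℝ, 0 < C ∧ ∀ (n : ℕ) (x : Fin n → X),
    (∀ i, x i ∈ Submodule.span ℝ (Set.range e.basis)) →
    (∀ i, ∀ p ∈ supp e (x i), n ≤ p + 1) →
    (∀ i j, i < j → ∀ p ∈ supp e (x i), ∀ q ∈ supp e (x j), p < q) →
    (1 / C) * ∑ i, ‖x i‖ ≤ ‖∑ i, x i‖

/-- `v` is a block basis of `u`. -/
def IsBlockBasis (v u : ℕ → X) : Prop :=
  ∃ (p : ℕ → ℕ) (a : ℕ → ℝ), StrictMono p ∧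
    ∀ j, v j = ∑ i ∈ Finset.Ico (p j) (p (j + 1)), a i • u i ∧ v j ≠ 0

/-- `x = ∑ a i • w i`, as the limit of the partial sums. -/
def IsExpansion (w : ℕ → X) (a : ℕ → ℝ) (x : X) : Prop :=
  Filter.Tendsto (fun n => ∑ i ∈ Finset.range n, a i • w i) Filter.atTop (nhds x)

open scoped Classical in
/-- The coefficients of `x` with respect to `w`, for `x` that has an expansion. -/
def coeff (w : ℕ → X) (x : X) : ℕ → ℝ :=
  if h : ∃ a, IsExpansion w a x then h.choose else 0

/-- The restriction `E x = ∑ i ∈ E, a i • w i` of `x = ∑ a i • w i`. -/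
def restrict (w : ℕ → X) (E : Finset ℕ) (x : X) : X := ∑ i ∈ E, coeff w x i • w i

/-- The closed linear span `[z_i]_{i ≥ k}`, where `z_i` is the term of number `i`. -/
def tailSpan (z : ℕ → X) (k : ℕ) : Submodule ℝ X :=
  (Submodule.span ℝ (z '' {i | k ≤ i + 1})).topologicalClosure

/-- The intervals `E i = [l i, r i]` of Lean indices are successive, and the set of the numbers
`min E i` (the successors of the Lean indices `l i`) belongs to `𝓕`. -/
structure IsAdmissible (𝓕 : Set (Finset ℕ)) {m : ℕ} (l r : Fin m → ℕ) : Prop where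
  nonempty : ∀ i, l i ≤ r i
  successive : ∀ i j, i < j → r i < l j
  mem : Finset.univ.image (fun i => l i + 1) ∈ 𝓕

/-- `sup { t * ∑ ‖E i x‖ : (E i) is an 𝓕-admissible sequence of intervals }`, restrictions being
taken with respect to `w`. -/
def admissibleSup (𝓕 : Set (Finset ℕ)) (w : ℕ → X) (t : ℝ) (x : X) : ℝ≥0∞ :=
  ⨆ (m : ℕ) (l : Fin m → ℕ) (r : Fin m → ℕ) (_ : IsAdmissible 𝓕 l r),
    ENNReal.ofReal (t * ∑ i, ‖restrict w (Finset.Icc (l i) (r i)) x‖)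

/-- Coordinate functionals of a block basis, with the expansions that they give. -/
theorem IsBlockBasis.exists_functionals (e : SchauderBasis ℝ X) {w : ℕ → X}
    (hw : IsBlockBasis w e.basis) : ∃ f : ℕ → (X →L[ℝ] ℝ),
      (∀ i j, f i (w j) = if i = j then 1 else 0) ∧
      ∀ x ∈ (Submodule.span ℝ (Set.range w)).topologicalClosure,
        IsExpansion w (fun i => f i x) x := by
  obtain ⟨p, a, hp, hw⟩ := hw
  have hc : ∀ q j, e.coord q (w j) = if q ∈ Finset.Ico (p j) (p (j + 1)) then a q else 0 := by
    intro q j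
    rw [(hw j).1]
    simp [e.ortho, Pi.single_apply]
  have hq : ∀ j, ∃ q, e.coord q (w j) ≠ 0 := by
    intro j
    by_contra h
    push Not at h
    apply (hw j).2
    have h1 := SchauderBasis.tendsto_proj e (w j)
    simp only [SchauderBasis.proj_apply, h, zero_smul, Finset.sum_const_zero] at h1
    exact (tendsto_nhds_unique h1 tendsto_const_nhds)
  choose q hq using hq
  have hqm : ∀ j, p j ≤ q j ∧ q j < p (j + 1) := by
    intro j
    have := hq j
    rw [hc] at this
    by_contra h
    apply this
    rw [if_neg]
    simpa using h
  have hdisj : ∀ i j, p j ≤ q i → q i < p (j + 1) → i = j := by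
    intro i j h1 h2
    have h3 := hqm i
    have a1 : i < j + 1 := by
      by_contra h
      have := hp.monotone (not_lt.mp h)
      omega
    have a2 : j < i + 1 := by
      by_contra h
      have := hp.monotone (not_lt.mp h)
      omega
    omega
  let f : ℕ → (X →L[ℝ] ℝ) := fun j => (e.coord (q j) (w j))⁻¹ • e.coord (q j)
  have hf : ∀ i j, f i (w j) = if i = j then 1 else 0 := by
    intro i j
    by_cases hij : i = j
    · subst hij
      simp [f, hq i]
    · have : e.coord (q i) (w j) = 0 := by
        rw [hc, if_neg]
        intro hm
        rw [Finset.mem_Ico] at hm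
        exact hij (hdisj i j hm.1 hm.2)
      simp [f, this, hij]
  refine ⟨f, hf, ?_⟩
  have key : ∀ m, ∀ x ∈ (Submodule.span ℝ (Set.range w)).topologicalClosure,
      ∑ i ∈ Finset.range m, f i x • w i = SchauderBasis.proj e (p m) x := by
    intro m
    let T : X →L[ℝ] X := ∑ i ∈ Finset.range m, (f i).smulRight (w i) - SchauderBasis.proj e (p m)
    have hT : (Submodule.span ℝ (Set.range w)).topologicalClosure ≤ T.toLinearMap.ker := by
      apply Submodule.topologicalClosure_minimal
      · rw [Submodule.span_le]
        rintro _ ⟨j, rfl⟩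
        have h1 : SchauderBasis.proj e (p m) (w j) = if j < m then w j else 0 := by
          conv_lhs => rw [(hw j).1]
          rw [map_sum]
          simp only [map_smul, SchauderBasis.proj_apply_basis_mem]
          split_ifs with hjm
          · conv_rhs => rw [(hw j).1]
            refine Finset.sum_congr rfl fun i hi => ?_
            rw [Finset.mem_Ico] at hi
            have := hp.monotone (show j + 1 ≤ m from hjm)
            rw [if_pos (by omega)]
          · refine Finset.sum_eq_zero fun i hi => ?_
            rw [Finset.mem_Ico] at hi
            have := hp.monotone (not_lt.mp hjm)
            rw [if_neg (by omega), smul_zero]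
        simp [T, h1, hf, -SchauderBasis.proj_apply]
      · exact T.isClosed_ker
    intro x hx
    have h2 := hT hx
    simpa [T, sub_eq_zero, -SchauderBasis.proj_apply] using h2
  intro x hx
  unfold IsExpansion
  simp only [fun m => key m x hx]
  exact (SchauderBasis.tendsto_proj e x).comp hp.tendsto_atTop

/-- Expansions with respect to a block basis are unique. -/
theorem IsBlockBasis.coeff_eq (e : SchauderBasis ℝ X) {w : ℕ → X}
    (hw : IsBlockBasis w e.basis) {a : ℕ → ℝ} {x : X} (h : IsExpansion w a x) :
    coeff w x = a := by
  obtain ⟨f, hf, -⟩ := hw.exists_functionals e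
  have uniq : ∀ b, IsExpansion w b x → ∀ j, f j x = b j := by
    intro b hb j
    have h1 := ((f j).continuous.tendsto x).comp hb
    refine tendsto_nhds_unique h1 (tendsto_const_nhds.congr' ?_)
    filter_upwards [Filter.eventually_gt_atTop j] with n hn
    simp [hf, hn]
  have hex : ∃ a, IsExpansion w a x := ⟨a, h⟩
  funext j
  rw [coeff, dif_pos hex, ← uniq _ hex.choose_spec, uniq a h]

/-- Every vector of the closed linear span of a block basis is the sum of its expansion. -/
theorem IsBlockBasis.isExpansion_coeff (e : SchauderBasis ℝ X) {w : ℕ → X}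
    (hw : IsBlockBasis w e.basis) {x : X}
    (hx : x ∈ (Submodule.span ℝ (Set.range w)).topologicalClosure) :
    IsExpansion w (coeff w x) x := by
  obtain ⟨f, -, hf⟩ := hw.exists_functionals e
  rw [hw.coeff_eq e (hf x hx)]
  exact hf x hx

end Blocks

end AsymptoticEll1

end

open AsymptoticEll1

open scoped ENNReal
open AsymptoticEll1

noncomputable section

namespace AsymptoticEll1

/-! For a block sequence `w` and a family `𝓕`, write δ(𝓕) for `lowerConst w 𝓕`, the best constant
with which `𝓕`-admissible blocks far out satisfy a lower ℓ₁ estimate. It can only grow on passing to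
blocks, and δ(𝓕)δ(𝓖) ≤ δ(𝓕[𝓖]). Diagonalizing (`exists_stable`) gives block sequences on which
countably many of these constants no longer change on further blocks. For such stable sequences,
families that embed into each other by strictly increasing maps of ℕ have equal constants. Hence
𝓢_{α·n} may be exchanged with the n-fold power of 𝓢_α, although the two families differ.

The engine is `BoundedDistortion.exists_sch_estimates`. Let δ = δ(𝓢_γ) > 0 on a stable `w`, and let
N(x) be the supremum of the 𝓢_γ-admissible sums of x, an equivalent norm on a tail. Stability says
that a lower estimate better than δ fails on every block subspace, so each of them contains vectors
with N(y) ≥ τ‖y‖ whenever τδ < 1 (`exists_large`). Conversely, if κ^m δ(𝓢_γ^m) is unbounded in m,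
each block subspace contains nonzero vectors with N(y) ≤ κ‖y‖ (`exists_small`). Otherwise one could
split a vector, then its pieces, and so on m times, and reach an 𝓢_γ^m-admissible sum of order
κ^m‖y‖, whereas such sums are at most a constant times ‖y‖/δ(𝓢_γ^m). Cutting at arbitrary places
would leave the block subspace, so the cuts are aligned with the blocks, and the error is controlled
by starting from a vector with uniformly small mass on 𝓢_γ^m-admissible sets of blocks
(`hasFlat_famPow`). Bounded distortion makes N proportional to the norm up to 5D/2 on a further
block subspace, and one large and one small vector then pin N down there: τ‖x‖ ≤ (5D/2)N(x) and N(x)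
≤ (5D/2)κ‖x‖.

If the constants δ(𝓢_γ^m) do not decay exponentially in m, then κ = 11/10 is allowed and the engine
gives δ(𝓢_γ) ≥ 1/(8D²). Were this so for every countable γ, uniform lower ℓ₁ estimates of all
countable orders would hold, and separability together with the regularity of ω₁ would produce a
copy of ℓ₁ (`containsEll1_of_lowerEst`). So there is a least α for which exponential decay occurs on
some stable `w`. Minimality makes δ(𝓢_α) positive and makes α additively indecomposable, because
decay for α ≤ β·2 forces decay for β; hence α = ω^β₀. Let θ be the exact exponential rate. For every
n the engine applies to 𝓢_{α·n} with τ = 9/(10θⁿ) and κ = 11/(10θⁿ), and a diagonal sequence over n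
gives `z`. -/

/-! ### Regular families of finite sets -/

/-- A family of finite sets that contains the singletons and is closed under passing to subsets and
under moving the elements to the right. -/
def IsReg (𝓕 : Set (Finset ℕ)) : Prop :=
  (∀ A ∈ 𝓕, ∀ (B : Finset ℕ) (g : ℕ → ℕ), StrictMonoOn g B → (∀ b ∈ B, g b ∈ A ∧ g b ≤ b) →
    B ∈ 𝓕) ∧ ∀ n, {n} ∈ 𝓕

namespace IsReg

variable {𝓕 𝓖 : Set (Finset ℕ)} {A B : Finset ℕ}

theorem mono (h : IsReg 𝓕) (hA : A ∈ 𝓕) (hB : B ⊆ A) : B ∈ 𝓕 :=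
  h.1 A hA B id (strictMono_id.strictMonoOn _) fun _ hb => ⟨hB hb, le_rfl⟩

theorem empty (h : IsReg 𝓕) : ∅ ∈ 𝓕 := h.mono (h.2 0) (Finset.empty_subset _)

theorem image (h : IsReg 𝓕) (hA : A ∈ 𝓕) {f : ℕ → ℕ} (hf : StrictMonoOn f A)
    (hle : ∀ a ∈ A, a ≤ f a) : A.image f ∈ 𝓕 := by
  have hinv : ∀ a ∈ A, Function.invFunOn f A (f a) = a := fun a ha =>
    hf.injOn (Function.invFunOn_mem ⟨a, ha, rfl⟩) ha (Function.invFunOn_eq ⟨a, ha, rfl⟩)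
  refine h.1 A hA _ (Function.invFunOn f A) ?_ ?_
  · rintro x hx y hy hxy
    simp only [Finset.coe_image, Set.mem_image, Finset.mem_coe] at hx hy
    obtain ⟨a, ha, rfl⟩ := hx
    obtain ⟨b, hb, rfl⟩ := hy
    rw [hinv a ha, hinv b hb]
    exact (hf.lt_iff_lt ha hb).1 hxy
  · intro b hb
    obtain ⟨a, ha, rfl⟩ := Finset.mem_image.1 hb
    rw [hinv a ha]
    exact ⟨ha, hle a ha⟩

theorem image_of_strictMono (h : IsReg 𝓕) (hA : A ∈ 𝓕) {f : ℕ → ℕ} (hf : StrictMono f) :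
    A.image f ∈ 𝓕 :=
  h.image hA (hf.strictMonoOn _) fun _ _ => hf.le_apply

/-- A set is in a regular family if some member of the family has an element below each of its
elements and an element between any two of them. -/
theorem of_interlaced (h : IsReg 𝓕) (hA : A ∈ 𝓕) (h1 : ∀ b ∈ B, ∃ s ∈ A, s ≤ b)
    (h2 : ∀ b ∈ B, ∀ b' ∈ B, b < b' → ∃ s ∈ A, b < s ∧ s ≤ b') : B ∈ 𝓕 := by
  -- The required map sends `b` to the largest element of `A` not exceeding `b`; the two interlacing
  -- hypotheses say that it exists and that it increases strictly.
  have key : ∀ b ∈ B, (A.filter (· ≤ b)).sup id ∈ A.filter (· ≤ b) := by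
    intro b hb
    obtain ⟨s, hs, hsb⟩ := h1 b hb
    have := Finset.exists_mem_eq_sup (A.filter (· ≤ b)) ⟨s, by simp [hs, hsb]⟩ id
    obtain ⟨i, hi, hi'⟩ := this
    rw [hi']
    exact hi
  refine h.1 A hA B (fun b => (A.filter (· ≤ b)).sup id) ?_ ?_
  · intro b hb b' hb' hlt
    obtain ⟨s, hs, hbs, hsb⟩ := h2 b hb b' hb' hlt
    have h3 := (Finset.mem_filter.1 (key b hb)).2
    have h4 : s ≤ (A.filter (· ≤ b')).sup id :=
      Finset.le_sup (f := id) (by simp [hs, hsb])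
    exact lt_of_le_of_lt h3 (lt_of_lt_of_le hbs h4)
  · intro b hb
    exact Finset.mem_filter.1 (key b hb)

theorem mem_of_card_le_one (h : IsReg 𝓕) (hA : A.card ≤ 1) : A ∈ 𝓕 := by
  rcases Finset.card_le_one_iff_subset_singleton.1 hA with ⟨x, hx⟩
  exact h.mono (h.2 x) hx

end IsReg

/-! ### Products of families -/

section Prod

variable {𝓕 𝓖 𝓗 : Set (Finset ℕ)}

/-- The pieces are encoded as the fibres of a monotone labelling. A label only has to lie below the
points of its fibre instead of being their minimum, because `𝓕` allows the set of labels to be moved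
right to the set of minima. Products are handled through labels from here on. -/
theorem mem_familyProd_of_label (h𝓕 : IsReg 𝓕) {E : Finset ℕ} (h : ℕ → ℕ)
    (hmono : MonotoneOn h E) (hle : ∀ x ∈ E, h x ≤ x) (him : E.image h ∈ 𝓕)
    (hfib : ∀ s, E.filter (fun x => h x = s) ∈ 𝓖) : E ∈ familyProd 𝓕 𝓖 := by
  set ι := (E.image h).orderEmbOfFin rfl with hι
  have hmem : ∀ i, ι i ∈ E.image h := fun i => Finset.orderEmbOfFin_mem _ rfl i
  have hG : ∀ i, (E.filter (fun x => h x = ι i)).Nonempty := by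
    intro i
    obtain ⟨x, hx, hxi⟩ := Finset.mem_image.1 (hmem i)
    exact ⟨x, Finset.mem_filter.2 ⟨hx, hxi⟩⟩
  refine ⟨_, fun i => E.filter (fun x => h x = ι i), hG, fun i => hfib _, ?_, ?_, ?_⟩
  · intro i j hij x hx y hy
    rw [Finset.mem_filter] at hx hy
    by_contra hxy
    have h1 := hmono hy.1 hx.1 (not_lt.1 hxy)
    rw [hx.2, hy.2] at h1
    exact absurd hij (not_lt.2 (ι.le_iff_le.1 h1))
  · have hm : ∀ i, (E.filter (fun x => h x = ι i)).min' (hG i) ∈ E ∧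
        h ((E.filter (fun x => h x = ι i)).min' (hG i)) = ι i := fun i =>
      Finset.mem_filter.1 (Finset.min'_mem _ (hG i))
    refine h𝓕.1 _ him _ h ?_ ?_
    · intro x hx y hy hxy
      simp only [Finset.coe_image, Set.mem_image, Finset.coe_univ, Set.mem_univ, true_and] at hx hy
      obtain ⟨i, rfl⟩ := hx
      obtain ⟨j, rfl⟩ := hy
      refine lt_of_le_of_ne (hmono (hm i).1 (hm j).1 hxy.le) fun heq => ?_
      rw [(hm i).2, (hm j).2] at heq
      have := ι.injective heq
      subst this
      exact lt_irrefl _ hxy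
    · intro b hb
      simp only [Finset.mem_image, Finset.mem_univ, true_and] at hb
      obtain ⟨i, rfl⟩ := hb
      exact ⟨Finset.mem_image_of_mem _ (hm i).1, hle _ (hm i).1⟩
  · ext x
    simp only [Finset.mem_biUnion, Finset.mem_univ, true_and, Finset.mem_filter]
    constructor
    · intro hx
      have : h x ∈ Set.range ι := by
        rw [hι, Finset.range_orderEmbOfFin]
        exact Finset.mem_coe.2 (Finset.mem_image_of_mem h hx)
      obtain ⟨i, hi⟩ := this
      exact ⟨i, hx, hi.symm⟩
    · rintro ⟨i, hx, -⟩
      exact hx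

/-- Converse encoding: the label of a point is the minimum of its piece, so labels are idempotent
and belong to `E`. -/
theorem exists_label (h𝓖 : IsReg 𝓖) {E : Finset ℕ} (hE : E ∈ familyProd 𝓕 𝓖) :
    ∃ h : ℕ → ℕ, MonotoneOn h E ∧ (∀ x ∈ E, h x ≤ x ∧ h x ∈ E ∧ h (h x) = h x) ∧
      E.image h ∈ 𝓕 ∧ ∀ s, E.filter (fun x => h x = s) ∈ 𝓖 := by
  classical
  obtain ⟨n, G, hG, hGm, hlt, him, rfl⟩ := hE
  let h : ℕ → ℕ := fun x => if hx : ∃ i, x ∈ G i then (G hx.choose).min' (hG _) else 0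
  have huniq : ∀ i j x, x ∈ G i → x ∈ G j → i = j := by
    intro i j x hi hj
    rcases lt_trichotomy i j with hij | hij | hij
    · exact absurd (hlt i j hij x hi x hj) (lt_irrefl _)
    · exact hij
    · exact absurd (hlt j i hij x hj x hi) (lt_irrefl _)
  have hh : ∀ i x, x ∈ G i → h x = (G i).min' (hG i) := by
    intro i x hx
    have hex : ∃ i, x ∈ G i := ⟨i, hx⟩
    have := huniq _ _ _ hex.choose_spec hx
    simp only [h, dif_pos hex]
    congr 1
    rw [this]
  have hmin : ∀ i, h ((G i).min' (hG i)) = (G i).min' (hG i) := fun i =>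
    hh i _ (Finset.min'_mem _ _)
  refine ⟨h, ?_, ?_, ?_, ?_⟩
  · intro x hx y hy hxy
    simp only [Finset.coe_biUnion, Set.mem_iUnion, Finset.mem_coe] at hx hy
    obtain ⟨i, -, hi⟩ := hx
    obtain ⟨j, -, hj⟩ := hy
    rw [hh i x hi, hh j y hj]
    rcases lt_trichotomy i j with hij | hij | hij
    · exact (hlt i j hij _ (Finset.min'_mem _ _) _ (Finset.min'_mem _ _)).le
    · subst hij; exact le_rfl
    · exact absurd (hlt j i hij y hj x hi) (not_lt.2 hxy)
  · intro x hx
    simp only [Finset.mem_biUnion, Finset.mem_univ, true_and] at hx ⊢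
    obtain ⟨i, hi⟩ := hx
    rw [hh i x hi]
    exact ⟨Finset.min'_le _ _ hi, ⟨i, Finset.min'_mem _ _⟩, hmin i⟩
  · convert him using 1
    ext y
    simp only [Finset.mem_image, Finset.mem_biUnion, Finset.mem_univ, true_and]
    constructor
    · rintro ⟨x, ⟨i, hi⟩, rfl⟩
      exact ⟨i, (hh i x hi).symm⟩
    · rintro ⟨i, rfl⟩
      exact ⟨_, ⟨i, Finset.min'_mem _ _⟩, hmin i⟩
  · intro s
    by_cases hs : ∃ i, (G i).min' (hG i) = s
    · obtain ⟨i, rfl⟩ := hs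
      refine h𝓖.mono (hGm i) ?_
      intro x hx
      simp only [Finset.mem_filter, Finset.mem_biUnion, Finset.mem_univ, true_and] at hx
      obtain ⟨⟨j, hj⟩, hx⟩ := hx
      rw [hh j x hj] at hx
      have := huniq j i _ (Finset.min'_mem _ (hG j)) (hx ▸ Finset.min'_mem _ _)
      exact this ▸ hj
    · convert h𝓖.empty
      rw [Finset.filter_eq_empty_iff]
      intro x hx hxs
      simp only [Finset.mem_biUnion, Finset.mem_univ, true_and] at hx
      obtain ⟨i, hi⟩ := hx
      exact hs ⟨i, (hh i x hi).symm.trans hxs⟩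

theorem IsReg.prod (h𝓕 : IsReg 𝓕) (h𝓖 : IsReg 𝓖) : IsReg (familyProd 𝓕 𝓖) := by
  constructor
  · intro E hE B g hg hgE
    obtain ⟨h, hmono, hle, him, hfib⟩ := exists_label h𝓖 hE
    refine mem_familyProd_of_label h𝓕 (fun x => h (g x)) ?_ ?_ ?_ ?_
    · intro x hx y hy hxy
      exact hmono (hgE x hx).1 (hgE y hy).1 (hg.monotoneOn hx hy hxy)
    · intro x hx
      exact (hle _ (hgE x hx).1).1.trans (hgE x hx).2
    · refine h𝓕.mono him ?_
      intro y hy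
      obtain ⟨x, hx, rfl⟩ := Finset.mem_image.1 hy
      exact Finset.mem_image_of_mem _ (hgE x hx).1
    · intro s
      refine h𝓖.1 _ (hfib s) _ g (hg.mono (Finset.coe_subset.2 (Finset.filter_subset _ _))) ?_
      intro b hb
      rw [Finset.mem_filter] at hb
      exact ⟨Finset.mem_filter.2 ⟨(hgE b hb.1).1, hb.2⟩, (hgE b hb.1).2⟩
  · intro n
    refine mem_familyProd_of_label h𝓕 id (monotone_id.monotoneOn _) (fun _ _ => le_rfl) ?_ ?_
    · simpa using h𝓕.2 n
    · intro s
      exact h𝓖.mono (h𝓖.2 n) (Finset.filter_subset _ _)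

theorem subset_familyProd_right (h𝓕 : IsReg 𝓕) (h𝓖 : IsReg 𝓖) : 𝓖 ⊆ familyProd 𝓕 𝓖 := by
  intro E hE
  by_cases hne : E.Nonempty
  · refine mem_familyProd_of_label h𝓕 (fun _ => E.min' hne) (fun _ _ _ _ _ => le_rfl)
      (fun x hx => Finset.min'_le _ _ hx) ?_ fun s => h𝓖.mono hE (Finset.filter_subset _ _)
    exact h𝓕.mem_of_card_le_one (Finset.card_le_one.2 (by simp +contextual))
  · rw [Finset.not_nonempty_iff_eq_empty.1 hne]
    exact (h𝓕.prod h𝓖).empty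

theorem subset_familyProd_left (h𝓕 : IsReg 𝓕) (h𝓖 : IsReg 𝓖) : 𝓕 ⊆ familyProd 𝓕 𝓖 := by
  intro E hE
  refine mem_familyProd_of_label h𝓕 id (monotone_id.monotoneOn _) (fun _ _ => le_rfl)
    (by simpa using hE) fun s => h𝓖.mem_of_card_le_one (Finset.card_le_one.2 ?_)
  simp +contextual

/-- From left to right, label a point by its inner label within its outer fibre; the outer labelling
then groups these inner labels. From right to left, compose the two labellings. -/
theorem familyProd_assoc (h𝓕 : IsReg 𝓕) (h𝓖 : IsReg 𝓖) (h𝓗 : IsReg 𝓗) :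
    familyProd 𝓕 (familyProd 𝓖 𝓗) = familyProd (familyProd 𝓕 𝓖) 𝓗 := by
  ext E
  constructor
  · intro hE
    obtain ⟨h, hmono, hle, him, hfib⟩ := exists_label (h𝓖.prod h𝓗) hE
    choose k kmono kle kim kfib using fun s => exists_label h𝓗 (hfib s)
    have hk : ∀ x ∈ E, k (h x) x ≤ x ∧ k (h x) x ∈ E ∧ h (k (h x) x) = h x := by
      intro x hx
      have := kle (h x) x (Finset.mem_filter.2 ⟨hx, rfl⟩)
      exact ⟨this.1, (Finset.mem_filter.1 this.2.1).1, (Finset.mem_filter.1 this.2.1).2⟩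
    refine mem_familyProd_of_label (h𝓕.prod h𝓖) (fun x => k (h x) x) ?_ (fun x hx => (hk x hx).1)
      ?_ ?_
    · intro x hx y hy hxy
      rcases (hmono hx hy hxy).lt_or_eq with hlt | heq
      · by_contra hcon
        have := hmono (hk y hy).2.1 (hk x hx).2.1 (not_le.1 hcon).le
        rw [(hk x hx).2.2, (hk y hy).2.2] at this
        exact absurd hlt (not_lt.2 this)
      · simp only [heq]
        exact kmono (h y) (by simp [Finset.mem_coe.1 hx, heq]) (by simpa using hy) hxy
    · refine mem_familyProd_of_label h𝓕 h ?_ ?_ ?_ ?_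
      · refine hmono.mono ?_
        intro y hy
        simp only [Finset.coe_image, Set.mem_image] at hy
        obtain ⟨x, hx, rfl⟩ := hy
        exact (hk x hx).2.1
      · intro y hy
        obtain ⟨x, hx, rfl⟩ := Finset.mem_image.1 hy
        exact (hle _ (hk x hx).2.1).1
      · refine h𝓕.mono him ?_
        intro y hy
        simp only [Finset.mem_image] at hy
        obtain ⟨_, ⟨x, hx, rfl⟩, rfl⟩ := hy
        exact Finset.mem_image_of_mem _ (hk x hx).2.1
      · intro s
        refine h𝓖.mono (kim s) ?_
        intro y hy
        simp only [Finset.mem_filter, Finset.mem_image] at hy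
        obtain ⟨⟨x, hx, rfl⟩, hs⟩ := hy
        rw [(hk x hx).2.2] at hs
        exact Finset.mem_image.2 ⟨x, by simp [hx, hs], by rw [hs]⟩
    · intro t
      refine h𝓗.mono (kfib (h t) t) ?_
      intro x hx
      rw [Finset.mem_filter] at hx
      have : h t = h x := by rw [← hx.2, (hk x hx.1).2.2]
      simp only [Finset.mem_filter]
      exact ⟨⟨hx.1, this.symm⟩, by rw [this]; exact hx.2⟩
  · intro hE
    obtain ⟨k, kmono, kle, kim, kfib⟩ := exists_label h𝓗 hE
    obtain ⟨h, hmono, hle, him, hfib⟩ := exists_label h𝓖 kim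
    have hk : ∀ x ∈ E, k x ∈ E.image k := fun x hx => Finset.mem_image_of_mem _ hx
    refine mem_familyProd_of_label h𝓕 (fun x => h (k x)) ?_ ?_ ?_ ?_
    · intro x hx y hy hxy
      exact hmono (hk x hx) (hk y hy) (kmono hx hy hxy)
    · intro x hx
      exact (hle _ (hk x hx)).1.trans (kle x hx).1
    · convert him using 1
      rw [Finset.image_image]
      rfl
    · intro s
      refine mem_familyProd_of_label h𝓖 k
        (kmono.mono (Finset.coe_subset.2 (Finset.filter_subset _ _))) ?_ ?_ ?_
      · intro x hx
        exact (kle x (Finset.mem_filter.1 hx).1).1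
      · refine h𝓖.mono (hfib s) ?_
        intro y hy
        obtain ⟨x, hx, rfl⟩ := Finset.mem_image.1 hy
        rw [Finset.mem_filter] at hx ⊢
        exact ⟨hk x hx.1, hx.2⟩
      · intro t
        refine h𝓗.mono (kfib t) ?_
        intro x hx
        simp only [Finset.mem_filter] at hx ⊢
        exact ⟨hx.1.1, hx.2⟩

/-- The image of a product under a strictly increasing map. -/
theorem image_mem_familyProd {𝓕' 𝓖' : Set (Finset ℕ)} (h𝓕' : IsReg 𝓕') (h𝓖 : IsReg 𝓖)
    (h𝓖' : IsReg 𝓖')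
    {m : ℕ → ℕ} (hm : StrictMono m) {E : Finset ℕ} (hE : E ∈ familyProd 𝓕 𝓖)
    (h1 : ∀ A ∈ 𝓕, A ⊆ E → A.image m ∈ 𝓕') (h2 : ∀ A ∈ 𝓖, A ⊆ E → A.image m ∈ 𝓖') :
    E.image m ∈ familyProd 𝓕' 𝓖' := by
  obtain ⟨h, hmono, hle, him, hfib⟩ := exists_label h𝓖 hE
  have hinv : ∀ x, Function.invFun m (m x) = x := Function.leftInverse_invFun hm.injective
  refine mem_familyProd_of_label h𝓕' (fun x => m (h (Function.invFun m x))) ?_ ?_ ?_ ?_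
  · intro x hx y hy hxy
    simp only [Finset.coe_image, Set.mem_image] at hx hy
    obtain ⟨a, ha, rfl⟩ := hx
    obtain ⟨b, hb, rfl⟩ := hy
    simp only [hinv]
    exact hm.monotone (hmono ha hb (hm.le_iff_le.1 hxy))
  · intro x hx
    obtain ⟨a, ha, rfl⟩ := Finset.mem_image.1 hx
    simp only [hinv]
    exact hm.monotone (hle a ha).1
  · have : (E.image m).image (fun x => m (h (Function.invFun m x))) = (E.image h).image m := by
      simp only [Finset.image_image]
      refine Finset.image_congr fun a _ => ?_
      simp [hinv]
    rw [this]
    refine h1 _ him ?_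
    intro y hy
    obtain ⟨x, hx, rfl⟩ := Finset.mem_image.1 hy
    exact (hle x hx).2.1
  · intro t
    by_cases ht : ∃ s, m s = t
    · obtain ⟨s, rfl⟩ := ht
      refine h𝓖'.mono (h2 _ (hfib s) (Finset.filter_subset _ _)) ?_
      intro x hx
      rw [Finset.mem_filter] at hx
      obtain ⟨hx, hxs⟩ := hx
      obtain ⟨a, ha, rfl⟩ := Finset.mem_image.1 hx
      simp only [hinv] at hxs
      exact Finset.mem_image_of_mem _ (Finset.mem_filter.2 ⟨ha, hm.injective hxs⟩)
    · convert h𝓖'.empty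
      rw [Finset.filter_eq_empty_iff]
      intro x _ hxt
      exact ht ⟨_, hxt⟩

end Prod

/-! ### Powers of families -/

/-- `{∅} ∪ {{n}}`. -/
def singletons : Set (Finset ℕ) := {A | A.card ≤ 1}

theorem isReg_singletons : IsReg singletons := by
  constructor
  · intro A hA B g hg hgA
    exact (Finset.card_le_card_of_injOn g (fun b hb => (hgA b hb).1) hg.injOn).trans hA
  · intro n
    simp [singletons]

/-- The powers of a family for the operation `𝓕[𝓖]`. -/
def famPow (𝓕 : Set (Finset ℕ)) : ℕ → Set (Finset ℕ)
  | 0 => singletons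
  | n + 1 => familyProd 𝓕 (famPow 𝓕 n)

section Pow

variable {𝓕 𝓖 : Set (Finset ℕ)}

theorem IsReg.pow (h : IsReg 𝓕) (n : ℕ) : IsReg (famPow 𝓕 n) := by
  induction n with
  | zero => exact isReg_singletons
  | succ n ih => exact h.prod ih

theorem familyProd_singletons_left (h : IsReg 𝓕) : familyProd singletons 𝓕 = 𝓕 := by
  refine Set.Subset.antisymm ?_ (subset_familyProd_right isReg_singletons h)
  intro E hE
  obtain ⟨k, hmono, hle, him, hfib⟩ := exists_label h hE
  by_cases hne : E.Nonempty
  · obtain ⟨x, hx⟩ := hne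
    convert hfib (k x)
    refine (Finset.filter_true_of_mem fun y hy => ?_).symm
    exact Finset.card_le_one.1 him _ (Finset.mem_image_of_mem _ hy) _ (Finset.mem_image_of_mem _ hx)
  · rw [Finset.not_nonempty_iff_eq_empty.1 hne]
    exact h.empty

theorem familyProd_singletons_right (h : IsReg 𝓕) : familyProd 𝓕 singletons = 𝓕 := by
  refine Set.Subset.antisymm ?_ (subset_familyProd_left h isReg_singletons)
  intro E hE
  obtain ⟨k, hmono, hle, him, hfib⟩ := exists_label isReg_singletons hE
  refine h.1 _ him E k ?_ fun b hb => ⟨Finset.mem_image_of_mem _ hb, (hle b hb).1⟩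
  intro x hx y hy hxy
  refine lt_of_le_of_ne (hmono hx hy hxy.le) fun heq => hxy.ne ?_
  exact Finset.card_le_one.1 (hfib (k x)) _ (by simpa using hx) _
    (by simpa [heq] using Finset.mem_coe.1 hy)

theorem famPow_one (h : IsReg 𝓕) : famPow 𝓕 1 = 𝓕 := familyProd_singletons_right h

theorem famPow_add (h : IsReg 𝓕) (m n : ℕ) :
    famPow 𝓕 (m + n) = familyProd (famPow 𝓕 m) (famPow 𝓕 n) := by
  induction m with
  | zero => rw [zero_add, famPow, familyProd_singletons_left (h.pow n)]
  | succ m ih =>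
    rw [Nat.succ_add, famPow, ih, familyProd_assoc h (h.pow m) (h.pow n), famPow]

theorem famPow_mul (h : IsReg 𝓕) (m n : ℕ) : famPow (famPow 𝓕 m) n = famPow 𝓕 (m * n) := by
  induction n with
  | zero => rfl
  | succ n ih => rw [famPow, ih, Nat.mul_succ, add_comm, famPow_add h]

theorem famPow_subset (h : IsReg 𝓕) {m n : ℕ} (hmn : m ≤ n) : famPow 𝓕 m ⊆ famPow 𝓕 n := by
  obtain ⟨k, rfl⟩ := Nat.exists_eq_add_of_le hmn
  rw [famPow_add h]
  exact subset_familyProd_left (h.pow m) (h.pow k)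

end Pow

/-! ### Domination of families -/

/-- Some strictly increasing map sends the members of `𝓕` to members of `𝓖`. -/
def Dominated (𝓕 𝓖 : Set (Finset ℕ)) : Prop :=
  ∃ m : ℕ → ℕ, StrictMono m ∧ ∀ A ∈ 𝓕, A.image m ∈ 𝓖

namespace Dominated

variable {𝓕 𝓖 𝓗 : Set (Finset ℕ)}

theorem refl (𝓕 : Set (Finset ℕ)) : Dominated 𝓕 𝓕 :=
  ⟨id, strictMono_id, fun A hA => by simpa using hA⟩

theorem trans (h1 : Dominated 𝓕 𝓖) (h2 : Dominated 𝓖 𝓗) : Dominated 𝓕 𝓗 := by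
  obtain ⟨m, hm, h1⟩ := h1
  obtain ⟨m', hm', h2⟩ := h2
  refine ⟨m' ∘ m, hm'.comp hm, fun A hA => ?_⟩
  rw [← Finset.image_image]
  exact h2 _ (h1 A hA)

/-- The sum of the two embeddings serves both factors: adding an increasing map only moves a set
further to the right, which regular families permit. -/
theorem prod {𝓕' 𝓖' : Set (Finset ℕ)} (h𝓕' : IsReg 𝓕') (h𝓖 : IsReg 𝓖)
    (h𝓖' : IsReg 𝓖') (h1 : Dominated 𝓕 𝓕') (h2 : Dominated 𝓖 𝓖') :
    Dominated (familyProd 𝓕 𝓖) (familyProd 𝓕' 𝓖') := by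
  obtain ⟨m, hm, h1⟩ := h1
  obtain ⟨m', hm', h2⟩ := h2
  refine ⟨fun x => m x + m' x, fun x y hxy => Nat.add_lt_add (hm hxy) (hm' hxy), fun E hE => ?_⟩
  have key : ∀ {𝓐 : Set (Finset ℕ)}, IsReg 𝓐 → ∀ {f g : ℕ → ℕ}, StrictMono f → StrictMono g →
      ∀ A : Finset ℕ, A.image f ∈ 𝓐 → A.image (fun x => f x + g x) ∈ 𝓐 := by
    intro 𝓐 hr f g hf hg A hA
    have hinv : ∀ x, Function.invFun f (f x) = x := Function.leftInverse_invFun hf.injective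
    have : A.image (fun x => f x + g x) =
        (A.image f).image (fun y => y + g (Function.invFun f y)) := by
      rw [Finset.image_image]
      refine Finset.image_congr fun a _ => ?_
      simp [hinv]
    rw [this]
    refine hr.image hA ?_ fun _ _ => Nat.le_add_right _ _
    intro x hx y hy hxy
    simp only [Finset.coe_image, Set.mem_image] at hx hy
    obtain ⟨a, ha, rfl⟩ := hx
    obtain ⟨b, hb, rfl⟩ := hy
    simp only [hinv]
    exact Nat.add_lt_add hxy (hg (hf.lt_iff_lt.1 hxy))
  refine image_mem_familyProd h𝓕' h𝓖 h𝓖' (fun x y hxy => Nat.add_lt_add (hm hxy) (hm' hxy)) hE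
    (fun A hA _ => key h𝓕' hm hm' A (h1 A hA)) fun A hA _ => ?_
  have := key h𝓖' hm' hm A (h2 A hA)
  simpa only [add_comm] using this

theorem pow (h𝓕 : IsReg 𝓕) (h𝓖 : IsReg 𝓖) (h : Dominated 𝓕 𝓖) (n : ℕ) :
    Dominated (famPow 𝓕 n) (famPow 𝓖 n) := by
  induction n with
  | zero => exact refl _
  | succ n ih => exact prod h𝓖 (h𝓕.pow n) (h𝓖.pow n) h ih

/-- Countably many dominations, of the tails `𝓕 n ∩ [n, ∞)`, by one map. -/
theorem exists_uniform (𝓕 𝓖 : ℕ → Set (Finset ℕ)) (h𝓖 : ∀ n, IsReg (𝓖 n))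
    (h : ∀ n, Dominated (𝓕 n) (𝓖 n)) (b : ℕ → ℕ) :
    ∃ m : ℕ → ℕ, StrictMono m ∧ (∀ i n, n ≤ i → b n ≤ m i) ∧
      ∀ n, ∀ A ∈ 𝓕 n, (∀ i ∈ A, n ≤ i) → A.image m ∈ 𝓖 n := by
  choose m hm hmem using h
  -- `M i` majorizes `m n i + b n` for all `n ≤ i` at once, so on subsets of `[n, ∞)` it moves
  -- points at least as far right as the `n`-th map. The summand `i` makes it strictly increasing.
  let M : ℕ → ℕ := fun i => i + ∑ n ∈ Finset.range (i + 1), (m n i + b n)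
  have hle : ∀ i n, n ≤ i → m n i + b n ≤ M i := by
    intro i n hn
    refine le_trans ?_ (Nat.le_add_left _ _)
    exact Finset.single_le_sum (f := fun n => m n i + b n) (fun _ _ => Nat.zero_le _)
      (Finset.mem_range.2 (Nat.lt_succ_of_le hn))
  have hM : StrictMono M := by
    refine strictMono_nat_of_lt_succ fun i => ?_
    have : ∑ n ∈ Finset.range (i + 1), (m n i + b n) ≤
        ∑ n ∈ Finset.range (i + 1 + 1), (m n (i + 1) + b n) := by
      refine (Finset.sum_le_sum fun n _ => ?_).trans
        (Finset.sum_le_sum_of_subset (Finset.range_mono (Nat.le_succ _)))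
      exact Nat.add_le_add_right ((hm n).monotone (Nat.le_succ i)) _
    simp only [M]
    omega
  refine ⟨M, hM, fun i n hn => (Nat.le_add_left _ _).trans (hle i n hn), fun n A hA hAn => ?_⟩
  have hinv : ∀ x, Function.invFun (m n) (m n x) = x :=
    Function.leftInverse_invFun (hm n).injective
  have : A.image M = (A.image (m n)).image (fun y => M (Function.invFun (m n) y)) := by
    rw [Finset.image_image]
    refine Finset.image_congr fun a _ => ?_
    simp [hinv]
  rw [this]
  refine (h𝓖 n).image (hmem n A hA) ?_ ?_
  · intro x hx y hy hxy
    simp only [Finset.coe_image, Set.mem_image] at hx hy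
    obtain ⟨a, ha, rfl⟩ := hx
    obtain ⟨c, hc, rfl⟩ := hy
    simp only [hinv]
    exact hM ((hm n).lt_iff_lt.1 hxy)
  · intro x hx
    obtain ⟨a, ha, rfl⟩ := Finset.mem_image.1 hx
    rw [hinv]
    exact (Nat.le_add_right _ _).trans (hle a n (hAn a ha))

end Dominated

/-! ### Schreier families in terms of indices from zero -/

/-- The Schreier family `𝓢_a`, as a family of sets of natural numbers starting with zero. -/
def sch (s : Ordinal.{0} → ℕ → Ordinal.{0}) (a : Ordinal.{0}) : Set (Finset ℕ) :=
  {A | A.image (· + 1) ∈ schreier s a}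

/-- The Schreier family `𝓢₁`, as a family of sets of natural numbers starting with zero. -/
def schOne : Set (Finset ℕ) := {A | ∀ n ∈ A, A.card ≤ n + 1}

section Sch

variable {s : Ordinal.{0} → ℕ → Ordinal.{0}}

theorem isReg_schOne : IsReg schOne := by
  constructor
  · intro A hA B g hg hgA n hn
    exact (Finset.card_le_card_of_injOn g (fun b hb => (hgA b hb).1) hg.injOn).trans
      ((hA _ (hgA n hn).1).trans (Nat.succ_le_succ (hgA n hn).2))
  · intro n
    simp [schOne]

theorem sch_zero : sch s 0 = singletons := by
  ext A
  simp only [sch, Set.mem_ofPred_eq, schreier_zero, schreierZero, singletons]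
  constructor
  · rintro (h | ⟨n, -, h⟩)
    · rw [Finset.image_eq_empty] at h
      simp [h]
    · have := congrArg Finset.card h
      rw [Finset.card_image_of_injective _ (add_left_injective 1)] at this
      simp [this]
  · intro h
    rcases Finset.eq_empty_or_nonempty A with rfl | hne
    · simp
    · obtain ⟨n, rfl⟩ := Finset.card_eq_one.1 (le_antisymm h hne.card_pos)
      exact Or.inr ⟨n + 1, by omega, by simp⟩

/-- Minima commute with translation. The truncated subtraction used to go back is an honest inverse,
because every piece consists of successors. -/
theorem image_succ_mem_familyProd {𝓕 𝓖 : Set (Finset ℕ)} {A : Finset ℕ} :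
    A.image (· + 1) ∈ familyProd 𝓕 𝓖 ↔
      A ∈ familyProd {A | A.image (· + 1) ∈ 𝓕} {A | A.image (· + 1) ∈ 𝓖} := by
  have hmin : ∀ (B : Finset ℕ) (hB : B.Nonempty) (hB' : (B.image (· + 1)).Nonempty),
      (B.image (· + 1)).min' hB' = B.min' hB + 1 := by
    intro B hB hB'
    exact Finset.min'_image (f := (· + 1)) (fun x y h => Nat.succ_le_succ h) B hB'
  constructor
  · rintro ⟨n, G, hG, h1, h2, h3, h4⟩
    have hsub : ∀ i, ((G i).image (· - 1)).image (· + 1) = G i := by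
      intro i
      rw [Finset.image_image]
      have : ∀ x ∈ G i, ((· + 1) ∘ (· - 1)) x = x := by
        intro x hx
        have hx' : x ∈ A.image (· + 1) := by
          rw [h4]
          exact Finset.mem_biUnion.2 ⟨i, Finset.mem_univ _, hx⟩
        obtain ⟨y, -, rfl⟩ := Finset.mem_image.1 hx'
        simp
      rw [Finset.image_congr (g := id) fun x hx => this x hx, Finset.image_id]
    refine ⟨n, fun i => (G i).image (· - 1), fun i => (hG i).image _, ?_, ?_, ?_, ?_⟩
    · intro i
      simpa only [Set.mem_ofPred_eq, hsub] using h1 i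
    · intro i j hij x hx y hy
      have hx' := Finset.mem_image_of_mem (· + 1) hx
      have hy' := Finset.mem_image_of_mem (· + 1) hy
      rw [hsub] at hx' hy'
      have := h2 i j hij _ hx' _ hy'
      omega
    · simp only [Set.mem_ofPred_eq, Finset.image_image]
      convert h3 using 2
      funext i
      simp only [Function.comp]
      rw [← hmin _ _ (((hG i).image _).image _)]
      congr 1
      exact hsub i
    · apply Finset.image_injective (add_left_injective 1)
      rw [h4]
      ext x
      simp only [Finset.mem_biUnion, Finset.mem_univ, true_and, Finset.mem_image]
      constructor
      · rintro ⟨i, hi⟩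
        rw [← hsub i] at hi
        obtain ⟨y, hy, rfl⟩ := Finset.mem_image.1 hi
        exact ⟨y, ⟨i, Finset.mem_image.1 hy⟩, rfl⟩
      · rintro ⟨y, ⟨i, hy⟩, rfl⟩
        refine ⟨i, ?_⟩
        rw [← hsub i]
        exact Finset.mem_image_of_mem _ (Finset.mem_image.2 hy)
  · rintro ⟨n, G, hG, h1, h2, h3, h4⟩
    refine ⟨n, fun i => (G i).image (· + 1), fun i => (hG i).image _, h1, ?_, ?_, ?_⟩
    · intro i j hij x hx y hy
      obtain ⟨x', hx', rfl⟩ := Finset.mem_image.1 hx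
      obtain ⟨y', hy', rfl⟩ := Finset.mem_image.1 hy
      exact Nat.succ_lt_succ (h2 i j hij x' hx' y' hy')
    · simp only [Set.mem_ofPred_eq, Finset.image_image] at h3
      convert h3 using 2
      funext i
      exact hmin _ (hG i) _
    · rw [h4]
      ext x
      simp only [Finset.mem_biUnion, Finset.mem_univ, true_and, Finset.mem_image]
      constructor
      · rintro ⟨y, ⟨i, hy⟩, rfl⟩
        exact ⟨i, y, hy, rfl⟩
      · rintro ⟨i, y, hy, rfl⟩
        exact ⟨y, ⟨i, hy⟩, rfl⟩

theorem sch_succ (a : Ordinal.{0}) : sch s (a + 1) = familyProd schOne (sch s a) := by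
  ext A
  have : {A : Finset ℕ | A.image (· + 1) ∈ schreierOne} = schOne := by
    ext B
    simp [schreierOne, schOne, Finset.card_image_of_injective _ (add_left_injective 1)]
  rw [sch, Set.mem_ofPred_eq, schreier_succ, image_succ_mem_familyProd, this]
  rfl

theorem sch_limit (hs : IsLadder s) {l : Ordinal.{0}} (hl : Order.IsSuccLimit l)
    (hl1 : l < Ordinal.omega 1) {A : Finset ℕ} :
    A ∈ sch s l ↔ ∃ n, A ∈ sch s (s l n) ∧ ∀ i ∈ A, n ≤ i := by
  rw [sch, Set.mem_ofPred_eq, schreier_limit s hs l hl hl1]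
  simp [sch]

theorem isReg_sch (hs : IsLadder s) {a : Ordinal.{0}} (ha : a < Ordinal.omega 1) :
    IsReg (sch s a) := by
  induction a using Ordinal.limitRecOn with
  | zero => rw [sch_zero]; exact isReg_singletons
  | add_one a ih =>
    rw [sch_succ]
    exact isReg_schOne.prod (ih ((lt_add_one a).trans ha))
  | limit l hl ih =>
    have h1 : ∀ n, IsReg (sch s (s l n)) := fun n =>
      ih _ ((hs l hl ha).2.1 n) (((hs l hl ha).2.1 n).trans ha)
    constructor
    · intro A hA B g hg hgA
      obtain ⟨n, hn, hnA⟩ := (sch_limit hs hl ha).1 hA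
      exact (sch_limit hs hl ha).2 ⟨n, (h1 n).1 A hn B g hg hgA, fun i hi =>
        (hnA _ (hgA i hi).1).trans (hgA i hi).2⟩
    · intro n
      exact (sch_limit hs hl ha).2 ⟨0, (h1 0).2 n, fun _ _ => Nat.zero_le _⟩

/-- `𝓢_b` is contained in `𝓢_c`, `b ≤ c`, up to an initial segment. -/
theorem exists_tail_sch_subset (hs : IsLadder s) {b c : Ordinal.{0}} (hbc : b ≤ c)
    (hc : c < Ordinal.omega 1) : ∃ k, ∀ A ∈ sch s b, (∀ i ∈ A, k ≤ i) → A ∈ sch s c := by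
  induction c using Ordinal.limitRecOn with
  | zero =>
    obtain rfl : b = 0 := le_antisymm hbc zero_le
    exact ⟨0, fun A hA _ => hA⟩
  | add_one c ih =>
    rcases hbc.lt_or_eq with hlt | rfl
    · have hc' := (lt_add_one c).trans hc
      obtain ⟨k, hk⟩ := ih (Order.lt_add_one_iff.1 hlt) hc'
      refine ⟨k, fun A hA hkA => ?_⟩
      rw [sch_succ]
      exact subset_familyProd_right isReg_schOne (isReg_sch hs hc') (hk A hA hkA)
    · exact ⟨0, fun A hA _ => hA⟩
  | limit l hl ih =>
    rcases hbc.lt_or_eq with hlt | rfl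
    · obtain ⟨n, hn⟩ := (hs l hl hc).2.2 b hlt
      obtain ⟨k, hk⟩ := ih _ ((hs l hl hc).2.1 n) hn.le (((hs l hl hc).2.1 n).trans hc)
      refine ⟨max k n, fun A hA hkA => (sch_limit hs hl hc).2 ⟨n, hk A hA fun i hi => ?_, ?_⟩⟩
      · exact (le_max_left _ _).trans (hkA i hi)
      · exact fun i hi => (le_max_right _ _).trans (hkA i hi)
    · exact ⟨0, fun A hA _ => hA⟩

theorem dominated_sch_of_le (hs : IsLadder s) {b c : Ordinal.{0}} (hbc : b ≤ c)
    (hc : c < Ordinal.omega 1) : Dominated (sch s b) (sch s c) := by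
  obtain ⟨k, hk⟩ := exists_tail_sch_subset hs hbc hc
  have hm : StrictMono (fun i : ℕ => i + k) := fun x y h => Nat.add_lt_add_right h k
  refine ⟨fun i => i + k, hm, fun A hA =>
    hk _ ((isReg_sch hs (hbc.trans_lt hc)).image_of_strictMono hA hm) fun i hi => ?_⟩
  obtain ⟨j, -, rfl⟩ := Finset.mem_image.1 hi
  exact Nat.le_add_left _ _

theorem add_lt_omega_one {a b : Ordinal.{0}} (ha : a < Ordinal.omega 1)
    (hb : b < Ordinal.omega 1) : a + b < Ordinal.omega 1 :=
  Ordinal.isPrincipal_add_omega 1 ha hb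

theorem mul_lt_omega_one {a b : Ordinal.{0}} (ha : a < Ordinal.omega 1)
    (hb : b < Ordinal.omega 1) : a * b < Ordinal.omega 1 :=
  Ordinal.isPrincipal_mul_omega 1 ha hb

theorem natCast_lt_omega_one (n : ℕ) : (n : Ordinal.{0}) < Ordinal.omega 1 :=
  (Ordinal.natCast_lt_omega0 n).trans Ordinal.omega0_lt_omega_one

/-- Ordinal addition is continuous in its right argument, so the induction runs over the order of
the outer family. Associativity of products gives the successor step. At a limit, a member starts
beyond some `n` with its label set in the `n`-th family; one map treats all `n` simultaneously and
also pushes the set beyond `k n`, as the definition of 𝓢 at `b + l` demands. -/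
theorem dominated_prod_sch (hs : IsLadder s) {a b : Ordinal.{0}} (ha : a < Ordinal.omega 1)
    (hb : b < Ordinal.omega 1) : Dominated (familyProd (sch s a) (sch s b)) (sch s (b + a)) := by
  induction a using Ordinal.limitRecOn with
  | zero =>
    rw [sch_zero, familyProd_singletons_left (isReg_sch hs hb), add_zero]
    exact Dominated.refl _
  | add_one a ih =>
    have ha' := (lt_add_one a).trans ha
    rw [← add_assoc, sch_succ, sch_succ,
      ← familyProd_assoc isReg_schOne (isReg_sch hs ha') (isReg_sch hs hb)]
    exact Dominated.prod isReg_schOne ((isReg_sch hs ha').prod (isReg_sch hs hb))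
      (isReg_sch hs (add_lt_omega_one hb ha')) (Dominated.refl _) (ih ha')
  | limit l hl ih =>
    have hl' := hs l hl ha
    have hbl : Order.IsSuccLimit (b + l) := Ordinal.isSuccLimit_add b hl
    have hbl1 := add_lt_omega_one hb ha
    have hbl' := hs _ hbl hbl1
    have hn : ∀ n, ∃ k, b + s l n < s (b + l) k := fun n =>
      hbl'.2.2 _ (add_lt_add_right (hl'.2.1 n) b)
    choose k hk using hn
    have hr : ∀ n, s (b + l) (k n) < Ordinal.omega 1 := fun n => (hbl'.2.1 _).trans hbl1
    obtain ⟨m, hm, hmk, hmem⟩ := Dominated.exists_uniform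
      (fun n => familyProd (sch s (s l n)) (sch s b)) (fun n => sch s (s (b + l) (k n)))
      (fun n => isReg_sch hs (hr n))
      (fun n => (ih _ (hl'.2.1 n) ((hl'.2.1 n).trans ha)).trans
        (dominated_sch_of_le hs (hk n).le (hr n))) k
    refine ⟨m, hm, fun E hE => ?_⟩
    obtain ⟨h, hmono, hle, him, hfib⟩ := exists_label (isReg_sch hs hb) hE
    obtain ⟨n, hn, hnE⟩ := (sch_limit hs hl ha).1 him
    have hnE' : ∀ i ∈ E, n ≤ i := fun i hi =>
      (hnE _ (Finset.mem_image_of_mem h hi)).trans (hle i hi).1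
    refine (sch_limit hs hbl hbl1).2 ⟨k n, hmem n E ?_ hnE', ?_⟩
    · exact mem_familyProd_of_label (isReg_sch hs ((hl'.2.1 n).trans ha)) h hmono
        (fun x hx => (hle x hx).1) hn hfib
    · intro i hi
      obtain ⟨j, hj, rfl⟩ := Finset.mem_image.1 hi
      exact hmk j n (hnE' j hj)

/-- The same induction in the opposite direction. At a limit, the ladder chosen for `b + l` need not
be `b` plus the ladder of `l`, but each of its terms lies below some `b + s l k`. -/
theorem dominated_sch_add (hs : IsLadder s) {a b : Ordinal.{0}} (ha : a < Ordinal.omega 1)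
    (hb : b < Ordinal.omega 1) : Dominated (sch s (b + a)) (familyProd (sch s a) (sch s b)) := by
  induction a using Ordinal.limitRecOn with
  | zero =>
    rw [sch_zero, familyProd_singletons_left (isReg_sch hs hb), add_zero]
    exact Dominated.refl _
  | add_one a ih =>
    have ha' := (lt_add_one a).trans ha
    rw [← add_assoc, sch_succ, sch_succ,
      ← familyProd_assoc isReg_schOne (isReg_sch hs ha') (isReg_sch hs hb)]
    exact Dominated.prod isReg_schOne (isReg_sch hs (add_lt_omega_one hb ha'))
      ((isReg_sch hs ha').prod (isReg_sch hs hb)) (Dominated.refl _) (ih ha')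
  | limit l hl ih =>
    have hl' := hs l hl ha
    have hbl : Order.IsSuccLimit (b + l) := Ordinal.isSuccLimit_add b hl
    have hbl1 := add_lt_omega_one hb ha
    have hbl' := hs _ hbl hbl1
    have hn : ∀ n, ∃ k, s (b + l) n ≤ b + s l k := by
      intro n
      have := hbl'.2.1 n
      rw [Ordinal.lt_add_iff_of_isSuccLimit hl] at this
      obtain ⟨d, hd, hdn⟩ := this
      obtain ⟨k, hk⟩ := hl'.2.2 d hd
      exact ⟨k, hdn.le.trans (add_le_add_right hk.le b)⟩
    choose k hk using hn
    have hr : ∀ n, s l (k n) < Ordinal.omega 1 := fun n => (hl'.2.1 _).trans ha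
    obtain ⟨m, hm, hmk, hmem⟩ := Dominated.exists_uniform
      (fun n => sch s (s (b + l) n)) (fun n => familyProd (sch s (s l (k n))) (sch s b))
      (fun n => (isReg_sch hs (hr n)).prod (isReg_sch hs hb))
      (fun n => (dominated_sch_of_le hs (hk n) (add_lt_omega_one hb (hr n))).trans
        (ih _ (hl'.2.1 _) (hr n))) k
    refine ⟨m, hm, fun E hE => ?_⟩
    obtain ⟨n, hn, hnE⟩ := (sch_limit hs hbl hbl1).1 hE
    have hE' := hmem n E hn hnE
    obtain ⟨h, hmono, hle, him, hfib⟩ := exists_label (isReg_sch hs hb) hE'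
    refine mem_familyProd_of_label (isReg_sch hs ha) h hmono (fun x hx => (hle x hx).1) ?_ hfib
    refine (sch_limit hs hl ha).2 ⟨k n, him, fun i hi => ?_⟩
    obtain ⟨j, hj, rfl⟩ := Finset.mem_image.1 hi
    obtain ⟨i, hi, hij⟩ := Finset.mem_image.1 (hle j hj).2.1
    rw [← hij]
    exact hmk i n (hnE i hi)

theorem sch_mul_succ_dominated (hs : IsLadder s) {a : Ordinal.{0}} (ha : a < Ordinal.omega 1)
    (n : ℕ) : Dominated (sch s (a * n)) (famPow (sch s a) n) ∧
      Dominated (famPow (sch s a) n) (sch s (a * n)) := by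
  induction n with
  | zero => simp [famPow, sch_zero, Dominated.refl]
  | succ n ih =>
    have h1 := mul_lt_omega_one ha (natCast_lt_omega_one n)
    have hr := isReg_sch hs ha
    rw [Nat.cast_succ, mul_add, mul_one, famPow]
    exact ⟨(dominated_sch_add hs ha h1).trans
        (Dominated.prod hr (isReg_sch hs h1) (hr.pow n) (Dominated.refl _) ih.1),
      (Dominated.prod hr (hr.pow n) (isReg_sch hs h1) (Dominated.refl _) ih.2).trans
        (dominated_prod_sch hs ha h1)⟩

end Sch

/-! ### Tails of block sequences -/

section Blk

variable {X : Type*} [NormedAddCommGroup X] [NormedSpace ℝ X]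

/-- From the index `k` on, the sequence `v` is a block sequence of `w`, the term `v j` being
supported on `[p j, p (j + 1))`. -/
def IsBlkMap (k : ℕ) (p : ℕ → ℕ) (v w : ℕ → X) : Prop :=
  StrictMono p ∧ ∀ j, k ≤ j → v j ≠ 0 ∧
    v j ∈ Submodule.span ℝ (w '' Set.Ico (p j) (p (j + 1)))

/-- From the index `k` on, the sequence `v` is a block sequence of `w`. -/
def IsBlk (k : ℕ) (v w : ℕ → X) : Prop := ∃ p, IsBlkMap k p v w

variable {u v w : ℕ → X} {k l : ℕ}

theorem IsBlkMap.span_le {p : ℕ → ℕ} (h : IsBlkMap k p v w) {a b : ℕ} (ha : k ≤ a) :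
    Submodule.span ℝ (v '' Set.Ico a b) ≤ Submodule.span ℝ (w '' Set.Ico (p a) (p b)) := by
  rw [Submodule.span_le]
  rintro _ ⟨j, ⟨haj, hjb⟩, rfl⟩
  refine Submodule.span_mono (Set.image_mono ?_) (h.2 j (ha.trans haj)).2
  exact Set.Ico_subset_Ico (h.1.monotone haj) (h.1.monotone hjb)

theorem IsBlkMap.comp {p q : ℕ → ℕ} (h1 : IsBlkMap k p u v) (h2 : IsBlkMap l q v w) :
    IsBlkMap (max k l) (q ∘ p) u w := by
  refine ⟨h2.1.comp h1.1, fun j hj => ⟨(h1.2 j ((le_max_left _ _).trans hj)).1, ?_⟩⟩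
  refine h2.span_le ?_ (h1.2 j ((le_max_left _ _).trans hj)).2
  exact ((le_max_right _ _).trans hj).trans h1.1.le_apply

theorem IsBlk.trans (h1 : IsBlk k u v) (h2 : IsBlk l v w) : IsBlk (max k l) u w := by
  obtain ⟨p, h1⟩ := h1
  obtain ⟨q, h2⟩ := h2
  exact ⟨_, h1.comp h2⟩

theorem IsBlk.trans_zero (h1 : IsBlk 0 u v) (h2 : IsBlk 0 v w) : IsBlk 0 u w := h1.trans h2

theorem IsBlk.mono (h : IsBlk k v w) (hkl : k ≤ l) : IsBlk l v w := by
  obtain ⟨p, hp, h⟩ := h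
  exact ⟨p, hp, fun j hj => h j (hkl.trans hj)⟩

theorem IsBlk.ne_zero (h : IsBlk k v w) {j : ℕ} (hj : k ≤ j) : v j ≠ 0 := by
  obtain ⟨p, hp, h⟩ := h
  exact (h j hj).1

theorem isBlk_comp {m : ℕ → ℕ} (hm : StrictMono m) (h : ∀ j, k ≤ j → w (m j) ≠ 0) :
    IsBlk k (w ∘ m) w := by
  refine ⟨m, hm, fun j hj => ⟨h j hj, Submodule.subset_span ⟨m j, ?_, rfl⟩⟩⟩
  exact ⟨le_rfl, hm (Nat.lt_succ_self j)⟩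

theorem isBlk_refl (h : ∀ j, w j ≠ 0) : IsBlk 0 w w :=
  isBlk_comp (m := id) strictMono_id fun j _ => h j

theorem IsBlk.shift (h : IsBlk k v w) : IsBlk 0 (fun j => v (j + k)) w := by
  obtain ⟨p, hp, h⟩ := h
  refine ⟨fun j => p (j + k), fun a b hab => hp (Nat.add_lt_add_right hab k), fun j _ => ?_⟩
  have := h (j + k) (Nat.le_add_left _ _)
  rwa [Nat.add_right_comm] at this

/-- The diagonal of a sequence of successive block sequences. -/
theorem isBlk_diagonal (u : ℕ → ℕ → X) (h : ∀ n, IsBlk 0 (u (n + 1)) (u n)) (h0 : ∀ j, u 0 j ≠ 0)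
    (n : ℕ) : IsBlk n (fun j => u j j) (u n) := by
  choose p hp using h
  -- `P d` composes the block maps leading from level `n + d` down to level `n`.
  let P : ℕ → ℕ → ℕ := fun d => Nat.rec id (fun d f => f ∘ p (n + d)) d
  have hne : ∀ n j, u n j ≠ 0 := by
    intro n j
    cases n with
    | zero => exact h0 j
    | succ n => exact ((hp n).2 j (Nat.zero_le _)).1
  have hP : ∀ d, IsBlkMap 0 (P d) (u (n + d)) (u n) := by
    intro d
    induction d with
    | zero =>
      refine ⟨strictMono_id, fun j _ => ⟨hne _ j, Submodule.subset_span ⟨j, ?_, rfl⟩⟩⟩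
      exact ⟨le_rfl, Nat.lt_succ_self j⟩
    | succ d ih => exact (hp (n + d)).comp ih
  -- Nothing is claimed before index `n`; the identity there merely keeps `q` strictly increasing.
  let q : ℕ → ℕ := fun j => if j < n then j else P (j - n) j
  have hq : ∀ j, n ≤ j → q j = P (j - n) j ∧ P (j - n) (j + 1) ≤ q (j + 1) := by
    intro j hj
    refine ⟨if_neg (not_lt.2 hj), ?_⟩
    have : q (j + 1) = P (j + 1 - n) (j + 1) := if_neg (not_lt.2 (hj.trans (Nat.le_succ j)))
    rw [this, Nat.sub_add_comm hj]
    exact (hP (j - n)).1.monotone (hp (n + (j - n))).1.le_apply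
  refine ⟨q, strictMono_nat_of_lt_succ fun j => ?_, fun j hj => ⟨hne j j, ?_⟩⟩
  · rcases lt_or_ge j n with hj | hj
    · have h1 : q j = j := if_pos hj
      rw [h1]
      by_cases hj' : j + 1 < n
      · have : q (j + 1) = j + 1 := if_pos hj'
        omega
      · have : q (j + 1) = P (j + 1 - n) (j + 1) := if_neg hj'
        rw [this]
        exact (Nat.lt_succ_self j).trans_le (hP _).1.le_apply
    · rw [(hq j hj).1]
      exact ((hP (j - n)).1 (Nat.lt_succ_self j)).trans_le (hq j hj).2
  · have := ((hP (j - n)).2 j (Nat.zero_le _)).2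
    rw [Nat.add_sub_cancel' hj] at this
    refine Submodule.span_mono (Set.image_mono (Set.Ico_subset_Ico ?_ (hq j hj).2)) this
    exact (hq j hj).1.le

end Blk

/-! ### Lower `ℓ₁` estimates -/

section Lower

variable {X : Type*} [NormedAddCommGroup X] [NormedSpace ℝ X]

/-- The intervals `[t, r t)`, `t ∈ A`, are successive. -/
def Adm (A : Finset ℕ) (r : ℕ → ℕ) : Prop := ∀ t ∈ A, ∀ t' ∈ A, t < t' → r t ≤ t'

theorem Adm.mono {A B : Finset ℕ} {r : ℕ → ℕ} (h : Adm A r) (hB : B ⊆ A) : Adm B r :=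
  fun t ht t' ht' => h t (hB ht) t' (hB ht')

/-- The lower `ℓ₁` estimate with constant `c` for `𝓕`-admissible blocks of `v` beyond `k`. -/
def LowerEst (v : ℕ → X) (𝓕 : Set (Finset ℕ)) (k : ℕ) (c : ℝ) : Prop :=
  ∀ A ∈ 𝓕, (∀ t ∈ A, k ≤ t) → ∀ r, Adm A r → ∀ x : ℕ → X,
    (∀ t ∈ A, x t ∈ Submodule.span ℝ (v '' Set.Ico t (r t))) →
    c * ∑ t ∈ A, ‖x t‖ ≤ ‖∑ t ∈ A, x t‖

variable {v w : ℕ → X} {𝓕 𝓖 : Set (Finset ℕ)} {k l : ℕ} {c d : ℝ}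

theorem LowerEst.mono (h : LowerEst v 𝓖 l c) (h𝓕 : 𝓕 ⊆ 𝓖) (hkl : l ≤ k) (hdc : d ≤ c) :
    LowerEst v 𝓕 k d := by
  intro A hA hk r hr x hx
  refine le_trans ?_ (h A (h𝓕 hA) (fun t ht => hkl.trans (hk t ht)) r hr x hx)
  exact mul_le_mul_of_nonneg_right hdc (Finset.sum_nonneg fun _ _ => norm_nonneg _)

theorem lowerEst_zero : LowerEst v 𝓕 k 0 := by
  intro A _ _ r _ x _
  simp

theorem lowerEst_singletons : LowerEst v singletons k 1 := by
  intro A hA _ r _ x _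
  rcases Finset.eq_empty_or_nonempty A with rfl | hne
  · simp
  · obtain ⟨n, rfl⟩ := Finset.card_eq_one.1 (le_antisymm hA hne.card_pos)
    simp

theorem LowerEst.of_blocks {p : ℕ → ℕ} (hp : StrictMono p)
    (hv : ∀ j, k ≤ j → v j ∈ Submodule.span ℝ (w '' Set.Ico (p j) (p (j + 1))))
    (h𝓕 : ∀ A ∈ 𝓕, (∀ t ∈ A, k ≤ t) → A.image p ∈ 𝓖) (hl : ∀ j, k ≤ j → l ≤ p j)
    (h : LowerEst w 𝓖 l c) : LowerEst v 𝓕 k c := by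
  intro A hA hk r hr x hx
  have hinv : ∀ i, Function.invFun p (p i) = i := Function.leftInverse_invFun hp.injective
  have := h (A.image p) (h𝓕 A hA hk) ?_ (fun i => p (r (Function.invFun p i))) ?_
    (fun i => x (Function.invFun p i)) ?_
  · simpa only [Finset.sum_image hp.injective.injOn, hinv] using this
  · intro t ht
    obtain ⟨i, hi, rfl⟩ := Finset.mem_image.1 ht
    exact hl i (hk i hi)
  · intro t ht t' ht' hlt
    obtain ⟨i, hi, rfl⟩ := Finset.mem_image.1 ht
    obtain ⟨i', hi', rfl⟩ := Finset.mem_image.1 ht'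
    simp only [hinv]
    exact hp.monotone (hr i hi i' hi' (hp.lt_iff_lt.1 hlt))
  · intro t ht
    obtain ⟨i, hi, rfl⟩ := Finset.mem_image.1 ht
    rw [hinv]
    refine Submodule.span_le.2 ?_ (hx i hi)
    rintro _ ⟨j, ⟨h1, h2⟩, rfl⟩
    refine Submodule.span_mono (Set.image_mono ?_) (hv j ((hk i hi).trans h1))
    exact Set.Ico_subset_Ico (hp.monotone h1) (hp.monotone h2)

theorem LowerEst.of_isBlkMap (h𝓕 : IsReg 𝓕) {p : ℕ → ℕ} (hb : IsBlkMap k p v w)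
    (h : LowerEst w 𝓕 l c) : LowerEst v 𝓕 (max k l) c :=
  h.of_blocks hb.1 (fun j hj => (hb.2 j ((le_max_left _ _).trans hj)).2)
    (fun _ hA _ => h𝓕.image_of_strictMono hA hb.1)
    fun _ hj => ((le_max_right _ _).trans hj).trans hb.1.le_apply

theorem LowerEst.of_isBlk (h𝓕 : IsReg 𝓕) (hb : IsBlk k v w)
    (h : LowerEst w 𝓕 l c) : LowerEst v 𝓕 (max k l) c := by
  obtain ⟨p, hb⟩ := hb
  exact h.of_isBlkMap h𝓕 hb

/-- Group the blocks by label: the inner estimate applies within each fibre, and the outer one to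
the fibre sums, which are blocks starting no earlier than their labels. -/
theorem LowerEst.prod (h𝓖 : IsReg 𝓖) (hc : 0 ≤ c) (h1 : LowerEst v 𝓕 k c)
    (h2 : LowerEst v 𝓖 k d) : LowerEst v (familyProd 𝓕 𝓖) k (c * d) := by
  intro A hA hk r hr x hx
  obtain ⟨h, hmono, hle, him, hfib⟩ := exists_label h𝓖 hA
  have hmaps : ∀ t ∈ A, h t ∈ A.image h := fun t ht => Finset.mem_image_of_mem h ht
  rw [← Finset.sum_fiberwise_of_maps_to hmaps, ← Finset.sum_fiberwise_of_maps_to hmaps]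
  have hmem : ∀ t ∈ A.image h, t ∈ A ∧ h t = t := by
    intro t ht
    obtain ⟨a, ha, rfl⟩ := Finset.mem_image.1 ht
    exact (hle a ha).2
  have e1 := h1 (A.image h) him (fun t ht => hk t (hmem t ht).1)
    (fun t => (A.filter (fun a => h a = t)).sup r) ?_
    (fun t => ∑ a ∈ A with h a = t, x a) ?_
  · refine le_trans ?_ e1
    rw [mul_assoc]
    refine mul_le_mul_of_nonneg_left ?_ hc
    rw [Finset.mul_sum]
    refine Finset.sum_le_sum fun t _ => ?_
    exact h2 _ (hfib t) (fun a ha => hk a (Finset.mem_filter.1 ha).1) r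
      (hr.mono (Finset.filter_subset _ _)) x fun a ha => hx a (Finset.mem_filter.1 ha).1
  · intro t ht t' ht' hlt
    refine Finset.sup_le fun a ha => ?_
    rw [Finset.mem_filter] at ha
    refine hr a ha.1 t' (hmem t' ht').1 ?_
    by_contra hcon
    have := hmono (hmem t' ht').1 ha.1 (not_lt.1 hcon)
    rw [(hmem t' ht').2, ha.2] at this
    exact absurd hlt (not_lt.2 this)
  · intro t ht
    refine Submodule.sum_mem _ fun a ha => ?_
    refine Submodule.span_mono (Set.image_mono (Set.Ico_subset_Ico ?_ ?_))
      (hx a (Finset.mem_filter.1 ha).1)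
    · rw [← (Finset.mem_filter.1 ha).2]
      exact (hle a (Finset.mem_filter.1 ha).1).1
    · exact Finset.le_sup (f := r) ha

/-! ### Optimal constants and their stabilization -/

/-- The best constant in the lower `ℓ₁` estimates for `𝓕`-admissible blocks of `v` far out. -/
def lowerConst (v : ℕ → X) (𝓕 : Set (Finset ℕ)) : ℝ := sSup {c | ∃ k, LowerEst v 𝓕 k c}

theorem LowerEst.le_one (h𝓕 : IsReg 𝓕) (hv : ∀ j, k ≤ j → v j ≠ 0) (h : LowerEst v 𝓕 l c) :
    c ≤ 1 := by
  have h1 := h {max k l} (h𝓕.2 _) (by simp) (fun t => t + 1)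
    (fun t _ t' _ hlt => Nat.succ_le_of_lt hlt) v (fun t _ => Submodule.subset_span ⟨t, by simp, rfl⟩)
  have h2 : 0 < ‖v (max k l)‖ := norm_pos_iff.2 (hv _ (le_max_left _ _))
  simp only [Finset.sum_singleton] at h1
  exact le_of_mul_le_mul_right (by simpa using h1) h2

theorem bddAbove_lowerEst (h𝓕 : IsReg 𝓕) (hv : ∀ j, k ≤ j → v j ≠ 0) :
    BddAbove {c | ∃ k, LowerEst v 𝓕 k c} :=
  ⟨1, fun _ hc => hc.elim fun _ h => h.le_one h𝓕 hv⟩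

theorem LowerEst.le_lowerConst (h𝓕 : IsReg 𝓕) (hv : ∀ j, k ≤ j → v j ≠ 0)
    (h : LowerEst v 𝓕 l c) : c ≤ lowerConst v 𝓕 :=
  le_csSup (bddAbove_lowerEst h𝓕 hv) ⟨l, h⟩

theorem lowerConst_nonneg (h𝓕 : IsReg 𝓕) (hv : ∀ j, k ≤ j → v j ≠ 0) : 0 ≤ lowerConst v 𝓕 :=
  LowerEst.le_lowerConst (l := 0) h𝓕 hv lowerEst_zero

theorem lowerConst_le_one (h𝓕 : IsReg 𝓕) (hv : ∀ j, k ≤ j → v j ≠ 0) : lowerConst v 𝓕 ≤ 1 :=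
  csSup_le ⟨0, 0, lowerEst_zero⟩ fun _ hc => hc.elim fun _ h => h.le_one h𝓕 hv

theorem exists_lowerEst (h : c < lowerConst v 𝓕) : ∃ k, LowerEst v 𝓕 k c := by
  rw [lowerConst] at h
  have hne : {c | ∃ k, LowerEst v 𝓕 k c}.Nonempty := ⟨0, 0, lowerEst_zero⟩
  obtain ⟨d, ⟨k, hk⟩, hd⟩ := exists_lt_of_lt_csSup hne h
  exact ⟨k, hk.mono (subset_refl _) le_rfl hd.le⟩

theorem lowerConst_le_of_forall {b : ℝ} (h : ∀ c k, LowerEst v 𝓕 k c → c ≤ b) :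
    lowerConst v 𝓕 ≤ b :=
  csSup_le ⟨0, 0, lowerEst_zero⟩ fun c hc => hc.elim fun k hk => h c k hk

theorem lowerConst_anti (h𝓕 : IsReg 𝓕) (hv : ∀ j, k ≤ j → v j ≠ 0)
    (hsub : 𝓕 ⊆ 𝓖) : lowerConst v 𝓖 ≤ lowerConst v 𝓕 :=
  lowerConst_le_of_forall fun _ _ h => (h.mono hsub le_rfl le_rfl).le_lowerConst h𝓕 hv

theorem IsBlk.lowerConst_le (h𝓕 : IsReg 𝓕) (hb : IsBlk k v w) :
    lowerConst w 𝓕 ≤ lowerConst v 𝓕 :=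
  lowerConst_le_of_forall fun _ _ h => (h.of_isBlk h𝓕 hb).le_lowerConst h𝓕 fun _ => hb.ne_zero

theorem lowerConst_prod (h𝓕 : IsReg 𝓕) (h𝓖 : IsReg 𝓖) (hv : ∀ j, k ≤ j → v j ≠ 0) :
    lowerConst v 𝓕 * lowerConst v 𝓖 ≤ lowerConst v (familyProd 𝓕 𝓖) := by
  have h0 := lowerConst_nonneg (h𝓕.prod h𝓖) hv
  refine mul_le_of_forall_lt_of_nonneg (lowerConst_nonneg h𝓕 hv) h0 fun c hc hc' d hd hd' => ?_
  obtain ⟨k₁, h1⟩ := exists_lowerEst hc'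
  obtain ⟨k₂, h2⟩ := exists_lowerEst hd'
  exact (LowerEst.prod h𝓖 hc (h1.mono (subset_refl _) (le_max_left k₁ k₂) le_rfl)
    (h2.mono (subset_refl _) (le_max_right k₁ k₂) le_rfl)).le_lowerConst (h𝓕.prod h𝓖) hv

theorem lowerConst_pow (h𝓕 : IsReg 𝓕) (hv : ∀ j, k ≤ j → v j ≠ 0) (n : ℕ) :
    lowerConst v 𝓕 ^ n ≤ lowerConst v (famPow 𝓕 n) := by
  induction n with
  | zero =>
    rw [pow_zero]
    exact LowerEst.le_lowerConst (l := 0) isReg_singletons hv lowerEst_singletons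
  | succ n ih =>
    rw [pow_succ']
    refine le_trans ?_ (lowerConst_prod h𝓕 (h𝓕.pow n) hv)
    exact mul_le_mul_of_nonneg_left ih (lowerConst_nonneg h𝓕 hv)

/-- The constant `lowerConst w 𝓕` does not improve on block sequences of tails of `w`. -/
def Stable (w : ℕ → X) (𝓕 : Set (Finset ℕ)) : Prop :=
  ∀ k v, IsBlk k v w → lowerConst v 𝓕 ≤ lowerConst w 𝓕

theorem Stable.of_isBlk (h𝓕 : IsReg 𝓕) (h : Stable w 𝓕) (hb : IsBlk k v w) : Stable v 𝓕 :=
  fun _ _ hu => (h _ _ (hu.trans hb)).trans (hb.lowerConst_le h𝓕)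

/-- On the subsequence `w ∘ m` a `𝓖`-estimate for `w` becomes an `𝓕`-estimate, and by stability the
subsequence has no better `𝓕`-constant than `w` itself. -/
theorem Stable.lowerConst_le (h𝓕 : IsReg 𝓕) (h : Stable w 𝓕) (hw : ∀ j, w j ≠ 0)
    (hd : Dominated 𝓕 𝓖) : lowerConst w 𝓖 ≤ lowerConst w 𝓕 := by
  obtain ⟨m, hm, hmem⟩ := hd
  have hb : IsBlk 0 (w ∘ m) w := isBlk_comp hm fun j _ => hw _
  refine le_trans (lowerConst_le_of_forall fun c l hc => ?_) (h 0 _ hb)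
  have : LowerEst (w ∘ m) 𝓕 l c := by
    refine hc.of_blocks hm (fun j _ => Submodule.subset_span ⟨m j, ?_, rfl⟩)
      (fun A hA _ => hmem A hA) fun j hj => hj.trans hm.le_apply
    exact ⟨le_rfl, hm (Nat.lt_succ_self j)⟩
  exact this.le_lowerConst h𝓕 fun _ => hb.ne_zero

/-- Take `u` almost attaining the supremum of the constants over all block sequences of `w`. A
sequence that is blocked only from `k` on is compared through its shift by `k`, whose constant is at
least as large. -/
theorem exists_almost_stable (h𝓕 : IsReg 𝓕) (hw : ∀ j, w j ≠ 0) {ε : ℝ} (hε : 0 < ε) :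
    ∃ u, IsBlk 0 u w ∧ ∀ k v, IsBlk k v u → lowerConst v 𝓕 ≤ lowerConst u 𝓕 + ε := by
  let S : Set ℝ := {c | ∃ u, IsBlk 0 u w ∧ lowerConst u 𝓕 = c}
  have hne : S.Nonempty := ⟨_, w, isBlk_refl hw, rfl⟩
  have hbdd : BddAbove S := by
    refine ⟨1, ?_⟩
    rintro _ ⟨u, hu, rfl⟩
    exact lowerConst_le_one h𝓕 fun _ => hu.ne_zero
  obtain ⟨_, ⟨u, hu, rfl⟩, hlt⟩ := exists_lt_of_lt_csSup hne (sub_lt_self (sSup S) hε)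
  refine ⟨u, hu, fun k v hv => ?_⟩
  have h1 : IsBlk 0 (fun j => v (j + k)) v :=
    isBlk_comp (fun a b hab => Nat.add_lt_add_right hab k) fun j _ =>
      hv.ne_zero (Nat.le_add_left _ _)
  have h2 : lowerConst (fun j => v (j + k)) 𝓕 ≤ sSup S :=
    le_csSup hbdd ⟨_, hv.shift.trans_zero hu, rfl⟩
  have h3 := h1.lowerConst_le h𝓕
  linarith

/-- Countably many families are stable for a suitable block sequence. -/
theorem exists_stable (𝓕 : ℕ → Set (Finset ℕ)) (h𝓕 : ∀ i, IsReg (𝓕 i)) (hw : ∀ j, w j ≠ 0) :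
    ∃ u, IsBlk 0 u w ∧ ∀ i, Stable u (𝓕 i) := by
  -- Step `n` handles the family with index `n.unpair.1` up to an error `1 / (n + 1)`. Every family
  -- is visited infinitely often, at the steps `Nat.pair i N`, so the errors vanish for the diagonal
  -- sequence.
  have hstep : ∀ (n : ℕ) (u : {u : ℕ → X // ∀ j, u j ≠ 0}), ∃ u' : {u : ℕ → X // ∀ j, u j ≠ 0},
      IsBlk 0 u'.1 u.1 ∧ ∀ k v, IsBlk k v u'.1 →
        lowerConst v (𝓕 n.unpair.1) ≤ lowerConst u'.1 (𝓕 n.unpair.1) + 1 / ((n : ℝ) + 1) := by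
    intro n u
    obtain ⟨u', h1, h2⟩ := exists_almost_stable (h𝓕 n.unpair.1) u.2
      (show (0 : ℝ) < 1 / ((n : ℝ) + 1) by positivity)
    exact ⟨⟨u', fun j => h1.ne_zero (Nat.zero_le _)⟩, h1, h2⟩
  choose f hf1 hf2 using hstep
  let U : ℕ → {u : ℕ → X // ∀ j, u j ≠ 0} := fun n => Nat.rec ⟨w, hw⟩ f n
  have hU : ∀ n, U (n + 1) = f n (U n) := fun n => rfl
  have hdiag := isBlk_diagonal (fun n => (U n).1) (fun n => by rw [hU]; exact hf1 n (U n)) hw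
  refine ⟨_, hdiag 0, fun i k v hv => ?_⟩
  refine le_of_forall_pos_le_add fun ε hε => ?_
  obtain ⟨N, hN⟩ := exists_nat_one_div_lt hε
  have h1 := hdiag (Nat.pair i N + 1)
  have h2 := hf2 (Nat.pair i N) (U _) _ v (hv.trans h1)
  rw [← hU, Nat.unpair_pair] at h2
  have h3 := h1.lowerConst_le (h𝓕 i)
  have h4 : 1 / ((Nat.pair i N : ℝ) + 1) ≤ 1 / ((N : ℝ) + 1) := by
    refine one_div_le_one_div_of_le (by positivity) ?_
    have : (N : ℝ) ≤ Nat.pair i N := by exact_mod_cast Nat.right_le_pair i N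
    linarith
  simp only at h2
  linarith

theorem sum_orderEmbOfFin {M : Type*} [AddCommMonoid M] (A : Finset ℕ) (g : ℕ → M) :
    ∑ i, g (A.orderEmbOfFin rfl i) = ∑ t ∈ A, g t := by
  rw [← Finset.sum_image (s := Finset.univ) (f := g) (g := A.orderEmbOfFin rfl)
    (A.orderEmbOfFin rfl).injective.injOn, Finset.image_orderEmbOfFin_univ A rfl]

theorem lowerEst_basis (e : SchauderBasis ℝ X) (he : IsAsymptoticEll1 e) :
    ∃ c > 0, LowerEst e.basis schOne 0 c := by
  obtain ⟨C, hC, h⟩ := he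
  refine ⟨1 / C, by positivity, fun A hA _ r hr x hx => ?_⟩
  let ι := A.orderEmbOfFin rfl
  have hmem : ∀ i, ι i ∈ A := fun i => Finset.orderEmbOfFin_mem _ rfl i
  have hsupp : ∀ t ∈ A, ∀ q ∈ supp e (x t), t ≤ q ∧ q < r t := by
    intro t ht q hq
    by_contra hcon
    apply hq
    have : Submodule.span ℝ (e.basis '' Set.Ico t (r t)) ≤ (e.coord q).toLinearMap.ker := by
      rw [Submodule.span_le]
      rintro _ ⟨j, hj, rfl⟩
      have hne : j ≠ q := by
        rintro rfl
        exact hcon hj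
      simp [e.ortho, hne]
    exact this (hx t ht)
  have := h A.card (fun i => x (ι i)) ?_ ?_ ?_
  · rwa [sum_orderEmbOfFin A (fun t => ‖x t‖), sum_orderEmbOfFin A x] at this
  · intro i
    exact Submodule.span_mono (Set.image_subset_range _ _) (hx _ (hmem i))
  · intro i q hq
    exact (hA _ (hmem i)).trans (Nat.succ_le_succ (hsupp _ (hmem i) q hq).1)
  · intro i j hij q hq q' hq'
    exact (hsupp _ (hmem i) q hq).2.trans_le
      ((hr _ (hmem i) _ (hmem j) (ι.lt_iff_lt.2 hij)).trans (hsupp _ (hmem j) q' hq').1)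

end Lower

/-! ### Coordinates with respect to a block basis -/

section Coord

variable {X : Type*} [NormedAddCommGroup X] [NormedSpace ℝ X]

theorem IsBlk.isBlockBasis {v w : ℕ → X} (h : IsBlk 0 v w) : IsBlockBasis v w := by
  obtain ⟨p, hp, h⟩ := h
  have h1 : ∀ j, ∃ b : ℕ → ℝ, ∑ i ∈ Finset.Ico (p j) (p (j + 1)), b i • w i = v j := by
    intro j
    have := (h j (Nat.zero_le _)).2
    rw [← Finset.coe_Ico, Submodule.mem_span_image_finset_iff_exists_fun] at this
    obtain ⟨c, hc⟩ := this
    refine ⟨fun i => if hi : i ∈ Finset.Ico (p j) (p (j + 1)) then c ⟨i, hi⟩ else 0, ?_⟩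
    rw [← hc, ← Finset.sum_coe_sort]
    exact Finset.sum_congr rfl fun i _ => by beta_reduce; rw [dif_pos i.2]
  choose b hb using h1
  -- The block supports are disjoint, so at most one summand is nonzero and the local coefficients
  -- glue to one sequence; `j ≤ i` suffices since `j ≤ p j ≤ i` on the block numbered `j`.
  refine ⟨p, fun i => ∑ j ∈ Finset.range (i + 1),
    if i ∈ Finset.Ico (p j) (p (j + 1)) then b j i else 0, hp, fun j => ⟨?_, (h j (Nat.zero_le _)).1⟩⟩
  rw [← hb j]
  refine Finset.sum_congr rfl fun i hi => ?_
  congr 1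
  beta_reduce
  have hij : j ≤ i := hp.le_apply.trans (Finset.mem_Ico.1 hi).1
  rw [Finset.sum_eq_single j, if_pos hi]
  · intro j' _ hne
    rw [if_neg]
    intro hi'
    rw [Finset.mem_Ico] at hi hi'
    rcases lt_or_gt_of_ne hne with hlt | hlt
    · have := hp.monotone (Nat.succ_le_of_lt hlt)
      exact absurd (hi'.2.trans_le this) (not_lt.2 hi.1)
    · have := hp.monotone (Nat.succ_le_of_lt hlt)
      exact absurd (hi.2.trans_le this) (not_lt.2 hi'.1)
  · intro hj
    exact absurd (Finset.mem_range.2 (Nat.lt_succ_of_le hij)) hj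

/-- The closed linear span of the terms of `w` from the index `k` on. -/
def tailClosure (w : ℕ → X) (k : ℕ) : Submodule ℝ X :=
  (Submodule.span ℝ (w '' Set.Ici k)).topologicalClosure

theorem tailClosure_zero (w : ℕ → X) :
    tailClosure w 0 = (Submodule.span ℝ (Set.range w)).topologicalClosure := by
  rw [tailClosure, ← Set.image_univ]
  congr 3
  ext
  simp

theorem tailClosure_anti (w : ℕ → X) {k l : ℕ} (h : k ≤ l) : tailClosure w l ≤ tailClosure w k :=
  Submodule.topologicalClosure_mono
    (Submodule.span_mono (Set.image_mono (Set.Ici_subset_Ici.2 h)))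

theorem span_le_tailClosure (w : ℕ → X) {S : Set ℕ} {k : ℕ} (h : ∀ i ∈ S, k ≤ i) :
    Submodule.span ℝ (w '' S) ≤ tailClosure w k :=
  (Submodule.span_mono (Set.image_mono fun i hi => h i hi)).trans
    (Submodule.le_topologicalClosure _)

/-- The restriction operator onto the coordinates in `E`. -/
def res (w : ℕ → X) (f : ℕ → X →L[ℝ] ℝ) (E : Finset ℕ) : X →L[ℝ] X :=
  ∑ i ∈ E, (f i).smulRight (w i)

theorem res_apply (w : ℕ → X) (f : ℕ → X →L[ℝ] ℝ) (E : Finset ℕ) (x : X) :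
    res w f E x = ∑ i ∈ E, f i x • w i := by
  simp [res]

/-- `f` are the coordinate functionals of `w`, and `K` bounds the partial sum projections. -/
structure CoordSystem (w : ℕ → X) (f : ℕ → X →L[ℝ] ℝ) (K : ℝ) : Prop where
  biorth : ∀ i j, f i (w j) = if i = j then 1 else 0
  expand : ∀ x ∈ tailClosure w 0,
    Filter.Tendsto (fun n => res w f (Finset.range n) x) Filter.atTop (nhds x)
  bound : ∀ n, ∀ x ∈ tailClosure w 0, ‖res w f (Finset.range n) x‖ ≤ K * ‖x‖
  one_le : 1 ≤ K
  coeff_eq : ∀ x ∈ tailClosure w 0, ∀ i, coeff w x i = f i x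

theorem exists_coordSystem [CompleteSpace X] (e : SchauderBasis ℝ X) {w : ℕ → X}
    (hw : IsBlk 0 w e.basis) : ∃ f K, CoordSystem w f K := by
  obtain ⟨f, hf, hexp⟩ := hw.isBlockBasis.exists_functionals e
  have hcoeff : ∀ x ∈ tailClosure w 0, ∀ i, coeff w x i = f i x := by
    intro x hx i
    rw [tailClosure_zero] at hx
    rw [hw.isBlockBasis.coeff_eq e (hexp x hx)]
  have hexp' : ∀ x ∈ tailClosure w 0,
      Filter.Tendsto (fun n => res w f (Finset.range n) x) Filter.atTop (nhds x) := by
    intro x hx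
    rw [tailClosure_zero] at hx
    simp only [res_apply]
    exact hexp x hx
  let Y := tailClosure w 0
  have : CompleteSpace Y := (Submodule.isClosed_topologicalClosure _).completeSpace_coe
  -- The partial sum operators converge pointwise on the Banach space `Y`, hence are uniformly
  -- bounded there.
  obtain ⟨K, hK⟩ := banach_steinhaus
    (g := fun n => (res w f (Finset.range n)).comp Y.subtypeL) (by
      intro x
      obtain ⟨C, hC⟩ := (hexp' x x.2).norm.bddAbove_range
      exact ⟨C, fun n => hC ⟨n, rfl⟩⟩)
  refine ⟨f, max K 1, hf, hexp', fun n x hx => ?_, le_max_right _ _, hcoeff⟩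
  have := ((res w f (Finset.range n)).comp Y.subtypeL).le_opNorm ⟨x, hx⟩
  refine this.trans ?_
  exact mul_le_mul_of_nonneg_right ((hK n).trans (le_max_left _ _)) (norm_nonneg _)

variable {w : ℕ → X} {f : ℕ → X →L[ℝ] ℝ} {K : ℝ}

theorem res_mem_span (E : Finset ℕ) (x : X) {S : Set ℕ} (h : ∀ i ∈ E, i ∈ S) :
    res w f E x ∈ Submodule.span ℝ (w '' S) := by
  rw [res_apply]
  exact Submodule.sum_mem _ fun i hi =>
    Submodule.smul_mem _ _ (Submodule.subset_span ⟨i, h i hi, rfl⟩)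

namespace CoordSystem

variable (h : CoordSystem w f K)

include h

theorem res_basis (E : Finset ℕ) (j : ℕ) : res w f E (w j) = if j ∈ E then w j else 0 := by
  simp [res_apply, h.biorth]

theorem res_eq_self {E : Finset ℕ} {S : Set ℕ} (hS : ∀ i ∈ S, i ∈ E) {x : X}
    (hx : x ∈ Submodule.span ℝ (w '' S)) : res w f E x = x := by
  induction hx using Submodule.span_induction with
  | mem x hx =>
    obtain ⟨j, hj, rfl⟩ := hx
    rw [h.res_basis, if_pos (hS j hj)]
  | zero => exact map_zero _
  | add x y _ _ hx hy => rw [map_add, hx, hy]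
  | smul c x _ hx => rw [map_smul, hx]

theorem res_eq_zero {E : Finset ℕ} {S : Set ℕ} (hS : ∀ i ∈ S, i ∉ E) {x : X}
    (hx : x ∈ Submodule.span ℝ (w '' S)) : res w f E x = 0 := by
  induction hx using Submodule.span_induction with
  | mem x hx =>
    obtain ⟨j, hj, rfl⟩ := hx
    rw [h.res_basis, if_neg (hS j hj)]
  | zero => exact map_zero _
  | add x y _ _ hx hy => rw [map_add, hx, hy, add_zero]
  | smul c x _ hx => rw [map_smul, hx, smul_zero]

theorem coord_eq_zero {k : ℕ} {x : X} (hx : x ∈ tailClosure w k) {i : ℕ} (hi : i < k) :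
    f i x = 0 := by
  have : tailClosure w k ≤ (f i).toLinearMap.ker := by
    refine Submodule.topologicalClosure_minimal _ ?_ (f i).isClosed_ker
    rw [Submodule.span_le]
    rintro _ ⟨j, hj, rfl⟩
    have : i ≠ j := (lt_of_lt_of_le hi hj).ne
    simp [h.biorth, this]
  exact this hx

theorem coord_res (E : Finset ℕ) (x : X) (i : ℕ) :
    f i (res w f E x) = if i ∈ E then f i x else 0 := by
  simp [res_apply, h.biorth]

theorem res_res (E F : Finset ℕ) (x : X) : res w f E (res w f F x) = res w f (E ∩ F) x := by
  rw [res_apply w f E, res_apply w f (E ∩ F)]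
  simp only [h.coord_res, ite_smul, zero_smul, Finset.sum_ite_mem]

theorem norm_res_le {x : X} (hx : x ∈ tailClosure w 0) (a b : ℕ) :
    ‖res w f (Finset.Ico a b) x‖ ≤ 2 * K * ‖x‖ := by
  have hK := h.one_le
  rcases le_or_gt a b with hab | hab
  · have : res w f (Finset.Ico a b) x =
        res w f (Finset.range b) x - res w f (Finset.range a) x := by
      simp only [res_apply]
      exact Finset.sum_Ico_eq_sub _ hab
    rw [this]
    refine (norm_sub_le _ _).trans ?_
    have := h.bound a x hx
    have := h.bound b x hx
    linarith
  · rw [Finset.Ico_eq_empty (not_lt.2 hab.le)]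
    simp only [res_apply, Finset.sum_empty, norm_zero]
    positivity

/-- The sum of the norms of the pieces of `x` over an admissible family of intervals. -/
theorem sum_norm_res_le_of_ge {𝓕 : Set (Finset ℕ)} {k : ℕ} {c : ℝ} (hc : 0 < c)
    (hl : LowerEst w 𝓕 k c) {x : X} (hx : x ∈ tailClosure w 0) {A : Finset ℕ} (hA : A ∈ 𝓕)
    (hk : ∀ t ∈ A, k ≤ t) {r : ℕ → ℕ} (hr : Adm A r) :
    ∑ t ∈ A, ‖res w f (Finset.Ico t (r t)) x‖ ≤ 4 * K ^ 2 / c * ‖x‖ := by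
  have hK := h.one_le
  rcases Finset.eq_empty_or_nonempty A with rfl | hne
  · simp only [Finset.sum_empty]
    positivity
  let L := A.sup r
  -- `Q t` extends the interval starting at `t` up to the next element of `A` (or to `L`). With the
  -- gaps filled, the pieces add up to a single interval projection of `x`, to which the lower
  -- estimate applies. Returning to the original intervals costs another factor `2 * K`.
  let Q : ℕ → Finset ℕ := fun t => (Finset.range L).filter fun i => t ≤ i ∧ ∀ t' ∈ A, t' ≤ i → t' ≤ t
  have hQ : ∀ t i, i ∈ Q t ↔ i < L ∧ t ≤ i ∧ ∀ t' ∈ A, t' ≤ i → t' ≤ t := by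
    intro t i
    simp [Q]
  have hsub : ∀ t ∈ A, Finset.Ico t (r t) ⊆ Q t := by
    intro t ht i hi
    rw [Finset.mem_Ico] at hi
    refine (hQ t i).2 ⟨hi.2.trans_le (Finset.le_sup (f := r) ht), hi.1, fun t' ht' hle => ?_⟩
    by_contra hcon
    have := hr t ht t' ht' (not_le.1 hcon)
    omega
  have hspan : ∀ t, res w f (Q t) x ∈ Submodule.span ℝ (w '' Set.Ico t ((Q t).sup (· + 1))) :=
    fun t => res_mem_span _ _ fun i hi => ⟨((hQ t i).1 hi).2.1,
      Finset.le_sup (f := (· + 1)) hi⟩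
  have h1 := hl A hA hk (fun t => (Q t).sup (· + 1)) (fun t ht t' ht' hlt => by
    refine Finset.sup_le fun i hi => ?_
    by_contra hcon
    have := ((hQ t i).1 hi).2.2 t' ht' (by omega)
    omega) (fun t => res w f (Q t) x) (fun t _ => hspan t)
  have hdisj : (A : Set ℕ).PairwiseDisjoint Q := by
    intro t ht t' ht' hne
    rw [Function.onFun, Finset.disjoint_left]
    intro i hi hi'
    have h2 := ((hQ t i).1 hi)
    have h3 := ((hQ t' i).1 hi')
    exact hne (le_antisymm (h3.2.2 t ht h2.2.1) (h2.2.2 t' ht' h3.2.1))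
  have hunion : A.biUnion Q = Finset.Ico (A.min' hne) L := by
    ext i
    simp only [Finset.mem_biUnion, hQ, Finset.mem_Ico]
    constructor
    · rintro ⟨t, ht, hi, hti, -⟩
      exact ⟨(Finset.min'_le _ _ ht).trans hti, hi⟩
    · rintro ⟨hi, hiL⟩
      have hne' : (A.filter (· ≤ i)).Nonempty :=
        ⟨_, Finset.mem_filter.2 ⟨Finset.min'_mem _ hne, hi⟩⟩
      have hmem := Finset.mem_filter.1 (Finset.max'_mem _ hne')
      exact ⟨_, hmem.1, hiL, hmem.2, fun t' ht' hle =>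
        Finset.le_max' _ _ (Finset.mem_filter.2 ⟨ht', hle⟩)⟩
  have hsum : ∑ t ∈ A, res w f (Q t) x = res w f (Finset.Ico (A.min' hne) L) x := by
    rw [← hunion]
    simp only [res_apply]
    rw [Finset.sum_biUnion hdisj]
  rw [hsum] at h1
  have h2 := h.norm_res_le hx (A.min' hne) L
  have h3 : ∀ t ∈ A, ‖res w f (Finset.Ico t (r t)) x‖ ≤ 2 * K * ‖res w f (Q t) x‖ := by
    intro t ht
    have h4 := h.norm_res_le (span_le_tailClosure w (fun _ _ => Nat.zero_le _) (hspan t)) t (r t)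
    rwa [h.res_res, Finset.inter_eq_left.2 (hsub t ht)] at h4
  calc ∑ t ∈ A, ‖res w f (Finset.Ico t (r t)) x‖
      ≤ 2 * K * ∑ t ∈ A, ‖res w f (Q t) x‖ := by
        rw [Finset.mul_sum]
        exact Finset.sum_le_sum h3
    _ ≤ 2 * K * (2 * K * ‖x‖ / c) := by
        refine mul_le_mul_of_nonneg_left ?_ (by positivity)
        rw [le_div_iff₀ hc]
        linarith
    _ = 4 * K ^ 2 / c * ‖x‖ := by ring

/-- Among the intervals that start before `k`, all but the last end by `k`, where `x` has no
coordinates. The last one accounts for the extra `2 * K`. -/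
theorem sum_norm_res_le {𝓕 : Set (Finset ℕ)} (h𝓕 : IsReg 𝓕) {k : ℕ} {c : ℝ} (hc : 0 < c)
    (hl : LowerEst w 𝓕 k c) {x : X} (hx : x ∈ tailClosure w k) {A : Finset ℕ} (hA : A ∈ 𝓕)
    {r : ℕ → ℕ} (hr : Adm A r) :
    ∑ t ∈ A, ‖res w f (Finset.Ico t (r t)) x‖ ≤ (4 * K ^ 2 / c + 2 * K) * ‖x‖ := by
  have hK := h.one_le
  have hx0 := tailClosure_anti w (Nat.zero_le k) hx
  rw [← Finset.sum_filter_add_sum_filter_not A (fun t => k ≤ t), add_mul]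
  refine add_le_add ?_ ?_
  · exact h.sum_norm_res_le_of_ge hc hl hx0 (h𝓕.mono hA (Finset.filter_subset _ _))
      (fun t ht => (Finset.mem_filter.1 ht).2) (hr.mono (Finset.filter_subset _ _))
  · rcases Finset.eq_empty_or_nonempty (A.filter fun t => ¬ k ≤ t) with he | hne
    · rw [he, Finset.sum_empty]
      positivity
    · have hmax := Finset.mem_filter.1 (Finset.max'_mem _ hne)
      rw [Finset.sum_eq_single_of_mem _ (Finset.max'_mem _ hne)]
      · exact h.norm_res_le hx0 _ _
      · intro t ht htne
        have hlt := lt_of_le_of_ne (Finset.le_max' _ _ ht) htne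
        have h1 := hr t (Finset.mem_filter.1 ht).1 _ hmax.1 hlt
        rw [norm_eq_zero, res_apply]
        refine Finset.sum_eq_zero fun i hi => ?_
        rw [h.coord_eq_zero hx (by have := Finset.mem_Ico.1 hi; omega), zero_smul]

/-- If `𝓕` is stable for `w`, then every block sequence has vectors whose `𝓕`-admissible pieces
have large norms. -/
theorem exists_large {𝓕 : Set (Finset ℕ)} (h𝓕 : IsReg 𝓕) (hst : Stable w 𝓕) {τ : ℝ} (hτ : 0 < τ)
    (hlt : τ * lowerConst w 𝓕 < 1) {v : ℕ → X} (hv : IsBlk 0 v w) :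
    ∃ y ∈ Submodule.span ℝ (Set.range v), y ≠ 0 ∧ ∃ A ∈ 𝓕, ∃ r, Adm A r ∧
      τ * ‖y‖ ≤ ∑ t ∈ A, ‖res w f (Finset.Ico t (r t)) y‖ := by
  -- An estimate with constant `1 / τ` would exceed the stable constant. The blocks violating it add
  -- up to the desired vector, and its pieces over their supports are the blocks themselves.
  have h1 : ¬ LowerEst v 𝓕 0 (1 / τ) := by
    intro hl
    have h2 := hl.le_lowerConst h𝓕 fun _ => hv.ne_zero
    have h3 := h2.trans (hst 0 v hv)
    rw [div_le_iff₀ hτ] at h3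
    linarith
  obtain ⟨p, hp⟩ := hv
  simp only [LowerEst, not_forall, not_le] at h1
  obtain ⟨A, hA, -, r, hr, x, hx, hlt'⟩ := h1
  have hx' : ∀ t ∈ A, x t ∈ Submodule.span ℝ (w '' Set.Ico (p t) (p (r t))) :=
    fun t ht => hp.span_le (Nat.zero_le _) (hx t ht)
  have hinv : ∀ i, Function.invFun p (p i) = i := Function.leftInverse_invFun hp.1.injective
  have hres : ∀ t ∈ A, res w f (Finset.Ico (p t) (p (r t))) (∑ t ∈ A, x t) = x t := by
    intro t ht
    rw [map_sum, Finset.sum_eq_single_of_mem t ht]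
    · exact h.res_eq_self (fun i hi => by simpa using hi) (hx' t ht)
    · intro t' ht' hne
      refine h.res_eq_zero (fun i hi hi' => ?_) (hx' t' ht')
      rw [Finset.mem_Ico] at hi'
      rcases lt_or_gt_of_ne hne with hlt | hlt
      · have := hp.1.monotone (hr t' ht' t ht hlt)
        exact absurd (hi.2.trans_le this) (not_lt.2 hi'.1)
      · have := hp.1.monotone (hr t ht t' ht' hlt)
        exact absurd (hi'.2.trans_le this) (not_lt.2 hi.1)
  refine ⟨∑ t ∈ A, x t, ?_, ?_, A.image p, h𝓕.image_of_strictMono hA hp.1,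
    fun i => p (r (Function.invFun p i)), ?_, ?_⟩
  · exact Submodule.sum_mem _ fun t ht => Submodule.span_mono (Set.image_subset_range _ _) (hx t ht)
  · intro h0
    have : ∑ t ∈ A, ‖x t‖ = 0 := Finset.sum_eq_zero fun t ht => by
      rw [← hres t ht, h0, map_zero, norm_zero]
    rw [this, h0, norm_zero, mul_zero] at hlt'
    exact lt_irrefl _ hlt'
  · intro t ht t' ht' hlt
    obtain ⟨i, hi, rfl⟩ := Finset.mem_image.1 ht
    obtain ⟨i', hi', rfl⟩ := Finset.mem_image.1 ht'
    simp only [hinv]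
    exact hp.1.monotone (hr i hi i' hi' (hp.1.lt_iff_lt.1 hlt))
  · rw [Finset.sum_image hp.1.injective.injOn]
    simp only [hinv]
    have hsum : ∑ t ∈ A, ‖res w f (Finset.Ico (p t) (p (r t))) (∑ t ∈ A, x t)‖ = ∑ t ∈ A, ‖x t‖ :=
      Finset.sum_congr rfl fun t ht => by rw [hres t ht]
    rw [hsum]
    rw [one_div, inv_mul_eq_div, lt_div_iff₀ hτ] at hlt'
    linarith

end CoordSystem

end Coord

/-! ### Extension of norms, distortion and block subspaces -/

section Ratio

variable {X : Type*} [NormedAddCommGroup X] [NormedSpace ℝ X]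

/-- The extension is the infimal convolution of `q` with `M` times the norm. The upper bound on `q`
makes it agree with `q` on `Y`, the lower bound keeps it above the norm of `X`. -/
theorem exists_seminorm_extension (Y : Submodule ℝ X) (q : Seminorm ℝ Y) {M : ℝ} (hM : 1 ≤ M)
    (h1 : ∀ y : Y, ‖y‖ ≤ q y) (h2 : ∀ y : Y, q y ≤ M * ‖y‖) :
    ∃ N : Seminorm ℝ X, (∀ y : Y, N y = q y) ∧ ∀ x, ‖x‖ ≤ N x ∧ N x ≤ M * ‖x‖ := by
  let g : X → Y → ℝ := fun x y => q y + M * ‖x - y‖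
  have hg : ∀ x y, ‖x‖ ≤ g x y := by
    intro x y
    have h3 : ‖x‖ ≤ ‖(y : X)‖ + ‖x - y‖ := by
      have := norm_add_le (y : X) (x - y)
      rwa [add_sub_cancel] at this
    have h4 : ‖x - y‖ ≤ M * ‖x - y‖ := le_mul_of_one_le_left (norm_nonneg _) hM
    have h5 := h1 y
    rw [Submodule.coe_norm] at h5
    simp only [g]
    linarith
  have hbdd : ∀ x, BddBelow (Set.range (g x)) := fun x => ⟨‖x‖, by rintro _ ⟨y, rfl⟩; exact hg x y⟩
  let N : X → ℝ := fun x => ⨅ y, g x y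
  have hNle : ∀ x y, N x ≤ g x y := fun x y => ciInf_le (hbdd x) y
  have hN0 : N 0 = 0 := by
    refine le_antisymm ?_ (le_ciInf fun y => ?_)
    · have := hNle 0 0
      simpa [g] using this
    · simpa using hg 0 y
  have hadd : ∀ x x', N (x + x') ≤ N x + N x' := by
    intro x x'
    refine le_ciInf_add_ciInf fun y y' => (hNle _ (y + y')).trans ?_
    have h3 := map_add_le_add q y y'
    have h4 : ‖x + x' - ((y + y' : Y) : X)‖ ≤ ‖x - y‖ + ‖x' - y'‖ := by
      rw [Submodule.coe_add, add_sub_add_comm]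
      exact norm_add_le _ _
    have h5 := mul_le_mul_of_nonneg_left h4 (zero_le_one.trans hM)
    simp only [g]
    linarith
  have hsmul : ∀ (c : ℝ) x, N (c • x) ≤ ‖c‖ * N x := by
    intro c x
    simp only [N]
    rw [Real.mul_iInf_of_nonneg (norm_nonneg c)]
    refine le_ciInf fun y => (hNle _ (c • y)).trans (le_of_eq ?_)
    simp only [g]
    rw [map_smul_eq_mul, Submodule.coe_smul, ← smul_sub, norm_smul]
    ring
  refine ⟨Seminorm.ofSMulLE N hN0 hadd hsmul, fun y => ?_, fun x => ⟨le_ciInf (hg x), ?_⟩⟩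
  · refine le_antisymm ?_ (le_ciInf fun y' => ?_)
    · have := hNle y y
      simp only [g, sub_self, norm_zero, mul_zero, add_zero] at this
      exact this
    · have h3 := map_add_le_add q y' (y - y')
      have h4 := h2 (y - y')
      rw [add_sub_cancel] at h3
      rw [Submodule.coe_norm, Submodule.coe_sub] at h4
      simp only [g]
      linarith
  · have := hNle x 0
    simp only [g, map_zero, Submodule.coe_zero, sub_zero, zero_add] at this
    exact this

variable {w : ℕ → X} {f : ℕ → X →L[ℝ] ℝ} {K : ℝ}

/-- The norms `∑ ‖E_t x‖` of `x` over the `𝓕`-admissible families of intervals. -/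
def admSums (w : ℕ → X) (f : ℕ → X →L[ℝ] ℝ) (𝓕 : Set (Finset ℕ)) (x : X) : Set ℝ :=
  {σ | ∃ A ∈ 𝓕, ∃ r, Adm A r ∧ σ = ∑ t ∈ A, ‖res w f (Finset.Ico t (r t)) x‖}

/-- An equivalent norm on `X` that is the supremum of the norms of admissible pieces on
the closed linear span of a tail of `w`. -/
theorem CoordSystem.exists_norm (h : CoordSystem w f K) {𝓕 : Set (Finset ℕ)} (h𝓕 : IsReg 𝓕)
    {k : ℕ} {c : ℝ} (hc : 0 < c) (hl : LowerEst w 𝓕 k c) :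
    ∃ (M : ℝ) (N : Seminorm ℝ X), 1 ≤ M ∧ (∀ x, ‖x‖ ≤ N x ∧ N x ≤ M * ‖x‖) ∧
      ∀ x ∈ tailClosure w k, IsLUB (admSums w f 𝓕 x) (N x) := by
  have hK := h.one_le
  let Y := tailClosure w k
  let M := 4 * K ^ 2 / c + 2 * K
  have hM : 1 ≤ M := by
    have : 0 ≤ 4 * K ^ 2 / c := by positivity
    simp only [M]
    linarith
  let ι := {P : Finset ℕ × (ℕ → ℕ) // P.1 ∈ 𝓕 ∧ Adm P.1 P.2}
  have : Nonempty ι := ⟨⟨(∅, id), h𝓕.empty, fun t ht => absurd ht (Finset.notMem_empty t)⟩⟩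
  let g : Y → ι → ℝ := fun y P => ∑ t ∈ P.1.1, ‖res w f (Finset.Ico t (P.1.2 t)) y‖
  have hg0 : ∀ y P, 0 ≤ g y P := fun y P => Finset.sum_nonneg fun _ _ => norm_nonneg _
  have hgM : ∀ y P, g y P ≤ M * ‖y‖ := fun y P => h.sum_norm_res_le h𝓕 hc hl y.2 P.2.1 P.2.2
  have hbdd : ∀ y, BddAbove (Set.range (g y)) := fun y =>
    ⟨M * ‖y‖, by rintro _ ⟨P, rfl⟩; exact hgM y P⟩
  let q : Seminorm ℝ Y := Seminorm.ofSMulLE (fun y => ⨆ P, g y P) (by simp [g])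
    (by
      intro y y'
      refine ciSup_le fun P => ?_
      refine le_trans ?_ (add_le_add (le_ciSup (hbdd y) P) (le_ciSup (hbdd y') P))
      simp only [g]
      rw [← Finset.sum_add_distrib]
      refine Finset.sum_le_sum fun t _ => ?_
      rw [Submodule.coe_add, map_add]
      exact norm_add_le _ _)
    (by
      intro c y
      refine ciSup_le fun P => ?_
      refine le_trans (le_of_eq ?_) (mul_le_mul_of_nonneg_left (le_ciSup (hbdd y) P) (norm_nonneg c))
      simp only [g, Submodule.coe_smul, map_smul, norm_smul, Finset.mul_sum])
  have hq : ∀ y : Y, IsLUB (Set.range (g y)) (q y) := fun y => isLUB_ciSup (hbdd y)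
  have hq1 : ∀ y : Y, ‖y‖ ≤ q y := by
    intro y
    have h1 := (h.expand y (tailClosure_anti w (Nat.zero_le k) y.2)).norm
    refine le_of_tendsto h1 (Filter.Eventually.of_forall fun n => ?_)
    -- The single interval `[0, n)` is admissible, so `q` dominates the norms of all partial sums,
    -- and hence the norm.
    refine (hq y).1 ⟨⟨({0}, fun _ => n), h𝓕.2 0, ?_⟩, ?_⟩
    · intro t ht t' ht' hlt
      simp_all
    · simp [g]
  obtain ⟨N, hN1, hN2⟩ := exists_seminorm_extension Y q hM hq1 fun y => ciSup_le (hgM y)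
  refine ⟨M, N, hM, hN2, fun x hx => ?_⟩
  have h1 := hq ⟨x, hx⟩
  rw [← hN1] at h1
  convert h1 using 1
  ext σ
  constructor
  · rintro ⟨A, hA, r, hr, rfl⟩
    exact ⟨⟨(A, r), hA, hr⟩, rfl⟩
  · rintro ⟨P, rfl⟩
    exact ⟨P.1.1, P.2.1, P.1.2, P.2.2, rfl⟩

theorem exists_subspace_of_distortion_lt {N : Seminorm ℝ X} {Y : Submodule ℝ X}
    {d : ℝ} (hd : 0 ≤ d) (h : distortion Y N < ENNReal.ofReal d) :
    ∃ Z : Submodule ℝ X, IsSubspace Z ∧ Z ≤ Y ∧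
      ∀ x ∈ Z, ∀ y ∈ Z, ‖x‖ = 1 → ‖y‖ = 1 → N x / N y ≤ d := by
  unfold distortion at h
  simp only [iInf_lt_iff] at h
  obtain ⟨Z, hZ, hZY, hlt⟩ := h
  refine ⟨Z, hZ, hZY, fun x hx y hy hx1 hy1 => ?_⟩
  have h1 : ENNReal.ofReal (N x / N y) ≤ ENNReal.ofReal d := by
    refine le_trans ?_ hlt.le
    exact le_iSup₂_of_le x hx (le_iSup₂_of_le y hy (le_iSup₂_of_le hx1 hy1 le_rfl))
  exact (ENNReal.ofReal_le_ofReal_iff hd).1 h1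

theorem IsSubspace.exists_norm_one {Z : Submodule ℝ X} (h : IsSubspace Z) :
    ∃ x ∈ Z, ‖x‖ = 1 := by
  have : Z ≠ ⊥ := by
    rintro rfl
    exact h.2 inferInstance
  obtain ⟨x, hx, hx0⟩ := Submodule.exists_mem_ne_zero_of_ne_bot this
  refine ⟨‖x‖⁻¹ • x, Z.smul_mem _ hx, ?_⟩
  rw [norm_smul, norm_inv, norm_norm, inv_mul_cancel₀ (norm_ne_zero_iff.2 hx0)]

/-- Tested on the norm of `X` itself, every ratio of values at unit vectors equals 1. -/
theorem BoundedDistortion.one_le {D : ℝ} (hD : BoundedDistortion X D)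
    (hX : ¬ FiniteDimensional ℝ X) : 1 ≤ D := by
  by_contra hlt
  have h1 := hD (normSeminorm ℝ X) ⟨1, 1, one_pos, one_pos, fun x => by simp⟩ ⊤
    ⟨isClosed_univ, fun hfin => hX (by
      have := hfin
      exact Module.finite_def.2 (Module.Finite.iff_fg.1 this))⟩
  -- `max D 0` appears because `ENNReal.ofReal` truncates negative numbers. Its midpoint with 1
  -- gives a strict bound, which is needed as the infimum may not be attained.
  have h2 : distortion (⊤ : Submodule ℝ X) (normSeminorm ℝ X) <
      ENNReal.ofReal ((max D 0 + 1) / 2) := by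
    refine h1.trans_lt ((ENNReal.ofReal_lt_ofReal_iff ?_).2 ?_)
    all_goals rcases max_cases D 0 with h | h <;> linarith
  obtain ⟨Z, hZ, -, hr⟩ := exists_subspace_of_distortion_lt
    (by rcases max_cases D 0 with h | h <;> linarith) h2
  obtain ⟨x, hx, hx1⟩ := hZ.exists_norm_one
  have := hr x hx x hx hx1 hx1
  simp only [coe_normSeminorm, hx1] at this
  rcases max_cases D 0 with h | h <;> linarith

/-- The infimum may not be attained, whence `2 * D`. Multiplying the ratio out makes the inequality
homogeneous and valid for zero vectors too. -/
theorem BoundedDistortion.exists_subspace {D : ℝ} (hD : BoundedDistortion X D) (hD1 : 1 ≤ D)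
    {N : Seminorm ℝ X} {M : ℝ} (hM : 1 ≤ M) (hN : ∀ x, ‖x‖ ≤ N x ∧ N x ≤ M * ‖x‖)
    {Y : Submodule ℝ X} (hY : IsSubspace Y) :
    ∃ Z : Submodule ℝ X, IsSubspace Z ∧ Z ≤ Y ∧
      ∀ x ∈ Z, ∀ y ∈ Z, N x * ‖y‖ ≤ 2 * D * (N y * ‖x‖) := by
  have h1 := hD N ⟨1, M, one_pos, by linarith, fun x => by simpa using hN x⟩ Y hY
  obtain ⟨Z, hZ, hZY, hr⟩ := exists_subspace_of_distortion_lt (d := 2 * D) (by linarith)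
    (h1.trans_lt ((ENNReal.ofReal_lt_ofReal_iff (by linarith)).2 (by linarith)))
  refine ⟨Z, hZ, hZY, fun x hx y hy => ?_⟩
  rcases eq_or_ne x 0 with rfl | hx0
  · simp
  rcases eq_or_ne y 0 with rfl | hy0
  · simp
  have hxn := norm_pos_iff.2 hx0
  have hyn := norm_pos_iff.2 hy0
  have hNy : 0 < N y := hyn.trans_le (hN y).1
  have h2 := hr (‖x‖⁻¹ • x) (Z.smul_mem _ hx) (‖y‖⁻¹ • y) (Z.smul_mem _ hy)
    (by rw [norm_smul, norm_inv, norm_norm, inv_mul_cancel₀ hxn.ne'])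
    (by rw [norm_smul, norm_inv, norm_norm, inv_mul_cancel₀ hyn.ne'])
  rw [map_smul_eq_mul, map_smul_eq_mul, norm_inv, norm_inv, norm_norm, norm_norm] at h2
  rw [div_le_iff₀ (by positivity)] at h2
  have h3 := mul_le_mul_of_nonneg_left h2 (mul_nonneg hxn.le hyn.le)
  field_simp at h3
  linarith

theorem not_finiteDimensional_tailClosure (h : CoordSystem w f K) (k : ℕ) :
    ¬ FiniteDimensional ℝ (tailClosure w k) := by
  intro hfin
  have hli : LinearIndependent ℝ w := by
    rw [linearIndependent_iff']
    intro s g hg i hi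
    have := congrArg (f i) hg
    simpa [h.biorth, hi] using this
  let v : ℕ → tailClosure w k := fun i =>
    ⟨w (i + k), span_le_tailClosure w (S := {i + k}) (by simp) (Submodule.subset_span (by simp))⟩
  have hv : LinearIndependent ℝ v := by
    refine LinearIndependent.of_comp (tailClosure w k).subtype ?_
    exact hli.comp (fun i => i + k) (add_left_injective k)
  exact not_finite_iff_infinite.2 inferInstance hv.finite

/-- Vectors of an infinite-dimensional subspace that are close to blocks far out. -/
theorem CoordSystem.exists_near_block (h : CoordSystem w f K) {Z : Submodule ℝ X}
    (hZ : Z ≤ tailClosure w 0) (hfin : ¬ FiniteDimensional ℝ Z) (n : ℕ) {ε : ℝ} (hε : 0 < ε) :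
    ∃ x ∈ Z, ‖x‖ = 1 ∧ ∃ m, n < m ∧ ‖x - res w f (Finset.Ico n m) x‖ ≤ ε := by
  -- Some nonzero vector of the infinite-dimensional `Z` has its first `n` coordinates zero; a long
  -- partial sum of its normalization is the block.
  let T : Z →ₗ[ℝ] (Fin n → ℝ) := LinearMap.pi fun i => (f i).toLinearMap.comp Z.subtype
  have hT : ¬ Function.Injective T := fun hinj => hfin (FiniteDimensional.of_injective T hinj)
  rw [← LinearMap.ker_eq_bot] at hT
  obtain ⟨x, hx, hx0⟩ := Submodule.exists_mem_ne_zero_of_ne_bot hT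
  have hx0' : (x : X) ≠ 0 := by simpa using hx0
  have hxf : ∀ i < n, f i x = 0 := fun i hi => congrFun (LinearMap.mem_ker.1 hx) ⟨i, hi⟩
  set y : X := ‖(x : X)‖⁻¹ • (x : X) with hy
  have hyZ : y ∈ Z := Z.smul_mem _ x.2
  have h1 := (h.expand y (hZ hyZ)).const_sub y |>.norm
  rw [sub_self, norm_zero] at h1
  obtain ⟨m, hm, hnm⟩ := ((h1.eventually (ge_mem_nhds hε)).and (Filter.eventually_gt_atTop n)).exists
  refine ⟨y, hyZ, ?_, m, hnm, ?_⟩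
  · rw [hy, norm_smul, norm_inv, norm_norm, inv_mul_cancel₀ (norm_ne_zero_iff.2 hx0')]
  · suffices hres : res w f (Finset.Ico n m) y = res w f (Finset.range m) y by rwa [hres]
    rw [res_apply, res_apply, Finset.sum_Ico_eq_sub _ hnm.le, sub_eq_self]
    refine Finset.sum_eq_zero fun i hi => ?_
    rw [hy, map_smul, hxf i (Finset.mem_range.1 hi), smul_zero, zero_smul]

/-- Every infinite-dimensional subspace is, up to a perturbation, a block subspace. -/
theorem CoordSystem.exists_block_near (h : CoordSystem w f K) {Z : Submodule ℝ X}
    (hZ : Z ≤ tailClosure w 0) (hfin : ¬ FiniteDimensional ℝ Z) {η : ℝ} (hη : 0 < η) :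
    ∃ z, IsBlk 0 z w ∧ ∀ y ∈ Submodule.span ℝ (Set.range z), ∃ x ∈ Z, ‖x - y‖ ≤ η * ‖y‖ := by
  have hK := h.one_le
  -- The bound 1/2 keeps `‖z j‖ ≥ 1 / 2`, so coefficients of `y` are at most `4 * K * ‖y‖`. The
  -- errors `ε j` sum to at most `2 * δ`, and `8 * K * δ ≤ η`.
  let δ : ℝ := min (η / (8 * K)) (1 / 2)
  have hδ : 0 < δ := lt_min (by positivity) (by norm_num)
  let ε : ℕ → ℝ := fun j => δ * (1 / 2) ^ j
  have hε : ∀ j, 0 < ε j := fun j => by positivity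
  have hε2 : ∀ j, ε j ≤ 1 / 2 := fun j =>
    (mul_le_of_le_one_right hδ.le (pow_le_one₀ (by norm_num) (by norm_num))).trans (min_le_right _ _)
  choose x hxZ hx1 m hm hxm using fun n j => h.exists_near_block hZ hfin n (hε j)
  let p : ℕ → ℕ := fun j => Nat.rec 0 (fun j n => m n j) j
  have hp : StrictMono p := strictMono_nat_of_lt_succ fun j => hm (p j) j
  let z : ℕ → X := fun j => res w f (Finset.Ico (p j) (p (j + 1))) (x (p j) j)
  have hxz : ∀ j, ‖x (p j) j - z j‖ ≤ ε j := fun j => hxm (p j) j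
  have hz2 : ∀ j, 1 / 2 ≤ ‖z j‖ := by
    intro j
    have h1 := norm_sub_norm_le (x (p j) j) (z j)
    have h2 := hxz j
    have h3 := hε2 j
    rw [hx1] at h1
    linarith
  have hzs : ∀ j, z j ∈ Submodule.span ℝ (w '' Set.Ico (p j) (p (j + 1))) := fun j =>
    res_mem_span _ _ fun i hi => by simpa using hi
  refine ⟨z, ⟨p, hp, fun j _ => ⟨?_, hzs j⟩⟩, fun y hy => ?_⟩
  · intro h0
    have := hz2 j
    rw [h0, norm_zero] at this
    linarith
  rw [Finsupp.mem_span_range_iff_exists_finsupp] at hy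
  obtain ⟨b, hb⟩ := hy
  have hb' : ∑ j ∈ b.support, b j • z j = y := hb
  have hy0 : y ∈ tailClosure w 0 := by
    rw [← hb']
    exact Submodule.sum_mem _ fun j _ => Submodule.smul_mem _ _
      (span_le_tailClosure w (fun _ _ => Nat.zero_le _) (hzs j))
  have hbj : ∀ j ∈ b.support, |b j| ≤ 4 * K * ‖y‖ := by
    intro j hj
    have h1 := h.norm_res_le hy0 (p j) (p (j + 1))
    have h2 : res w f (Finset.Ico (p j) (p (j + 1))) y = b j • z j := by
      rw [← hb', map_sum, Finset.sum_eq_single_of_mem j hj]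
      · rw [map_smul, h.res_eq_self (fun i hi => by simpa using hi) (hzs j)]
      · intro j' _ hne
        rw [map_smul, h.res_eq_zero (fun i hi hi' => ?_) (hzs j'), smul_zero]
        rw [Finset.mem_Ico] at hi'
        rcases lt_or_gt_of_ne hne with hlt | hlt
        · exact absurd (hi.2.trans_le (hp.monotone hlt)) (not_lt.2 hi'.1)
        · exact absurd (hi'.2.trans_le (hp.monotone hlt)) (not_lt.2 hi.1)
    rw [h2, norm_smul, Real.norm_eq_abs] at h1
    have h3 := mul_le_mul_of_nonneg_left (hz2 j) (abs_nonneg (b j))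
    linarith
  refine ⟨∑ j ∈ b.support, b j • x (p j) j, Submodule.sum_mem _ fun j _ =>
    Z.smul_mem _ (hxZ _ _), ?_⟩
  rw [← hb', ← Finset.sum_sub_distrib, hb']
  calc ‖∑ j ∈ b.support, (b j • x (p j) j - b j • z j)‖
      ≤ ∑ j ∈ b.support, ‖b j • x (p j) j - b j • z j‖ := norm_sum_le _ _
    _ ≤ ∑ j ∈ b.support, 4 * K * ‖y‖ * ε j := by
        refine Finset.sum_le_sum fun j hj => ?_
        rw [← smul_sub, norm_smul, Real.norm_eq_abs]
        exact mul_le_mul (hbj j hj) (hxz j) (norm_nonneg _) (by positivity)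
    _ = 4 * K * ‖y‖ * δ * ∑ j ∈ b.support, (1 / 2 : ℝ) ^ j := by
        rw [Finset.mul_sum]
        exact Finset.sum_congr rfl fun j _ => by simp only [ε]; ring
    _ ≤ 4 * K * ‖y‖ * (η / (8 * K)) * 2 := by
        have h1 : ∑ j ∈ b.support, (1 / 2 : ℝ) ^ j ≤ 2 := by
          refine le_trans ?_ tsum_geometric_two.le
          exact summable_geometric_two.sum_le_tsum _ fun _ _ => by positivity
        have h2 : δ ≤ η / (8 * K) := min_le_left _ _
        gcongr
    _ = η * ‖y‖ := by
        field_simp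
        ring

/-- In a space of bounded distortion, an equivalent norm is, up to a constant, proportional to the
original one on a block subspace. -/
theorem BoundedDistortion.exists_block {D : ℝ} (hD : BoundedDistortion X D) (hD1 : 1 ≤ D)
    (h : CoordSystem w f K) {N : Seminorm ℝ X} {M : ℝ} (hM : 1 ≤ M)
    (hN : ∀ x, ‖x‖ ≤ N x ∧ N x ≤ M * ‖x‖) :
    ∃ z, IsBlk 0 z w ∧ ∀ x ∈ Submodule.span ℝ (Set.range z),
      ∀ y ∈ Submodule.span ℝ (Set.range z), N x * ‖y‖ ≤ 5 / 2 * D * (N y * ‖x‖) := by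
  obtain ⟨Z, hZ, hZw, hr⟩ := hD.exists_subspace hD1 hM hN (Y := tailClosure w 0)
    ⟨Submodule.isClosed_topologicalClosure _, not_finiteDimensional_tailClosure h 0⟩
  -- With this `η` the perturbation changes both norms by at most one percent, and 2(101/99)² < 5/2.
  obtain ⟨z, hz, hnear⟩ := h.exists_block_near hZw hZ.2 (η := 1 / (100 * M)) (by positivity)
  have key : ∀ y ∈ Submodule.span ℝ (Set.range z), ∃ x ∈ Z, 99 / 100 * ‖y‖ ≤ ‖x‖ ∧
      ‖x‖ ≤ 101 / 100 * ‖y‖ ∧ 99 / 100 * N y ≤ N x ∧ N x ≤ 101 / 100 * N y := by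
    intro y hy
    obtain ⟨x, hx, hxy⟩ := hnear y hy
    have h1 : M * ‖x - y‖ ≤ 1 / 100 * ‖y‖ := by
      have := mul_le_mul_of_nonneg_left hxy (zero_le_one.trans hM)
      have h' : M * (1 / (100 * M) * ‖y‖) = 1 / 100 * ‖y‖ := by field_simp
      linarith
    have h2 : ‖x - y‖ ≤ M * ‖x - y‖ := le_mul_of_one_le_left (norm_nonneg _) hM
    have h3 := norm_sub_norm_le x y
    have h4 := norm_sub_norm_le y x
    have h5 := (hN (x - y)).2
    have h6 := (hN y).1
    have h7 := map_add_le_add N y (x - y)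
    have h8 := map_add_le_add N x (y - x)
    rw [add_sub_cancel] at h7 h8
    rw [map_sub_rev N] at h8
    rw [norm_sub_rev] at h4
    exact ⟨x, hx, by linarith, by linarith, by linarith, by linarith⟩
  refine ⟨z, hz, fun a ha b hb => ?_⟩
  obtain ⟨x, hx, hx1, hx2, hx3, hx4⟩ := key a ha
  obtain ⟨y, hy, hy1, hy2, hy3, hy4⟩ := key b hb
  have h1 := hr x hx y hy
  have hNa := apply_nonneg N a
  have hNb := apply_nonneg N b
  have h2 : (99 / 100 * N a) * (99 / 100 * ‖b‖) ≤ N x * ‖y‖ :=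
    mul_le_mul hx3 hy1 (by positivity) (apply_nonneg N x)
  have h3 : N y * ‖x‖ ≤ (101 / 100 * N b) * (101 / 100 * ‖a‖) :=
    mul_le_mul hy4 hx2 (norm_nonneg _) (by positivity)
  have h4 := mul_le_mul_of_nonneg_left h3 (show 0 ≤ 2 * D by linarith)
  have h5 : 0 ≤ D * (N b * ‖a‖) := by positivity
  nlinarith

/-- The estimates that follow from the existence of vectors with large and of vectors with small
pieces in all block subspaces. -/
theorem BoundedDistortion.exists_block_estimates [CompleteSpace X] {D : ℝ}
    (hD : BoundedDistortion X D)
    (hD1 : 1 ≤ D) (e : SchauderBasis ℝ X) (hw : IsBlk 0 w e.basis) (h : CoordSystem w f K)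
    {𝓕 : Set (Finset ℕ)} (h𝓕 : IsReg 𝓕) (hpos : 0 < lowerConst w 𝓕) {τ σ : ℝ}
    (hτ : ∀ v, IsBlk 0 v w → ∃ y ∈ Submodule.span ℝ (Set.range v), y ≠ 0 ∧
      ∃ s ∈ admSums w f 𝓕 y, τ * ‖y‖ ≤ s)
    (hσ : ∀ v, IsBlk 0 v w → ∃ y ∈ Submodule.span ℝ (Set.range v), y ≠ 0 ∧
      ∀ s ∈ admSums w f 𝓕 y, s ≤ σ * ‖y‖)
    {u : ℕ → X} {l : ℕ} (hu : IsBlk l u w) :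
    ∃ z, IsBlk 0 z u ∧ ∀ x ∈ tailClosure z 0,
      (∀ s ∈ admSums w f 𝓕 x, s ≤ 5 / 2 * D * σ * ‖x‖) ∧
      ∀ B, (∀ s ∈ admSums w f 𝓕 x, s ≤ B) → τ * ‖x‖ ≤ 5 / 2 * D * B := by
  obtain ⟨k, hk⟩ := exists_lowerEst (half_lt_self hpos)
  obtain ⟨M, N, hM, hN, hlub⟩ := h.exists_norm h𝓕 (half_pos hpos) hk
  -- Shifting past `l` and `k` puts all further blocks into the tail of `w` on which `N` is the
  -- supremum of the admissible sums.
  have hu' : IsBlk 0 (fun j => u (j + max l k)) u :=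
    isBlk_comp (fun a b hab => Nat.add_lt_add_right hab _) fun j _ =>
      hu.ne_zero ((le_max_left l k).trans (Nat.le_add_left _ _))
  have hu0 : IsBlk 0 (fun j => u (j + max l k)) w := (hu.mono (le_max_left l k)).shift
  obtain ⟨g, K', hsys⟩ := exists_coordSystem e (hu0.trans_zero hw)
  obtain ⟨z, hz, hr⟩ := hD.exists_block hD1 hsys hM hN
  have hzk : tailClosure z 0 ≤ tailClosure w k := by
    refine Submodule.topologicalClosure_minimal _ ?_ (Submodule.isClosed_topologicalClosure _)
    rw [Submodule.span_le]
    rintro _ ⟨j, -, rfl⟩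
    obtain ⟨p, hp, hzp⟩ := hz
    obtain ⟨q, hq, huq⟩ := hu
    refine Submodule.span_le.2 ?_ (hzp j (Nat.zero_le _)).2
    rintro _ ⟨i, -, rfl⟩
    have h1 := (huq (i + max l k) ((le_max_left l k).trans (Nat.le_add_left _ _))).2
    refine span_le_tailClosure w (fun i' hi' => ?_) h1
    exact ((le_max_right l k).trans (Nat.le_add_left _ _)).trans (hq.le_apply.trans hi'.1)
  have hspan : Submodule.span ℝ (Set.range z) ≤ tailClosure z 0 := by
    rw [tailClosure_zero]
    exact Submodule.le_topologicalClosure _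
  have hcont : Continuous N := by
    refine (LipschitzWith.of_le_add_mul ⟨M, zero_le_one.trans hM⟩ fun x y => ?_).continuous
    have h1 := map_add_le_add N y (x - y)
    rw [add_sub_cancel] at h1
    have h2 := (hN (x - y)).2
    rw [dist_eq_norm]
    exact h1.trans (add_le_add_right h2 _)
  have hzw : IsBlk 0 z w := hz.trans_zero hu0
  -- One vector with a large sum and one with small sums fix the nearly constant ratio of `N` to the
  -- norm from both sides.
  obtain ⟨y₁, hy₁, hy₁0, s₁, hs₁, hys₁⟩ := hτ z hzw
  obtain ⟨y₂, hy₂, hy₂0, hs₂⟩ := hσ z hzw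
  have hτN : τ * ‖y₁‖ ≤ N y₁ := hys₁.trans ((hlub y₁ (hzk (hspan hy₁))).1 hs₁)
  have hσN : N y₂ ≤ σ * ‖y₂‖ := (hlub y₂ (hzk (hspan hy₂))).2 hs₂
  have hy₁p := norm_pos_iff.2 hy₁0
  have hy₂p := norm_pos_iff.2 hy₂0
  have hmain : ∀ x ∈ tailClosure z 0, N x ≤ 5 / 2 * D * σ * ‖x‖ ∧ τ * ‖x‖ ≤ 5 / 2 * D * N x := by
    have hcl : IsClosed {x : X | N x ≤ 5 / 2 * D * σ * ‖x‖ ∧ τ * ‖x‖ ≤ 5 / 2 * D * N x} :=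
      (isClosed_le hcont (continuous_const.mul continuous_norm)).inter
        (isClosed_le (continuous_const.mul continuous_norm) (continuous_const.mul hcont))
    intro x hx
    rw [tailClosure_zero] at hx
    refine closure_minimal (fun y hy => And.intro ?_ ?_) hcl hx
    · have h1 := hr y hy y₂ hy₂
      have h2 : N y₂ * ‖y‖ ≤ σ * ‖y₂‖ * ‖y‖ := mul_le_mul_of_nonneg_right hσN (norm_nonneg _)
      have h3 := mul_le_mul_of_nonneg_left h2 (show 0 ≤ 5 / 2 * D by linarith)
      refine le_of_mul_le_mul_right ?_ hy₂p
      linarith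
    · have h1 := hr y₁ hy₁ y hy
      have h2 : τ * ‖y₁‖ * ‖y‖ ≤ N y₁ * ‖y‖ := mul_le_mul_of_nonneg_right hτN (norm_nonneg _)
      refine le_of_mul_le_mul_right ?_ hy₁p
      linarith
  refine ⟨z, hz.trans_zero hu', fun x hx => ?_⟩
  have h1 := hlub x (hzk hx)
  refine ⟨fun s hs => (h1.1 hs).trans (hmain x hx).1, fun B hB => (hmain x hx).2.trans ?_⟩
  exact mul_le_mul_of_nonneg_left (h1.2 hB) (by linarith)

end Ratio

/-! ### Flat vectors in block subspaces -/

section Flat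

variable {X : Type*} [NormedAddCommGroup X] [NormedSpace ℝ X]
  {w : ℕ → X} {f : ℕ → X →L[ℝ] ℝ} {K : ℝ} {u : ℕ → X} {p : ℕ → ℕ}

/-- The `j`-th piece of a vector with respect to the partition into the intervals
`[p j, p (j + 1))`. -/
def blockRes (w : ℕ → X) (f : ℕ → X →L[ℝ] ℝ) (p : ℕ → ℕ) (j : ℕ) : X →L[ℝ] X :=
  res w f (Finset.Ico (p j) (p (j + 1)))

theorem familyProd_of_tail {𝓐 𝓑 𝓖 : Set (Finset ℕ)} {k : ℕ} {E : Finset ℕ}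
    (hE : E ∈ familyProd 𝓐 𝓖) (h : ∀ A ∈ 𝓐, (∀ i ∈ A, k ≤ i) → A ∈ 𝓑) (hk : ∀ i ∈ E, k ≤ i) :
    E ∈ familyProd 𝓑 𝓖 := by
  obtain ⟨n, G, hG, h1, h2, h3, rfl⟩ := hE
  refine ⟨n, G, hG, h1, h2, h _ h3 fun i hi => ?_, rfl⟩
  obtain ⟨j, -, rfl⟩ := Finset.mem_image.1 hi
  exact hk _ (Finset.mem_biUnion.2 ⟨j, Finset.mem_univ _, Finset.min'_mem _ _⟩)

theorem exists_mem_span_Ico {a : ℕ} {y : X} (hy : y ∈ Submodule.span ℝ (u '' Set.Ici a)) :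
    ∃ b, a < b ∧ y ∈ Submodule.span ℝ (u '' Set.Ico a b) := by
  induction hy using Submodule.span_induction with
  | mem x hx =>
    obtain ⟨j, hj, rfl⟩ := hx
    have hj' : a ≤ j := hj
    exact ⟨j + 1, by omega, Submodule.subset_span ⟨j, ⟨hj, Nat.lt_succ_self j⟩, rfl⟩⟩
  | zero => exact ⟨a + 1, Nat.lt_succ_self a, Submodule.zero_mem _⟩
  | add x y _ _ hx hy =>
    obtain ⟨b, hb, hx⟩ := hx
    obtain ⟨c, hc, hy⟩ := hy
    refine ⟨max b c, lt_max_of_lt_left hb, Submodule.add_mem _ ?_ ?_⟩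
    · exact Submodule.span_mono (Set.image_mono (Set.Ico_subset_Ico le_rfl (le_max_left _ _))) hx
    · exact Submodule.span_mono (Set.image_mono (Set.Ico_subset_Ico le_rfl (le_max_right _ _))) hy
  | smul c x _ hx =>
    obtain ⟨b, hb, hx⟩ := hx
    exact ⟨b, hb, Submodule.smul_mem _ _ hx⟩

theorem mem_span_image_of_subset {S T : Set ℕ} (hST : ∀ i ∈ S, i ∈ T) {x : X}
    (hx : x ∈ Submodule.span ℝ (u '' S)) : x ∈ Submodule.span ℝ (u '' T) :=
  Submodule.span_mono (Set.image_mono hST) hx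

namespace CoordSystem

variable (h : CoordSystem w f K) (hu : IsBlkMap 0 p u w)

include h

theorem blockRes_eq_zero {S : Set ℕ} {y : X}
    (hy : y ∈ Submodule.span ℝ (w '' S)) {j : ℕ} (hj : ∀ i ∈ S, i < p j ∨ p (j + 1) ≤ i) :
    blockRes w f p j y = 0 := by
  refine h.res_eq_zero (fun i hi hi' => ?_) hy
  rw [Finset.mem_Ico] at hi'
  have := hj i hi
  omega

include hu

theorem blockRes_of_span_Ico {a b : ℕ} {y : X} (hy : y ∈ Submodule.span ℝ (u '' Set.Ico a b))
    {j : ℕ} (hj : j < a ∨ b ≤ j) : blockRes w f p j y = 0 := by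
  refine h.blockRes_eq_zero (hu.span_le (Nat.zero_le _) hy) fun i hi => ?_
  rcases hj with hj | hj
  · exact Or.inr ((hu.1.monotone hj).trans hi.1)
  · exact Or.inl (hi.2.trans_le (hu.1.monotone hj))

theorem sum_blockRes_filter {k : ℕ} {y : X} (hy : y ∈ Submodule.span ℝ (u '' Set.Ici k))
    (J : Finset ℕ) : ∑ j ∈ J, ‖blockRes w f p j y‖ =
      ∑ j ∈ J.filter (k ≤ ·), ‖blockRes w f p j y‖ := by
  obtain ⟨b, -, hy⟩ := exists_mem_span_Ico hy
  refine (Finset.sum_filter_of_ne fun j _ hne => ?_).symm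
  by_contra hlt
  exact hne (by rw [h.blockRes_of_span_Ico hu hy (Or.inl (not_le.1 hlt)), norm_zero])

omit h in
theorem sum_blockRes_le {𝓗 : Set (Finset ℕ)} {k : ℕ} {M : ℝ}
    (hM : ∀ x ∈ tailClosure w k, ∀ s ∈ admSums w f 𝓗 x, s ≤ M * ‖x‖) {y : X}
    (hy : y ∈ tailClosure w k) {J : Finset ℕ} (hJ : J.image p ∈ 𝓗) :
    ∑ j ∈ J, ‖blockRes w f p j y‖ ≤ M * ‖y‖ := by
  have hinv : ∀ i, Function.invFun p (p i) = i := Function.leftInverse_invFun hu.1.injective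
  refine hM y hy _ ⟨J.image p, hJ, fun i => p (Function.invFun p i + 1), ?_, ?_⟩
  · intro t ht t' ht' hlt
    obtain ⟨i, hi, rfl⟩ := Finset.mem_image.1 ht
    obtain ⟨i', hi', rfl⟩ := Finset.mem_image.1 ht'
    simp only [hinv]
    exact hu.1.monotone (hu.1.lt_iff_lt.1 hlt)
  · rw [Finset.sum_image hu.1.injective.injOn]
    simp only [hinv]
    rfl

omit hu in
theorem admSums_le {𝓗 : Set (Finset ℕ)} (h𝓗 : IsReg 𝓗) {k : ℕ} {c : ℝ} (hc : 0 < c)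
    (hl : LowerEst w 𝓗 k c) : ∀ x ∈ tailClosure w k, ∀ s ∈ admSums w f 𝓗 x,
      s ≤ (4 * K ^ 2 / c + 2 * K) * ‖x‖ := by
  rintro x hx _ ⟨A, hA, r, hr, rfl⟩
  exact h.sum_norm_res_le h𝓗 hc hl hx hA hr

omit h hu in
/-- Every tail of the block sequence `u` has normalized vectors with small `𝓗`-mass. -/
def HasFlat (w : ℕ → X) (f : ℕ → X →L[ℝ] ℝ) (p : ℕ → ℕ) (u : ℕ → X) (𝓗 : Set (Finset ℕ)) : Prop :=
  ∀ ε > 0, ∀ k, ∃ y ∈ Submodule.span ℝ (u '' Set.Ici k), ‖y‖ = 1 ∧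
    ∀ J : Finset ℕ, J.image p ∈ 𝓗 → ∑ j ∈ J, ‖blockRes w f p j y‖ ≤ ε

/-- Averages of long sequences of vectors that are flat for the members of `𝓗` that begin early. -/
theorem hasFlat_of_step {𝓗 : Set (Finset ℕ)} {c M : ℝ} {k₁ : ℕ} (hc : 0 < c)
    (hl : LowerEst w schOne 0 c)
    (hM : ∀ y ∈ Submodule.span ℝ (u '' Set.Ici k₁), ∀ J : Finset ℕ, J.image p ∈ 𝓗 →
      ∑ j ∈ J, ‖blockRes w f p j y‖ ≤ M * ‖y‖)
    (hM0 : 0 ≤ M)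
    (hstep : ∀ (R : ℕ), ∀ ε > 0, ∀ k, ∃ y ∈ Submodule.span ℝ (u '' Set.Ici k), ‖y‖ = 1 ∧
      ∀ J : Finset ℕ, J.image p ∈ 𝓗 → (∃ j ∈ J, p j ≤ R) →
        ∑ j ∈ J, ‖blockRes w f p j y‖ ≤ ε) : HasFlat w f p u 𝓗 := by
  intro ε hε k
  -- A sum of `N` suitable vectors has norm at least `c * N`, while its `𝓗`-mass stays below `M +
  -- 1`; normalizing makes the mass at most `ε`.
  obtain ⟨N, hN⟩ := exists_nat_gt ((M + 1) / (c * ε))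
  have hN0 : (0 : ℝ) < N := lt_of_le_of_lt (by positivity) hN
  have hnext : ∀ a, ∃ b, a < b ∧ ∃ y ∈ Submodule.span ℝ (u '' Set.Ico a b), ‖y‖ = 1 ∧
      ∀ J : Finset ℕ, J.image p ∈ 𝓗 → (∃ j ∈ J, p j ≤ p a) →
        ∑ j ∈ J, ‖blockRes w f p j y‖ ≤ 1 / N := by
    intro a
    obtain ⟨y, hy, hy1, hyJ⟩ := hstep (p a) (1 / N) (by positivity) a
    obtain ⟨b, hab, hy⟩ := exists_mem_span_Ico hy
    exact ⟨b, hab, y, hy, hy1, hyJ⟩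
  choose b hb y hy hy1 hyJ using hnext
  let a : ℕ → ℕ := fun i => Nat.rec (motive := fun _ => ℕ) (max k k₁) (fun _ a => b a) i
  have ha : StrictMono a := strictMono_nat_of_lt_succ fun i => hb (a i)
  have ha0 : ∀ i, max k k₁ ≤ a i := fun i => ha.monotone (Nat.zero_le i)
  let v : ℕ → X := fun i => y (a i)
  have hv : ∀ i, v i ∈ Submodule.span ℝ (u '' Set.Ico (a i) (a (i + 1))) := fun i => hy (a i)
  have hvu : IsBlkMap 0 a v u := ⟨ha, fun i _ => ⟨by
    intro h0
    have := hy1 (a i)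
    rw [show y (a i) = 0 from h0, norm_zero] at this
    exact zero_ne_one this, hv i⟩⟩
  have hlv := (hl.of_isBlkMap isReg_schOne hu).of_isBlkMap isReg_schOne hvu
  -- The window `[N, 2N)` has `N` elements, none below `N`, so it belongs to `schOne`.
  have hlow := hlv (Finset.Ico N (2 * N)) (by
    intro n hn
    rw [Finset.mem_Ico] at hn
    rw [Nat.card_Ico]
    omega) (fun _ _ => Nat.zero_le _) (fun i => i + 1) (fun t _ t' _ hlt => Nat.succ_le_of_lt hlt) v
    (fun t _ => Submodule.subset_span ⟨t, ⟨le_rfl, Nat.lt_succ_self t⟩, rfl⟩)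
  set x : X := ∑ i ∈ Finset.Ico N (2 * N), v i with hx
  have hcard : (Finset.Ico N (2 * N)).card = N := by rw [Nat.card_Ico]; omega
  have hxn : c * N ≤ ‖x‖ := by
    have h1 : ∑ i ∈ Finset.Ico N (2 * N), ‖v i‖ = N := by
      rw [Finset.sum_congr rfl fun i _ => hy1 (a i), Finset.sum_const, hcard, nsmul_eq_mul, mul_one]
    rwa [h1] at hlow
  have hx0 : 0 < ‖x‖ := lt_of_lt_of_le (by positivity) hxn
  have hmass : ∀ J : Finset ℕ, J.image p ∈ 𝓗 → ∑ j ∈ J, ‖blockRes w f p j x‖ ≤ M + 1 := by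
    intro J hJ
    classical
    -- `P i` says that `J` begins strictly inside the range of `v i`, which happens for at most one
    -- `i` and costs `M`. If `J` begins at or before `a i`, the mass on `v i` is at most `1 / N` by
    -- construction; if it begins after that range, the mass is zero.
    let P : ℕ → Prop := fun i => (∀ j ∈ J, a i < j) ∧ ∃ j ∈ J, j < a (i + 1)
    let S : Finset ℕ := (Finset.Ico N (2 * N)).filter P
    have hS : S.card ≤ 1 := by
      rw [Finset.card_le_one]
      intro i hi i' hi'
      obtain ⟨h1, j, hj, h2⟩ := (Finset.mem_filter.1 hi).2
      obtain ⟨h1', j', hj', h2'⟩ := (Finset.mem_filter.1 hi').2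
      rcases lt_trichotomy i i' with hlt | heq | hlt
      · have := ha.monotone (Nat.succ_le_of_lt hlt)
        have := h1' j hj
        simp only [Nat.succ_eq_add_one] at *
        omega
      · exact heq
      · have := ha.monotone (Nat.succ_le_of_lt hlt)
        have := h1 j' hj'
        simp only [Nat.succ_eq_add_one] at *
        omega
    have hi : ∀ i ∈ Finset.Ico N (2 * N),
        ∑ j ∈ J, ‖blockRes w f p j (v i)‖ ≤ (if i ∈ S then M else 0) + 1 / N := by
      intro i hi
      by_cases h1 : ∃ j ∈ J, p j ≤ p (a i)
      · refine (hyJ (a i) J hJ h1).trans (le_add_of_nonneg_left ?_)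
        split_ifs <;> simp [hM0]
      · push Not at h1
        have h1' : ∀ j ∈ J, a i < j := fun j hj => hu.1.lt_iff_lt.1 (h1 j hj)
        by_cases h2 : ∃ j ∈ J, j < a (i + 1)
        · rw [if_pos (Finset.mem_filter.2 ⟨hi, h1', h2⟩)]
          have h3 := hM (v i) (mem_span_image_of_subset (fun j hj =>
            (le_max_right k k₁).trans ((ha0 i).trans hj.1)) (hv i)) J hJ
          rw [show ‖v i‖ = 1 from hy1 (a i), mul_one] at h3
          exact h3.trans (le_add_of_nonneg_right (by positivity))
        · push Not at h2
          rw [Finset.sum_eq_zero fun j hj => ?_]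
          · split_ifs <;> positivity
          · rw [h.blockRes_of_span_Ico hu (hv i) (Or.inr (h2 j hj)), norm_zero]
    calc ∑ j ∈ J, ‖blockRes w f p j x‖
        ≤ ∑ j ∈ J, ∑ i ∈ Finset.Ico N (2 * N), ‖blockRes w f p j (v i)‖ := by
          refine Finset.sum_le_sum fun j _ => ?_
          rw [hx, map_sum]
          exact norm_sum_le _ _
      _ = ∑ i ∈ Finset.Ico N (2 * N), ∑ j ∈ J, ‖blockRes w f p j (v i)‖ := Finset.sum_comm
      _ ≤ ∑ i ∈ Finset.Ico N (2 * N), ((if i ∈ S then M else 0) + 1 / N) := Finset.sum_le_sum hi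
      _ ≤ M + 1 := by
          rw [Finset.sum_add_distrib, Finset.sum_const, hcard, nsmul_eq_mul,
            mul_one_div_cancel hN0.ne', Finset.sum_ite_mem, Finset.sum_const, nsmul_eq_mul]
          refine add_le_add_left ?_ _
          refine mul_le_of_le_one_left hM0 ?_
          exact_mod_cast (Finset.card_le_card Finset.inter_subset_right).trans hS
  refine ⟨‖x‖⁻¹ • x, ?_, ?_, fun J hJ => ?_⟩
  · refine Submodule.smul_mem _ _ (Submodule.sum_mem _ fun i _ => ?_)
    exact mem_span_image_of_subset (fun j hj =>
      (le_max_left k k₁).trans ((ha0 i).trans hj.1)) (hv i)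
  · rw [norm_smul, norm_inv, norm_norm, inv_mul_cancel₀ hx0.ne']
  · simp only [map_smul, norm_smul, norm_inv, norm_norm]
    rw [← Finset.mul_sum, inv_mul_le_iff₀ hx0]
    refine (hmass J hJ).trans ?_
    rw [div_lt_iff₀ (by positivity)] at hN
    have := mul_le_mul_of_nonneg_right hxn hε.le
    linarith

/-- A singleton that begins before `R` misses any block beyond `R`, so the averaging step applies
with zero early mass. -/
theorem hasFlat_singletons {c : ℝ} (hc : 0 < c) (hl : LowerEst w schOne 0 c) :
    HasFlat w f p u singletons := by
  have hK := h.one_le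
  have hM := h.admSums_le isReg_singletons one_pos (lowerEst_singletons (v := w) (k := 0))
  refine h.hasFlat_of_step hu (k₁ := 0) (M := 4 * K ^ 2 / 1 + 2 * K) hc hl (fun y hy J hJ => ?_)
    (by positivity) fun R ε hε k => ?_
  · obtain ⟨b, -, hy⟩ := exists_mem_span_Ico hy
    exact sum_blockRes_le hu hM (span_le_tailClosure w (fun _ _ => Nat.zero_le _)
      (hu.span_le (Nat.zero_le _) hy)) hJ
  · have hne : u (max k (R + 1)) ≠ 0 := (hu.2 _ (Nat.zero_le _)).1
    have hmem : ‖u (max k (R + 1))‖⁻¹ • u (max k (R + 1)) ∈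
        Submodule.span ℝ (u '' Set.Ico (max k (R + 1)) (max k (R + 1) + 1)) :=
      Submodule.smul_mem _ _ (Submodule.subset_span ⟨_, ⟨le_rfl, Nat.lt_succ_self _⟩, rfl⟩)
    refine ⟨_, mem_span_image_of_subset (fun j hj => (le_max_left k (R + 1)).trans hj.1) hmem,
      ?_, ?_⟩
    · rw [norm_smul, norm_inv, norm_norm, inv_mul_cancel₀ (norm_ne_zero_iff.2 hne)]
    · rintro J hJ ⟨j, hj, hjR⟩
      rw [Finset.sum_eq_zero fun j' hj' => ?_]
      · exact hε.le
      · have : p j' = p j := Finset.card_le_one.1 hJ _ (Finset.mem_image_of_mem _ hj') _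
          (Finset.mem_image_of_mem _ hj)
        have h1 : j' ≤ p j' := hu.1.le_apply
        rw [h.blockRes_of_span_Ico hu hmem, norm_zero]
        left
        have := le_max_right k (R + 1)
        omega

/-- By induction on `γ`, only sets beginning by `R` have to be controlled. At a successor such a set
splits into at most `R + 1` members of the previous product, each of mass at most `ε / (R + 1)`. At
a limit it comes from one of the finitely many ladder families with index at most `R`, and far out
these are all contained in the `R`-th. The ordinal `γ₀` supplies one bound `M` for the masses at
every stage. -/
theorem hasFlat_prod_sch {s : Ordinal.{0} → ℕ → Ordinal.{0}} (hs : IsLadder s) {c₁ : ℝ}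
    (hc₁ : 0 < c₁) (hl₁ : LowerEst w schOne 0 c₁) {𝓖 : Set (Finset ℕ)} (h𝓖 : IsReg 𝓖)
    (hflat : HasFlat w f p u 𝓖) {γ₀ : Ordinal.{0}} (hγ₀ : γ₀ < Ordinal.omega 1) {k₀ : ℕ} {c : ℝ}
    (hc : 0 < c) (hl : LowerEst w (familyProd (sch s γ₀) 𝓖) k₀ c) {γ : Ordinal.{0}} (hγ : γ ≤ γ₀) :
    HasFlat w f p u (familyProd (sch s γ) 𝓖) := by
  have hK := h.one_le
  have hr : ∀ {γ}, γ ≤ γ₀ → IsReg (sch s γ) := fun hγ => isReg_sch hs (hγ.trans_lt hγ₀)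
  have hMall := h.admSums_le ((hr le_rfl).prod h𝓖) hc hl
  have hMγ : ∀ γ ≤ γ₀, ∃ k₁, ∀ y ∈ Submodule.span ℝ (u '' Set.Ici k₁), ∀ J : Finset ℕ,
      J.image p ∈ familyProd (sch s γ) 𝓖 →
        ∑ j ∈ J, ‖blockRes w f p j y‖ ≤ (4 * K ^ 2 / c + 2 * K) * ‖y‖ := by
    intro γ hγ
    obtain ⟨k, hk⟩ := exists_tail_sch_subset hs hγ hγ₀
    refine ⟨max k k₀, fun y hy J hJ => ?_⟩
    rw [h.sum_blockRes_filter hu hy]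
    obtain ⟨b, -, hy⟩ := exists_mem_span_Ico hy
    refine sum_blockRes_le hu hMall (span_le_tailClosure w (fun i hi => ?_)
      (hu.span_le (Nat.zero_le _) hy)) (familyProd_of_tail
        (((hr hγ).prod h𝓖).mono hJ (Finset.image_subset_image (Finset.filter_subset _ _))) hk ?_)
    · exact (le_max_right k k₀).trans (hu.1.le_apply.trans hi.1)
    · intro i hi
      obtain ⟨j, hj, rfl⟩ := Finset.mem_image.1 hi
      exact (le_max_left k k₀).trans ((Finset.mem_filter.1 hj).2.trans hu.1.le_apply)
  induction γ using Ordinal.limitRecOn with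
  | zero => rwa [sch_zero, familyProd_singletons_left h𝓖]
  | add_one γ ih =>
    have hγ' : γ ≤ γ₀ := (lt_add_one γ).le.trans hγ
    obtain ⟨k₁, hk₁⟩ := hMγ _ hγ
    refine h.hasFlat_of_step hu hc₁ hl₁ hk₁ (by positivity) fun R ε hε k => ?_
    obtain ⟨y, hy, hy1, hyJ⟩ := ih hγ' (ε / (R + 1)) (by positivity) k
    refine ⟨y, hy, hy1, ?_⟩
    rintro J hJ ⟨j₀, hj₀, hj₀R⟩
    have hr' := (hr hγ').prod h𝓖
    rw [sch_succ, ← familyProd_assoc isReg_schOne (hr hγ') h𝓖] at hJ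
    obtain ⟨g, -, hle, him, hfib⟩ := exists_label hr' hJ
    have hmaps : ∀ j ∈ J, g (p j) ∈ (J.image p).image g := fun j hj =>
      Finset.mem_image_of_mem _ (Finset.mem_image_of_mem _ hj)
    have hcard : ((J.image p).image g).card ≤ R + 1 :=
      (him _ (hmaps j₀ hj₀)).trans
        (Nat.succ_le_succ ((hle _ (Finset.mem_image_of_mem _ hj₀)).1.trans hj₀R))
    rw [← Finset.sum_fiberwise_of_maps_to hmaps]
    calc ∑ t ∈ (J.image p).image g, ∑ j ∈ J with g (p j) = t, ‖blockRes w f p j y‖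
        ≤ ∑ t ∈ (J.image p).image g, ε / (R + 1) := by
          refine Finset.sum_le_sum fun t _ => hyJ _ (hr'.mono (hfib t) ?_)
          intro i hi
          obtain ⟨j, hj, rfl⟩ := Finset.mem_image.1 hi
          rw [Finset.mem_filter] at hj ⊢
          exact ⟨Finset.mem_image_of_mem _ hj.1, hj.2⟩
      _ ≤ ε := by
          rw [Finset.sum_const, nsmul_eq_mul]
          have : (((J.image p).image g).card : ℝ) ≤ R + 1 := by exact_mod_cast hcard
          calc _ ≤ ((R : ℝ) + 1) * (ε / (R + 1)) := by gcongr
            _ = ε := by field_simp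
  | limit l hlim ih =>
    obtain ⟨k₁, hk₁⟩ := hMγ _ hγ
    have hl1 := hγ.trans_lt hγ₀
    have hsl := hs l hlim hl1
    refine h.hasFlat_of_step hu hc₁ hl₁ hk₁ (by positivity) fun R ε hε k => ?_
    have htail : ∀ n, ∃ q, n ≤ R → ∀ A ∈ sch s (s l n), (∀ i ∈ A, q ≤ i) → A ∈ sch s (s l R) := by
      intro n
      by_cases hn : n ≤ R
      · obtain ⟨q, hq⟩ := exists_tail_sch_subset hs (hsl.1.monotone hn) ((hsl.2.1 R).trans hl1)
        exact ⟨q, fun _ => hq⟩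
      · exact ⟨0, fun hn' => absurd hn' hn⟩
    choose q hq using htail
    obtain ⟨y, hy, hy1, hyJ⟩ := ih _ (hsl.2.1 R) ((hsl.2.1 R).le.trans hγ) ε hε
      (max k ((Finset.range (R + 1)).sup q))
    refine ⟨y, mem_span_image_of_subset (fun i hi =>
      (le_max_left k ((Finset.range (R + 1)).sup q)).trans hi) hy, hy1, ?_⟩
    rintro J hJ ⟨j₀, hj₀, hj₀R⟩
    obtain ⟨g, hmono, hle, him, hfib⟩ := exists_label h𝓖 hJ
    obtain ⟨n, hn, hnE⟩ := (sch_limit hs hlim hl1).1 him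
    have hp₀ : p j₀ ∈ J.image p := Finset.mem_image_of_mem _ hj₀
    have hnR : n ≤ R := (hnE _ (Finset.mem_image_of_mem g hp₀)).trans ((hle _ hp₀).1.trans hj₀R)
    have hrn := hr ((hsl.2.1 n).le.trans hγ)
    have hJ' : J.image p ∈ familyProd (sch s (s l n)) 𝓖 :=
      mem_familyProd_of_label hrn g hmono (fun x hx => (hle x hx).1) hn hfib
    rw [h.sum_blockRes_filter hu hy]
    refine hyJ _ (familyProd_of_tail ((hrn.prod h𝓖).mono hJ'
      (Finset.image_subset_image (Finset.filter_subset _ _))) (hq n hnR) fun i hi => ?_)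
    obtain ⟨j, hj, rfl⟩ := Finset.mem_image.1 hi
    have h1 : q n ≤ (Finset.range (R + 1)).sup q :=
      Finset.le_sup (f := q) (Finset.mem_range.2 (Nat.lt_succ_of_le hnR))
    exact h1.trans ((le_max_right k _).trans ((Finset.mem_filter.1 hj).2.trans hu.1.le_apply))

theorem hasFlat_famPow {s : Ordinal.{0} → ℕ → Ordinal.{0}} (hs : IsLadder s) {c₁ : ℝ}
    (hc₁ : 0 < c₁) (hl₁ : LowerEst w schOne 0 c₁) (hw : ∀ j, w j ≠ 0) {γ : Ordinal.{0}}
    (hγ : γ < Ordinal.omega 1) (hpos : 0 < lowerConst w (sch s γ)) (m : ℕ) :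
    HasFlat w f p u (famPow (sch s γ) m) := by
  induction m with
  | zero => exact h.hasFlat_singletons hu hc₁ hl₁
  | succ m ih =>
    have hr := isReg_sch hs hγ
    have hpos' : 0 < lowerConst w (famPow (sch s γ) (m + 1)) :=
      (pow_pos hpos _).trans_le (lowerConst_pow (k := 0) hr (fun j _ => hw j) _)
    obtain ⟨k, hk⟩ := exists_lowerEst (half_lt_self hpos')
    exact h.hasFlat_prod_sch hu hs hc₁ hl₁ (hr.pow m) ih hγ (half_pos hpos') hk le_rfl

end CoordSystem

end Flat

/-! ### Vectors with small admissible pieces -/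

section Small

variable {X : Type*} [NormedAddCommGroup X] [NormedSpace ℝ X]
  {w : ℕ → X} {f : ℕ → X →L[ℝ] ℝ} {K : ℝ} {u : ℕ → X} {p : ℕ → ℕ}

theorem sum_biUnion_univ_le {ι : Type*} [Fintype ι] (J : ι → Finset ℕ) {g : ℕ → ℝ}
    (hg : ∀ j, 0 ≤ g j) : ∑ j ∈ Finset.univ.biUnion J, g j ≤ ∑ i, ∑ j ∈ J i, g j := by
  classical
  calc ∑ j ∈ Finset.univ.biUnion J, g j
      ≤ ∑ j ∈ Finset.univ.biUnion J, ∑ i, if j ∈ J i then g j else 0 := by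
        refine Finset.sum_le_sum fun j hj => ?_
        obtain ⟨i, hi, hji⟩ := Finset.mem_biUnion.1 hj
        have := Finset.single_le_sum (f := fun i => if j ∈ J i then g j else 0)
          (fun i _ => by split_ifs <;> simp [hg]) hi
        simpa [hji] using this
    _ = ∑ i, ∑ j ∈ J i, g j := by
        rw [Finset.sum_comm]
        refine Finset.sum_congr rfl fun i _ => ?_
        rw [Finset.sum_ite_mem, Finset.inter_eq_right.2
          (Finset.subset_biUnion_of_mem J (Finset.mem_univ i))]

theorem res_Ico_eq_sum (hp : StrictMono p) (y : X) {m n : ℕ} (hmn : m ≤ n) :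
    res w f (Finset.Ico (p m) (p n)) y = ∑ j ∈ Finset.Ico m n, blockRes w f p j y := by
  induction n, hmn using Nat.le_induction with
  | base => simp [res_apply]
  | succ n hmn ih =>
    rw [Finset.sum_Ico_succ_top hmn, ← ih, blockRes, res_apply, res_apply, res_apply,
      Finset.sum_Ico_consecutive _ (hp.monotone hmn) (hp.monotone (Nat.le_succ n))]

namespace CoordSystem

variable (h : CoordSystem w f K) (hp : StrictMono p)

include h hp

/-- Replacing an admissible family of intervals by one that is aligned with the partition into the
intervals `[p j, p (j + 1))`. -/
theorem exists_aligned {𝓕 : Set (Finset ℕ)} (h𝓕 : IsReg 𝓕) {k : ℕ} {M : ℝ}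
    (hM0 : 0 ≤ M)
    (hM : ∀ x ∈ tailClosure w k, ∀ s ∈ admSums w f 𝓕 x, s ≤ M * ‖x‖) (hk : ∀ j, k ≤ p j)
    {a b : ℕ} {y : X} (hy : y ∈ Submodule.span ℝ (w '' Set.Ico (p a) (p b)))
    {A : Finset ℕ} (hA : A ∈ 𝓕) {r : ℕ → ℕ} (hr : Adm A r) :
    ∃ (J : Finset ℕ) (ρ : ℕ → ℕ) (J' : Fin 3 → Finset ℕ), Adm J ρ ∧ J.image p ∈ 𝓕 ∧
      (∀ j ∈ J, a ≤ j ∧ j < ρ j ∧ ρ j ≤ b) ∧ (∀ i, (J' i).image p ∈ 𝓕) ∧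
      (∀ i, ∀ j ∈ J' i, a ≤ j ∧ j < b) ∧
      ∑ t ∈ A, ‖res w f (Finset.Ico t (r t)) y‖ ≤
        ∑ j ∈ J, ‖res w f (Finset.Ico (p j) (p (ρ j))) y‖ +
          M * ∑ i, ∑ j ∈ J' i, ‖blockRes w f p j y‖ := by
  classical
  rcases le_or_gt b a with hba | hab
  · have hy0 : y = 0 := by
      have : Set.Ico (p a) (p b) = ∅ := Set.Ico_eq_empty (not_lt.2 (hp.monotone hba))
      rw [this, Set.image_empty, Submodule.span_empty] at hy
      simpa using hy
    refine ⟨∅, id, fun _ => ∅, by simp [Adm], by simpa using h𝓕.empty, by simp,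
      by simpa using h𝓕.empty, by simp, by simp [hy0]⟩
  have hmono := hp.monotone
  have hsucc : ∀ {i j : ℕ}, p i < p j → p (i + 1) ≤ p j := fun hij =>
    hmono (Nat.succ_le_of_lt (hp.lt_iff_lt.1 hij))
  -- `full t` lists the blocks lying entirely inside the interval `[t, r t)`; these are consecutive
  -- and form the aligned interval.
  let full : ℕ → Finset ℕ := fun t => (Finset.Ico a b).filter fun j => t ≤ p j ∧ p (j + 1) ≤ r t
  have hfull : ∀ t j, j ∈ full t ↔ (a ≤ j ∧ j < b) ∧ t ≤ p j ∧ p (j + 1) ≤ r t := by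
    intro t j
    simp [full]
  let m : ℕ → ℕ := fun t => if ht : (full t).Nonempty then (full t).min' ht else 0
  let n : ℕ → ℕ := fun t => (full t).sup (· + 1)
  let A' := A.filter fun t => (full t).Nonempty
  have hA' : ∀ t, t ∈ A' ↔ t ∈ A ∧ (full t).Nonempty := fun t => Finset.mem_filter
  have hm : ∀ t ∈ A', m t ∈ full t ∧ ∀ j ∈ full t, m t ≤ j := by
    intro t ht
    have hne := ((hA' t).1 ht).2
    have : m t = (full t).min' hne := dif_pos hne
    rw [this]
    exact ⟨Finset.min'_mem _ _, fun j hj => Finset.min'_le _ _ hj⟩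
  have hn : ∀ t ∈ A', ∃ j ∈ full t, n t = j + 1 := fun t ht =>
    Finset.exists_mem_eq_sup _ ((hA' t).1 ht).2 _
  have hmn : ∀ t ∈ A', m t < n t := fun t ht =>
    Finset.le_sup (f := (· + 1)) (hm t ht).1
  have hpn : ∀ t ∈ A', p (n t) ≤ r t := by
    intro t ht
    obtain ⟨j, hj, hnj⟩ := hn t ht
    rw [hnj]
    exact ((hfull t j).1 hj).2.2
  have hnm : ∀ t ∈ A', ∀ t' ∈ A', t < t' → n t ≤ m t' := by
    intro t ht t' ht' hlt
    have h1 := hr t ((hA' t).1 ht).1 t' ((hA' t').1 ht').1 hlt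
    have h2 := ((hfull t' _).1 (hm t' ht').1).2.1
    exact hp.le_iff_le.1 ((hpn t ht).trans (h1.trans h2))
  have hmstrict : StrictMonoOn m A' := fun t ht t' ht' hlt =>
    (hmn t ht).trans_le (hnm t ht t' ht' hlt)
  have hinv : ∀ t ∈ A', Function.invFunOn m A' (m t) = t := fun t ht =>
    hmstrict.injOn (Function.invFunOn_mem ⟨t, ht, rfl⟩) ht (Function.invFunOn_eq ⟨t, ht, rfl⟩)
  have hfullIco : ∀ t ∈ A', full t = Finset.Ico (m t) (n t) := by
    intro t ht
    obtain ⟨j₁, hj₁, hnj⟩ := hn t ht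
    ext j
    rw [Finset.mem_Ico]
    constructor
    · exact fun hj => ⟨(hm t ht).2 j hj, Finset.le_sup (f := (· + 1)) hj⟩
    · rintro ⟨h1, h2⟩
      have h3 := (hfull t _).1 (hm t ht).1
      have h4 := (hfull t _).1 hj₁
      have h5 : j ≤ j₁ := by omega
      refine (hfull t j).2 ⟨⟨h3.1.1.trans h1, h5.trans_lt h4.1.2⟩, h3.2.1.trans (hmono h1),
        (hmono (Nat.succ_le_succ h5)).trans h4.2.2⟩
  let inner := (Finset.Ico a b).filter fun j => ∃ t ∈ A, p j < t ∧ t < p (j + 1)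
  have hinner : ∀ j, j ∈ inner ↔ (a ≤ j ∧ j < b) ∧ ∃ t ∈ A, p j < t ∧ t < p (j + 1) := by
    intro j
    simp [inner]
  -- The cut blocks fall into three kinds: those containing a starting point in their interior,
  -- except the first such block; those cut by the right end of an interval that started at or
  -- before their left end; and the exceptional first block. For the first kind, starting points
  -- inside earlier blocks witness interlacing with `A`. The first block has no such witness, but a
  -- singleton is always in `𝓕`.
  let J' : Fin 3 → Finset ℕ := ![inner.filter fun j => ∃ j' ∈ inner, j' < j,
    (Finset.Ico a b).filter fun j => ∃ t ∈ A, t ≤ p j ∧ p j < r t ∧ r t < p (j + 1),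
    inner.filter fun j => ∀ j' ∈ inner, j ≤ j']
  have hpart : ∀ t ∈ A, ∀ j, a ≤ j → j < b → j ∉ full t → t < p (j + 1) → p j < r t →
      ∃ i, j ∈ J' i := by
    intro t ht j haj hjb hjf h1 h2
    by_cases h3 : t ≤ p j
    · have h4 : r t < p (j + 1) := by
        by_contra hcon
        exact hjf ((hfull t j).2 ⟨⟨haj, hjb⟩, h3, not_lt.1 hcon⟩)
      exact ⟨1, by simpa [J'] using ⟨⟨haj, hjb⟩, t, ht, h3, h2, h4⟩⟩
    · have hji : j ∈ inner := (hinner j).2 ⟨⟨haj, hjb⟩, t, ht, not_le.1 h3, h1⟩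
      by_cases h4 : ∃ j' ∈ inner, j' < j
      · exact ⟨0, Finset.mem_filter.2 ⟨hji, h4⟩⟩
      · push Not at h4
        exact ⟨2, Finset.mem_filter.2 ⟨hji, h4⟩⟩
  have hysum : y = ∑ j ∈ Finset.Ico a b, blockRes w f p j y := by
    rw [← res_Ico_eq_sum hp y hab.le]
    exact (h.res_eq_self (fun i hi => by simpa using hi) hy).symm
  have hspan : ∀ j, blockRes w f p j y ∈ Submodule.span ℝ (w '' Set.Ico (p j) (p (j + 1))) :=
    fun j => res_mem_span _ _ fun i hi => by simpa using hi
  have hpiece : ∀ t ∈ A, ‖res w f (Finset.Ico t (r t)) y‖ ≤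
      ‖∑ j ∈ full t, blockRes w f p j y‖ + ∑ j ∈ Finset.univ.biUnion J',
        ‖res w f (Finset.Ico t (r t)) (blockRes w f p j y)‖ := by
    intro t ht
    have h1 : res w f (Finset.Ico t (r t)) y = ∑ j ∈ full t, blockRes w f p j y +
        ∑ j ∈ (Finset.Ico a b).filter (· ∉ full t),
          res w f (Finset.Ico t (r t)) (blockRes w f p j y) := by
      conv_lhs => rw [hysum]
      rw [map_sum, ← Finset.sum_filter_add_sum_filter_not _ (· ∈ full t)]
      congr 1
      have h2 : (Finset.Ico a b).filter (· ∈ full t) = full t := by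
        ext j
        rw [Finset.mem_filter, Finset.mem_Ico]
        exact ⟨fun hj => hj.2, fun hj => ⟨((hfull t j).1 hj).1, hj⟩⟩
      rw [h2]
      refine Finset.sum_congr rfl fun j hj => h.res_eq_self (fun i hi => ?_) (hspan j)
      have h3 := ((hfull t j).1 hj).2
      rw [Finset.mem_Ico]
      exact ⟨h3.1.trans hi.1, hi.2.trans_le h3.2⟩
    rw [h1]
    refine (norm_add_le _ _).trans (add_le_add le_rfl ((norm_sum_le _ _).trans ?_))
    rw [← Finset.sum_filter_ne_zero]
    refine Finset.sum_le_sum_of_subset_of_nonneg (fun j hj => ?_) fun _ _ _ => norm_nonneg _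
    obtain ⟨hj, hne⟩ := Finset.mem_filter.1 hj
    rw [Finset.mem_filter, Finset.mem_Ico] at hj
    have h4 : t < p (j + 1) ∧ p j < r t := by
      by_contra hcon
      refine hne ?_
      rw [h.res_eq_zero (fun i hi hi' => ?_) (hspan j), norm_zero]
      rw [Finset.mem_Ico] at hi'
      exact hcon ⟨hi'.1.trans_lt hi.2, hi.1.trans_lt hi'.2⟩
    obtain ⟨i, hi⟩ := hpart t ht j hj.1.1 hj.1.2 hj.2 h4.1 h4.2
    exact Finset.mem_biUnion.2 ⟨i, Finset.mem_univ _, hi⟩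
  refine ⟨A'.image m, fun j => n (Function.invFunOn m A' j), J', ?_, ?_, ?_, ?_, ?_, ?_⟩
  · intro j hj j' hj' hlt
    obtain ⟨t, ht, rfl⟩ := Finset.mem_image.1 hj
    obtain ⟨t', ht', rfl⟩ := Finset.mem_image.1 hj'
    simp only [hinv t ht]
    exact hnm t ht t' ht' ((hmstrict.lt_iff_lt ht ht').1 hlt)
  · refine h𝓕.of_interlaced hA ?_ ?_
    · intro x hx
      simp only [Finset.mem_image] at hx
      obtain ⟨_, ⟨t, ht, rfl⟩, rfl⟩ := hx
      exact ⟨t, ((hA' t).1 ht).1, ((hfull t _).1 (hm t ht).1).2.1⟩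
    · intro x hx x' hx' hlt
      simp only [Finset.mem_image] at hx hx'
      obtain ⟨_, ⟨t, ht, rfl⟩, rfl⟩ := hx
      obtain ⟨_, ⟨t', ht', rfl⟩, rfl⟩ := hx'
      have htt' : t < t' := (hmstrict.lt_iff_lt ht ht').1 (hp.lt_iff_lt.1 hlt)
      refine ⟨t', ((hA' t').1 ht').1, ?_, ((hfull t' _).1 (hm t' ht').1).2.1⟩
      exact (hp (hmn t ht)).trans_le ((hpn t ht).trans
        (hr t ((hA' t).1 ht).1 t' ((hA' t').1 ht').1 htt'))
  · intro j hj
    obtain ⟨t, ht, rfl⟩ := Finset.mem_image.1 hj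
    simp only [hinv t ht]
    refine ⟨((hfull t _).1 (hm t ht).1).1.1, hmn t ht, ?_⟩
    obtain ⟨j, hj, hnj⟩ := hn t ht
    rw [hnj]
    exact ((hfull t j).1 hj).1.2
  · intro i
    fin_cases i
    · refine h𝓕.of_interlaced hA ?_ ?_
      · intro x hx
        obtain ⟨j, hj, rfl⟩ := Finset.mem_image.1 hx
        obtain ⟨-, j', hj', hlt⟩ := Finset.mem_filter.1 hj
        obtain ⟨-, t, ht, h1, h2⟩ := (hinner j').1 hj'
        exact ⟨t, ht, h2.le.trans (hmono hlt)⟩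
      · intro x hx x' hx' hlt
        obtain ⟨j, hj, rfl⟩ := Finset.mem_image.1 hx
        obtain ⟨j', hj', rfl⟩ := Finset.mem_image.1 hx'
        obtain ⟨-, t, ht, h1, h2⟩ := (hinner j).1 (Finset.mem_filter.1 hj).1
        exact ⟨t, ht, h1, h2.le.trans (hsucc hlt)⟩
    · refine h𝓕.of_interlaced hA ?_ ?_
      · intro x hx
        obtain ⟨j, hj, rfl⟩ := Finset.mem_image.1 hx
        obtain ⟨-, t, ht, h1, h2, h3⟩ := Finset.mem_filter.1 hj
        exact ⟨t, ht, h1⟩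
      · intro x hx x' hx' hlt
        obtain ⟨j, hj, rfl⟩ := Finset.mem_image.1 hx
        obtain ⟨j', hj', rfl⟩ := Finset.mem_image.1 hx'
        obtain ⟨-, t, ht, h1, h2, h3⟩ := Finset.mem_filter.1 hj
        obtain ⟨-, t', ht', h1', h2', h3'⟩ := Finset.mem_filter.1 hj'
        have h4 := hsucc hlt
        refine ⟨t', ht', ?_, h1'⟩
        rcases lt_trichotomy t t' with htt | htt | htt
        · exact h2.trans_le (hr t ht t' ht' htt)
        · subst htt
          omega
        · have := hr t' ht' t ht htt
          omega
    · refine h𝓕.mem_of_card_le_one (Finset.card_image_le.trans (Finset.card_le_one.2 ?_))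
      intro j hj j' hj'
      have h1 := Finset.mem_filter.1 hj
      have h2 := Finset.mem_filter.1 hj'
      exact le_antisymm (h1.2 j' h2.1) (h2.2 j h1.1)
  · intro i j hj
    fin_cases i
    · exact ((hinner j).1 (Finset.mem_filter.1 hj).1).1
    · exact Finset.mem_Ico.1 (Finset.mem_filter.1 hj).1
    · exact ((hinner j).1 (Finset.mem_filter.1 hj).1).1
  · refine (Finset.sum_le_sum hpiece).trans ?_
    rw [Finset.sum_add_distrib]
    refine add_le_add (le_of_eq ?_) ?_
    · rw [Finset.sum_image hmstrict.injOn, Finset.sum_filter]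
      refine Finset.sum_congr rfl fun t ht => ?_
      split_ifs with hne
      · have ht' := (hA' t).2 ⟨ht, hne⟩
        simp only [hinv t ht']
        rw [res_Ico_eq_sum hp y (hmn t ht').le, ← hfullIco t ht']
      · rw [Finset.not_nonempty_iff_eq_empty.1 hne, Finset.sum_empty, norm_zero]
    · rw [Finset.sum_comm, Finset.mul_sum]
      calc ∑ j ∈ Finset.univ.biUnion J',
            ∑ t ∈ A, ‖res w f (Finset.Ico t (r t)) (blockRes w f p j y)‖
          ≤ ∑ j ∈ Finset.univ.biUnion J', M * ‖blockRes w f p j y‖ :=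
            Finset.sum_le_sum fun j _ => hM _ (span_le_tailClosure w
              (fun i hi => (hk j).trans hi.1) (hspan j)) _ ⟨A, hA, r, hr, rfl⟩
        _ ≤ ∑ i, ∑ j ∈ J' i, M * ‖blockRes w f p j y‖ :=
            sum_biUnion_univ_le J' fun _ => by positivity
        _ = ∑ i, M * ∑ j ∈ J' i, ‖blockRes w f p j y‖ := by simp only [Finset.mul_sum]

omit h in
-- The label of a point is the image under `p` of the largest element of `J` not exceeding its
-- index; admissibility makes this the start of the interval containing it.
theorem image_biUnion_mem_familyProd {𝓕 𝓖 : Set (Finset ℕ)} (h𝓕 : IsReg 𝓕) (h𝓖 : IsReg 𝓖)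
    {J : Finset ℕ} {ρ : ℕ → ℕ} (hJ : Adm J ρ) (hJ𝓕 : J.image p ∈ 𝓕) {G : ℕ → Finset ℕ}
    (hG : ∀ j ∈ J, (G j).image p ∈ 𝓖) (hGJ : ∀ j ∈ J, ∀ i ∈ G j, j ≤ i ∧ i < ρ j) :
    (J.biUnion G).image p ∈ familyProd 𝓕 𝓖 := by
  have hinv : ∀ i, Function.invFun p (p i) = i := Function.leftInverse_invFun hp.injective
  let g : ℕ → ℕ := fun i => (J.filter (· ≤ i)).sup id
  have hg : ∀ j ∈ J, ∀ i ∈ G j, g i = j := by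
    intro j hj i hi
    refine le_antisymm (Finset.sup_le fun j' hj' => ?_) ?_
    · rw [Finset.mem_filter] at hj'
      by_contra hcon
      have := hJ j hj j' hj'.1 (not_le.1 hcon)
      have := (hGJ j hj i hi).2
      omega
    · exact Finset.le_sup (f := id) (Finset.mem_filter.2 ⟨hj, (hGJ j hj i hi).1⟩)
  refine mem_familyProd_of_label h𝓕 (fun x => p (g (Function.invFun p x))) ?_ ?_ ?_ ?_
  · intro x hx x' hx' hle
    simp only [Finset.coe_image, Set.mem_image, Finset.coe_biUnion, Set.mem_iUnion,
      Finset.mem_coe] at hx hx'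
    obtain ⟨i, ⟨j, hj, hi⟩, rfl⟩ := hx
    obtain ⟨i', ⟨j', hj', hi'⟩, rfl⟩ := hx'
    simp only [hinv]
    refine hp.monotone (Finset.sup_mono fun t ht => ?_)
    rw [Finset.mem_filter] at ht ⊢
    exact ⟨ht.1, ht.2.trans (hp.le_iff_le.1 hle)⟩
  · intro x hx
    obtain ⟨i, hi, rfl⟩ := Finset.mem_image.1 hx
    obtain ⟨j, hj, hi⟩ := Finset.mem_biUnion.1 hi
    rw [hinv, hg j hj i hi]
    exact hp.monotone (hGJ j hj i hi).1
  · refine h𝓕.mono hJ𝓕 fun x hx => ?_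
    simp only [Finset.mem_image, Finset.mem_biUnion] at hx
    obtain ⟨_, ⟨i, ⟨j, hj, hi⟩, rfl⟩, rfl⟩ := hx
    rw [hinv, hg j hj i hi]
    exact Finset.mem_image_of_mem p hj
  · intro x
    by_cases hx : ∃ j ∈ J, p j = x
    · obtain ⟨j, hj, rfl⟩ := hx
      refine h𝓖.mono (hG j hj) fun x hx => ?_
      simp only [Finset.mem_filter, Finset.mem_image, Finset.mem_biUnion] at hx
      obtain ⟨⟨i, ⟨j', hj', hi⟩, rfl⟩, hx⟩ := hx
      rw [hinv, hg j' hj' i hi] at hx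
      rw [← hp.injective hx]
      exact Finset.mem_image_of_mem p hi
    · convert h𝓖.empty
      rw [Finset.filter_eq_empty_iff]
      intro x' hx' heq
      obtain ⟨i, hi, rfl⟩ := Finset.mem_image.1 hx'
      obtain ⟨j, hj, hi⟩ := Finset.mem_biUnion.1 hi
      rw [hinv, hg j hj i hi] at heq
      exact hx ⟨j, hj, heq⟩

end CoordSystem

end Small

/-! ### Iterated splitting and vectors with small admissible sums -/

section SmallVectors

variable {X : Type*} [NormedAddCommGroup X] [NormedSpace ℝ X]
  {w : ℕ → X} {f : ℕ → X →L[ℝ] ℝ} {K : ℝ} {u : ℕ → X} {p : ℕ → ℕ}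

theorem sum_Ico_mem_admSums {𝓗 : Set (Finset ℕ)} (hp : StrictMono p) {J : Finset ℕ} {ρ : ℕ → ℕ}
    (hJ : Adm J ρ) (hJ𝓗 : J.image p ∈ 𝓗) (y : X) :
    ∑ j ∈ J, ‖res w f (Finset.Ico (p j) (p (ρ j))) y‖ ∈ admSums w f 𝓗 y := by
  have hinv : ∀ i, Function.invFun p (p i) = i := Function.leftInverse_invFun hp.injective
  refine ⟨J.image p, hJ𝓗, fun i => p (ρ (Function.invFun p i)), ?_, ?_⟩
  · intro t ht t' ht' hlt
    obtain ⟨i, hi, rfl⟩ := Finset.mem_image.1 ht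
    obtain ⟨i', hi', rfl⟩ := Finset.mem_image.1 ht'
    simp only [hinv]
    exact hp.monotone (hJ i hi i' hi' (hp.lt_iff_lt.1 hlt))
  · rw [Finset.sum_image hp.injective.injOn]
    simp only [hinv]

namespace CoordSystem

variable (h : CoordSystem w f K) (hu : IsBlkMap 0 p u w)

include h hu

theorem res_mem_span_block (a b : ℕ) {y : X} (hy : y ∈ Submodule.span ℝ (Set.range u)) :
    res w f (Finset.Ico (p a) (p b)) y ∈ Submodule.span ℝ (u '' Set.Ico a b) := by
  induction hy using Submodule.span_induction with
  | mem x hx =>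
    obtain ⟨j, rfl⟩ := hx
    have hj := (hu.2 j (Nat.zero_le _)).2
    by_cases hab : a ≤ j ∧ j < b
    · rw [h.res_eq_self (fun i hi => ?_) hj]
      · exact Submodule.subset_span ⟨j, hab, rfl⟩
      · exact Finset.mem_Ico.2 ⟨(hu.1.monotone hab.1).trans hi.1,
          hi.2.trans_le (hu.1.monotone hab.2)⟩
    · rw [h.res_eq_zero (fun i hi hi' => ?_) hj]
      · exact Submodule.zero_mem _
      · rw [Finset.mem_Ico] at hi'
        refine hab ⟨?_, hu.1.lt_iff_lt.1 (hi.1.trans_lt hi'.2)⟩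
        exact Nat.lt_succ_iff.1 (hu.1.lt_iff_lt.1 (hi'.1.trans_lt hi.2))
  | zero => rw [map_zero]; exact Submodule.zero_mem _
  | add x y _ _ hx hy => rw [map_add]; exact Submodule.add_mem _ hx hy
  | smul c x _ hx => rw [map_smul]; exact Submodule.smul_mem _ _ hx

omit hu in
theorem res_Ico_res_Ico {a b c d : ℕ} (hac : a ≤ c) (hdb : d ≤ b) (y : X) :
    res w f (Finset.Ico c d) (res w f (Finset.Ico a b) y) = res w f (Finset.Ico c d) y := by
  rw [h.res_res, Finset.inter_eq_left.2 (Finset.Ico_subset_Ico hac hdb)]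

/-- Each round applies `hlarge` to all current pieces, which gains a factor `κ`, and realigns the
new cuts with the blocks so that the pieces stay in the span of `u` and `hlarge` applies again.
Realigning loses the three families of cut blocks. After `l` rounds these lie in a power of `𝓕` of
exponent at most `m`, so flatness bounds each loss by `3 * M * ε` before scaling. -/
theorem exists_iterate {𝓕 : Set (Finset ℕ)} (h𝓕 : IsReg 𝓕) {k : ℕ} {M : ℝ} (hM0 : 0 ≤ M)
    (hM : ∀ x ∈ tailClosure w k, ∀ s ∈ admSums w f 𝓕 x, s ≤ M * ‖x‖) (hk : ∀ j, k ≤ p j)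
    {κ : ℝ} (hκ : 1 ≤ κ)
    (hlarge : ∀ y ∈ Submodule.span ℝ (Set.range u), ∃ s ∈ admSums w f 𝓕 y, κ * ‖y‖ ≤ s)
    {y : X} (hy : y ∈ Submodule.span ℝ (Set.range u)) {ε : ℝ} (hε : 0 ≤ ε) {m : ℕ}
    (hflat : ∀ J : Finset ℕ, J.image p ∈ famPow 𝓕 m → ∑ j ∈ J, ‖blockRes w f p j y‖ ≤ ε)
    {l : ℕ} (hl : l ≤ m) :
    ∃ (J : Finset ℕ) (ρ : ℕ → ℕ), Adm J ρ ∧ J.image p ∈ famPow 𝓕 l ∧ (∀ j ∈ J, j < ρ j) ∧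
      κ ^ l * ‖y‖ ≤ ∑ j ∈ J, ‖res w f (Finset.Ico (p j) (p (ρ j))) y‖ +
        l * (3 * M * ε) * κ ^ l := by
  classical
  have hp := hu.1
  induction l with
  | zero =>
    obtain ⟨b, hb, hyb⟩ := exists_mem_span_Ico (a := 0) (u := u) (y := y) (by
      refine Submodule.span_mono ?_ hy
      rintro _ ⟨j, rfl⟩
      exact ⟨j, Nat.zero_le _, rfl⟩)
    refine ⟨{0}, fun _ => b, ?_, ?_, ?_, ?_⟩
    · intro t ht t' ht' hlt
      rw [Finset.mem_singleton] at ht ht'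
      omega
    · exact isReg_singletons.mem_of_card_le_one (by simp)
    · intro j hj
      rwa [Finset.mem_singleton.1 hj]
    · rw [Finset.sum_singleton, h.res_eq_self (fun i hi => by simpa using hi)
        (hu.span_le (Nat.zero_le _) hyb)]
      simp
  | succ l ih =>
    obtain ⟨J, ρ, hJ, hJl, hJρ, hsum⟩ := ih (Nat.le_of_succ_le hl)
    let Y : ℕ → X := fun j => res w f (Finset.Ico (p j) (p (ρ j))) y
    have hYw : ∀ j, Y j ∈ Submodule.span ℝ (w '' Set.Ico (p j) (p (ρ j))) := fun j =>
      res_mem_span _ _ fun i hi => by simpa using hi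
    have hY : ∀ j, ∃ (I : Finset ℕ) (σ : ℕ → ℕ) (I' : Fin 3 → Finset ℕ), Adm I σ ∧ I.image p ∈ 𝓕 ∧
        (∀ i ∈ I, j ≤ i ∧ i < σ i ∧ σ i ≤ ρ j) ∧ (∀ q, (I' q).image p ∈ 𝓕) ∧
        (∀ q, ∀ i ∈ I' q, j ≤ i ∧ i < ρ j) ∧
        κ * ‖Y j‖ ≤ ∑ i ∈ I, ‖res w f (Finset.Ico (p i) (p (σ i))) y‖ +
          M * ∑ q, ∑ i ∈ I' q, ‖blockRes w f p i y‖ := by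
      intro j
      have hYu : Y j ∈ Submodule.span ℝ (Set.range u) :=
        Submodule.span_mono (Set.image_subset_range _ _) (h.res_mem_span_block hu j (ρ j) hy)
      obtain ⟨_, ⟨A, hA, r, hr, rfl⟩, hs⟩ := hlarge _ hYu
      obtain ⟨I, σ, I', h1, h2, h3, h4, h5, h6⟩ :=
        h.exists_aligned hp h𝓕 hM0 hM hk (hYw j) hA hr
      refine ⟨I, σ, I', h1, h2, h3, h4, h5, hs.trans (h6.trans (le_of_eq ?_))⟩
      congr 1
      · refine Finset.sum_congr rfl fun i hi => ?_
        rw [h.res_Ico_res_Ico (hp.monotone (h3 i hi).1) (hp.monotone (h3 i hi).2.2)]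
      · congr 1
        refine Finset.sum_congr rfl fun q _ => Finset.sum_congr rfl fun i hi => ?_
        rw [blockRes, h.res_Ico_res_Ico (hp.monotone (h5 q i hi).1) (hp.monotone (h5 q i hi).2)]
    choose I σ I' hI hI𝓕 hIρ hI'𝓕 hI'ρ hYsum using hY
    have hdisj : ∀ G : ℕ → Finset ℕ, (∀ j, ∀ i ∈ G j, j ≤ i ∧ i < ρ j) →
        (J : Set ℕ).PairwiseDisjoint G := by
      intro G hG j hj j' hj' hne
      rw [Function.onFun, Finset.disjoint_left]
      intro i hi hi'
      have h1 := hG _ _ hi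
      have h2 := hG _ _ hi'
      rcases lt_or_gt_of_ne hne with hlt | hlt
      · have := hJ j hj j' hj' hlt
        omega
      · have := hJ j' hj' j hj hlt
        omega
    have hmem : ∀ G : ℕ → Finset ℕ, (∀ j, (G j).image p ∈ 𝓕) →
        (∀ j, ∀ i ∈ G j, j ≤ i ∧ i < ρ j) → (J.biUnion G).image p ∈ famPow 𝓕 (l + 1) := by
      intro G hG hGJ
      rw [famPow_add h𝓕, famPow_one h𝓕]
      exact image_biUnion_mem_familyProd hp (h𝓕.pow l) h𝓕 hJ hJl (fun j _ => hG j)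
        fun j _ => hGJ j
    have hIb : ∀ j, ∀ i ∈ I j, j ≤ i ∧ i < ρ j := fun j i hi =>
      ⟨(hIρ j i hi).1, (hIρ j i hi).2.1.trans_le (hIρ j i hi).2.2⟩
    let g : ℕ → ℕ := fun i => if hi : ∃ j ∈ J, i ∈ I j then hi.choose else 0
    have hg : ∀ j ∈ J, ∀ i ∈ I j, g i = j := by
      intro j hj i hi
      have hex : ∃ j ∈ J, i ∈ I j := ⟨j, hj, hi⟩
      have hgi : g i = hex.choose := dif_pos hex
      by_contra hne
      rw [hgi] at hne
      exact Finset.disjoint_left.1 (hdisj I hIb hex.choose_spec.1 hj hne) hex.choose_spec.2 hi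
    refine ⟨J.biUnion I, fun i => σ (g i) i, ?_, hmem I hI𝓕 hIb, ?_, ?_⟩
    · intro i hi i' hi' hlt
      obtain ⟨j, hj, hi⟩ := Finset.mem_biUnion.1 hi
      obtain ⟨j', hj', hi'⟩ := Finset.mem_biUnion.1 hi'
      simp only [hg j hj i hi]
      rcases lt_trichotomy j j' with hjj | hjj | hjj
      · exact (hIρ j i hi).2.2.trans ((hJ j hj j' hj' hjj).trans (hIρ j' i' hi').1)
      · subst hjj
        exact hI j i hi i' hi' hlt
      · have h1 := hJ j' hj' j hj hjj
        have h2 := hIρ j i hi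
        have h3 := hIρ j' i' hi'
        omega
    · intro i hi
      obtain ⟨j, hj, hi⟩ := Finset.mem_biUnion.1 hi
      simp only [hg j hj i hi]
      exact (hIρ j i hi).2.1
    · rw [Finset.sum_biUnion (hdisj I hIb)]
      have hmass : ∀ q, ∑ j ∈ J, ∑ i ∈ I' j q, ‖blockRes w f p i y‖ ≤ ε := by
        intro q
        rw [← Finset.sum_biUnion (hdisj (fun j => I' j q) fun j => hI'ρ j q)]
        exact hflat _ (famPow_subset h𝓕 hl (hmem _ (fun j => hI'𝓕 j q) fun j => hI'ρ j q))
      have hκl : 1 ≤ κ ^ (l + 1) := one_le_pow₀ hκ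
      have h1 : κ * ∑ j ∈ J, ‖Y j‖ ≤
          ∑ j ∈ J, ∑ i ∈ I j, ‖res w f (Finset.Ico (p i) (p (σ (g i) i))) y‖ + 3 * M * ε := by
        rw [Finset.mul_sum]
        refine (Finset.sum_le_sum fun j _ => hYsum j).trans ?_
        rw [Finset.sum_add_distrib, ← Finset.mul_sum, Finset.sum_comm]
        refine add_le_add (le_of_eq ?_) ?_
        · refine Finset.sum_congr rfl fun j hj => Finset.sum_congr rfl fun i hi => ?_
          rw [hg j hj i hi]
        · have h2 := Finset.sum_le_sum fun q (_ : q ∈ (Finset.univ : Finset (Fin 3))) => hmass q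
          rw [Finset.sum_const, Finset.card_univ, Fintype.card_fin, nsmul_eq_mul] at h2
          have := mul_le_mul_of_nonneg_left h2 hM0
          push_cast at this
          linarith
      have h2 := mul_le_mul_of_nonneg_left hsum (zero_le_one.trans hκ)
      have h3 : 3 * M * ε ≤ 3 * M * ε * κ ^ (l + 1) :=
        le_mul_of_one_le_right (by positivity) hκl
      push_cast
      rw [pow_succ'] at h3 ⊢
      simp only [Y] at h1
      nlinarith [h1, h2, h3]

omit hu in
/-- If the lower constants of the powers of `𝓢_γ` do not decay faster than `κ⁻ᵐ`, then every block
subspace contains a vector whose admissible sums are at most `κ` times its norm. -/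
theorem exists_small {s : Ordinal.{0} → ℕ → Ordinal.{0}} (hs : IsLadder s) {c₁ : ℝ}
    (hc₁ : 0 < c₁) (hl₁ : LowerEst w schOne 0 c₁) (hw : ∀ j, w j ≠ 0) {γ : Ordinal.{0}}
    (hγ : γ < Ordinal.omega 1) (hpos : 0 < lowerConst w (sch s γ)) {κ : ℝ} (hκ : 1 ≤ κ)
    (hunb : ∀ B : ℝ, ∃ m, B ≤ κ ^ m * lowerConst w (famPow (sch s γ) m))
    (hu : IsBlk 0 u w) : ∃ y ∈ Submodule.span ℝ (Set.range u), y ≠ 0 ∧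
      ∀ t ∈ admSums w f (sch s γ) y, t ≤ κ * ‖y‖ := by
  obtain ⟨p, hu⟩ := hu
  have hr := isReg_sch hs hγ
  have hK := h.one_le
  by_contra hcon
  push Not at hcon
  -- The iteration will give (3/4)κ^m Γ ≤ 10K², which this choice of `m` contradicts.
  obtain ⟨m, hm⟩ := hunb (20 * K ^ 2)
  set Γ := lowerConst w (famPow (sch s γ) m) with hΓ
  have hΓ0 : 0 < Γ := (pow_pos hpos _).trans_le (lowerConst_pow (k := 0) hr (fun j _ => hw j) _)
  have hΓ1 : Γ ≤ 1 := lowerConst_le_one (k := 0) (hr.pow m) fun j _ => hw j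
  obtain ⟨k, hk⟩ := exists_lowerEst (half_lt_self hpos)
  obtain ⟨k', hk'⟩ := exists_lowerEst (half_lt_self hΓ0)
  have hM := h.admSums_le hr (half_pos hpos) hk
  have hM' := h.admSums_le (hr.pow m) (half_pos hΓ0) hk'
  set M := 4 * K ^ 2 / (lowerConst w (sch s γ) / 2) + 2 * K with hMdef
  have hM0 : 0 ≤ M := by positivity
  let N := max k k'
  have hu' : IsBlkMap 0 (fun j => p (j + N)) (fun j => u (j + N)) w := by
    refine ⟨fun a b hab => hu.1 (Nat.add_lt_add_right hab N), fun j _ => ?_⟩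
    have := hu.2 (j + N) (Nat.zero_le _)
    rwa [Nat.add_right_comm] at this
  have hN : ∀ j, N ≤ p (j + N) := fun j => (Nat.le_add_left N j).trans hu.1.le_apply
  have hsub : Submodule.span ℝ (Set.range fun j => u (j + N)) ≤ Submodule.span ℝ (Set.range u) := by
    refine Submodule.span_mono ?_
    rintro _ ⟨j, rfl⟩
    exact ⟨j + N, rfl⟩
  have hlarge : ∀ x ∈ Submodule.span ℝ (Set.range fun j => u (j + N)),
      ∃ t ∈ admSums w f (sch s γ) x, κ * ‖x‖ ≤ t := by
    intro x hx
    by_cases hx0 : x = 0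
    · exact ⟨0, ⟨∅, hr.empty, id, by simp [Adm], by simp⟩, by simp [hx0]⟩
    · obtain ⟨t, ht, hlt⟩ := hcon x (hsub hx) hx0
      exact ⟨t, ht, hlt.le⟩
  -- Chosen so that the accumulated alignment error `m * (3 * M * ε)` is at most 1/4; the added 1
  -- keeps the denominator positive.
  have hε : 0 < 1 / (12 * m * M + 1) := by positivity
  obtain ⟨y, hy, hy1, hyJ⟩ := h.hasFlat_famPow hu' hs hc₁ hl₁ hw hγ hpos m _ hε 0
  have hy' : y ∈ Submodule.span ℝ (Set.range fun j => u (j + N)) :=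
    Submodule.span_mono (Set.image_subset_range _ _) hy
  obtain ⟨J, ρ, hJ, hJm, -, hsum⟩ := h.exists_iterate hu' hr hM0 hM
    (fun j => (le_max_left k k').trans (hN j)) hκ hlarge hy' hε.le hyJ le_rfl
  obtain ⟨b, -, hyb⟩ := exists_mem_span_Ico hy
  have hyt : y ∈ tailClosure w k' := span_le_tailClosure w
    (fun i hi => (le_max_right k k').trans ((hN 0).trans hi.1)) (hu'.span_le (Nat.zero_le _) hyb)
  have h1 := hM' y hyt _ (sum_Ico_mem_admSums hu'.1 hJ hJm y)
  rw [hy1, mul_one] at hsum h1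
  have h2 : 4 * K ^ 2 / (Γ / 2) + 2 * K ≤ 10 * K ^ 2 / Γ := by
    rw [le_div_iff₀ hΓ0, add_mul, div_mul_eq_mul_div, div_div_eq_mul_div, mul_right_comm,
      mul_div_assoc, div_self hΓ0.ne']
    nlinarith [mul_le_mul_of_nonneg_left hΓ1 (zero_le_one.trans hK)]
  have h3 : (m : ℝ) * (3 * M * (1 / (12 * m * M + 1))) ≤ 1 / 4 := by
    rw [mul_one_div, mul_div_assoc', div_le_div_iff₀ (by positivity) (by norm_num)]
    linarith
  have hκm : 0 < κ ^ m := by positivity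
  have h4 : κ ^ m ≤ 10 * K ^ 2 / Γ + 1 / 4 * κ ^ m := by
    have := mul_le_mul_of_nonneg_right h3 hκm.le
    linarith
  have h5 : 3 / 4 * κ ^ m * Γ ≤ 10 * K ^ 2 := by
    rw [← le_div_iff₀ hΓ0]
    linarith
  nlinarith

end CoordSystem

end SmallVectors

/-! ### Decay of the lower constants along powers -/

section Decay

variable {X : Type*} [NormedAddCommGroup X] [NormedSpace ℝ X]
  {w : ℕ → X} {f : ℕ → X →L[ℝ] ℝ} {K : ℝ} {s : Ordinal.{0} → ℕ → Ordinal.{0}}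

/-- The lower constants of the powers of `𝓕` decay exponentially. -/
def Decays (w : ℕ → X) (𝓕 : Set (Finset ℕ)) : Prop :=
  ∃ c : ℝ, 0 ≤ c ∧ c < 1 ∧ ∀ m, 1 ≤ m → lowerConst w (famPow 𝓕 m) ≤ c ^ m

/-- One exponent `m` with a large constant suffices, because supermultiplicativity carries the bound
`c ^ m` to all multiples of `m`. -/
theorem exists_le_pow_mul_lowerConst {𝓕 : Set (Finset ℕ)} (h𝓕 : IsReg 𝓕) (hw : ∀ j, w j ≠ 0)
    {c κ : ℝ} (hc : 0 ≤ c) (hκ : 0 ≤ κ) (hcκ : 1 < κ * c) {m : ℕ} (hm : 1 ≤ m)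
    (h : c ^ m ≤ lowerConst w (famPow 𝓕 m)) (B : ℝ) :
    ∃ n, B ≤ κ ^ n * lowerConst w (famPow 𝓕 n) := by
  obtain ⟨n, hn⟩ := pow_unbounded_of_one_lt B hcκ
  refine ⟨m * n, hn.le.trans ?_⟩
  have h1 : c ^ (m * n) ≤ lowerConst w (famPow 𝓕 (m * n)) := by
    rw [pow_mul, ← famPow_mul h𝓕]
    exact (pow_le_pow_left₀ (pow_nonneg hc _) h n).trans
      (lowerConst_pow (k := 0) (h𝓕.pow m) (fun j _ => hw j) n)
  calc (κ * c) ^ n ≤ (κ * c) ^ (m * n) :=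
        pow_le_pow_right₀ hcκ.le (Nat.le_mul_of_pos_left n hm)
    _ = κ ^ (m * n) * c ^ (m * n) := mul_pow _ _ _
    _ ≤ _ := by gcongr

theorem BoundedDistortion.exists_sch_estimates [CompleteSpace X] {D : ℝ}
    (hD : BoundedDistortion X D) (hD1 : 1 ≤ D) (e : SchauderBasis ℝ X) (hw : IsBlk 0 w e.basis)
    (h : CoordSystem w f K) (hs : IsLadder s) {c₁ : ℝ} (hc₁ : 0 < c₁)
    (hl₁ : LowerEst w schOne 0 c₁) {γ : Ordinal.{0}} (hγ : γ < Ordinal.omega 1)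
    (hst : Stable w (sch s γ)) (hpos : 0 < lowerConst w (sch s γ)) {τ κ : ℝ} (hτ : 0 < τ)
    (hlt : τ * lowerConst w (sch s γ) < 1) (hκ : 1 ≤ κ)
    (hunb : ∀ B : ℝ, ∃ m, B ≤ κ ^ m * lowerConst w (famPow (sch s γ) m))
    {u : ℕ → X} {l : ℕ} (hu : IsBlk l u w) :
    ∃ z, IsBlk 0 z u ∧ ∀ x ∈ tailClosure z 0,
      (∀ t ∈ admSums w f (sch s γ) x, t ≤ 5 / 2 * D * κ * ‖x‖) ∧
      ∀ B, (∀ t ∈ admSums w f (sch s γ) x, t ≤ B) → τ * ‖x‖ ≤ 5 / 2 * D * B := by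
  have hr := isReg_sch hs hγ
  have hw0 : ∀ j, w j ≠ 0 := fun j => hw.ne_zero (Nat.zero_le j)
  refine hD.exists_block_estimates hD1 e hw h hr hpos (fun v hv => ?_) (fun v hv => ?_) hu
  · obtain ⟨y, hy, hy0, A, hA, r, hrA, hle⟩ := h.exists_large hr hst hτ hlt hv
    exact ⟨y, hy, hy0, _, ⟨A, hA, r, hrA, rfl⟩, hle⟩
  · exact h.exists_small hs hc₁ hl₁ hw0 hγ hpos hκ hunb hv

/-- With δ the constant of 𝓢_γ, the engine with τ = 9/(10δ) and κ = 11/10, evaluated at one nonzero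
vector, gives 9/(10δ) ≤ (5D/2)²·11/10, and 8 is a convenient bound for the resulting numerical
factor. -/
theorem BoundedDistortion.le_lowerConst_of_not_decays [CompleteSpace X] {D : ℝ}
    (hD : BoundedDistortion X D) (hD1 : 1 ≤ D) (e : SchauderBasis ℝ X)
    (he : IsAsymptoticEll1 e) (hw : IsBlk 0 w e.basis) (hs : IsLadder s)
    {γ : Ordinal.{0}} (hγ : γ < Ordinal.omega 1) (hst : Stable w (sch s γ))
    (hdec : ¬ Decays w (sch s γ)) : 1 / (8 * D ^ 2) ≤ lowerConst w (sch s γ) := by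
  have hr := isReg_sch hs hγ
  have hw0 : ∀ j, w j ≠ 0 := fun j => hw.ne_zero (Nat.zero_le j)
  obtain ⟨f, K, h⟩ := exists_coordSystem e hw
  obtain ⟨c₁, hc₁, hl₁⟩ := lowerEst_basis e he
  have hl₁ : LowerEst w schOne 0 c₁ := hl₁.of_isBlk isReg_schOne hw
  -- If the constant were zero, those of all higher powers would vanish too, which is decay with
  -- rate 0.
  have hpos : 0 < lowerConst w (sch s γ) := by
    refine (lowerConst_nonneg (k := 0) hr fun j _ => hw0 j).lt_of_ne' fun h0 => hdec ?_
    refine ⟨0, le_rfl, zero_lt_one, fun m hm => ?_⟩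
    rw [zero_pow (by omega), ← h0]
    refine lowerConst_anti (k := 0) hr (fun j _ => hw0 j) ?_
    have := famPow_subset hr hm
    rwa [famPow_one hr] at this
  have hunb : ∀ B : ℝ, ∃ m, B ≤ (11 / 10) ^ m * lowerConst w (famPow (sch s γ) m) := by
    have h1 : ¬ ∀ m, 1 ≤ m → lowerConst w (famPow (sch s γ) m) ≤ (20 / 21 : ℝ) ^ m := fun h1 =>
      hdec ⟨20 / 21, by norm_num, by norm_num, h1⟩
    push Not at h1
    obtain ⟨m, hm, hlt⟩ := h1
    exact exists_le_pow_mul_lowerConst hr hw0 (by norm_num) (by norm_num) (by norm_num) hm hlt.le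
  obtain ⟨z, hz, hest⟩ := hD.exists_sch_estimates hD1 e hw h hs hc₁ hl₁ hγ hst hpos
    (τ := 9 / 10 / lowerConst w (sch s γ)) (by positivity)
    (by rw [div_mul_cancel₀ _ hpos.ne']; norm_num) (by norm_num) hunb (isBlk_refl hw0)
  have hz0 : 0 < ‖z 0‖ := norm_pos_iff.2 (hz.ne_zero le_rfl)
  obtain ⟨h1, h2⟩ := hest (z 0) (span_le_tailClosure z (S := {0}) (by simp)
    (Submodule.subset_span (by simp)))
  have h3 := h2 _ h1
  rw [← mul_assoc] at h3
  have h4 := le_of_mul_le_mul_right h3 hz0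
  rw [div_le_iff₀ hpos] at h4
  rw [div_le_iff₀ (by positivity)]
  nlinarith [mul_pos hpos (pow_pos (zero_lt_one.trans_le hD1) 2)]

end Decay

/-! ### Uniform `ℓ₁` trees of every countable order -/

section Tree

variable {X : Type*} [NormedAddCommGroup X] [NormedSpace ℝ X]

/-- Summation against `y` is bounded on ℓ₁ because `y` is normalized, and bounded below by
hypothesis, so it is an isomorphism onto its closed range. -/
theorem containsEll1_of_lower [CompleteSpace X] {y : ℕ → X} (hy : ∀ i, ‖y i‖ = 1) {C : ℝ}
    (hC : ∀ (n : ℕ) (a : ℕ → ℝ),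
      ∑ i ∈ Finset.range n, |a i| ≤ C * ‖∑ i ∈ Finset.range n, a i • y i‖) : ContainsEll1 X := by
  have hC0 : 0 ≤ C := by
    have := hC 1 (fun _ => 1)
    simp only [Finset.range_one, Finset.sum_singleton, one_smul, hy, mul_one, abs_one] at this
    linarith
  have hsum : ∀ a : lp (fun _ : ℕ => ℝ) 1, Summable fun i => |a i| := fun a => by
    have := (memℓp_gen_iff (p := 1) (by simp)).1 (lp.memℓp a)
    simpa using this
  have hnorm : ∀ a : lp (fun _ : ℕ => ℝ) 1, ‖a‖ = ∑' i, |a i| := fun a => by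
    have := lp.norm_eq_tsum_rpow (p := 1) (by simp) a
    simpa using this
  have hns : ∀ a : lp (fun _ : ℕ => ℝ) 1, Summable fun i => ‖a i • y i‖ := fun a => by
    simpa [norm_smul, hy] using hsum a
  have hs : ∀ a : lp (fun _ : ℕ => ℝ) 1, Summable fun i => a i • y i := fun a => (hns a).of_norm
  let T₀ : lp (fun _ : ℕ => ℝ) 1 →ₗ[ℝ] X :=
    { toFun := fun a => ∑' i, a i • y i
      map_add' := fun a b => by
        rw [← (hs a).tsum_add (hs b)]
        simp only [lp.coeFn_add, Pi.add_apply, add_smul]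
      map_smul' := fun r a => by
        rw [RingHom.id_apply, ← (hs a).tsum_const_smul]
        simp only [lp.coeFn_smul, Pi.smul_apply, smul_assoc] }
  let T : lp (fun _ : ℕ => ℝ) 1 →L[ℝ] X := T₀.mkContinuous 1 fun a => by
    rw [one_mul, hnorm]
    refine (norm_tsum_le_tsum_norm (hns a)).trans (le_of_eq ?_)
    simp [norm_smul, hy]
  have hlow : ∀ a, ‖a‖ ≤ (C.toNNReal : ℝ) * ‖T a‖ := by
    intro a
    rw [Real.coe_toNNReal C hC0, hnorm]
    exact le_of_tendsto_of_tendsto' (hsum a).hasSum.tendsto_sum_nat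
      ((hs a).hasSum.tendsto_sum_nat.norm.const_mul C) fun n => hC n a
  have hanti := T.antilipschitz_of_bound hlow
  exact ⟨_, ⟨(T.equivRange hanti.injective
    (hanti.isClosed_range T.uniformContinuous)).symm⟩⟩

theorem separableSpace_of_basis (e : SchauderBasis ℝ X) : TopologicalSpace.SeparableSpace X := by
  rw [← TopologicalSpace.isSeparable_univ_iff]
  refine ((Set.countable_range e.basis).isSeparable.span (R := ℝ)).closure.mono fun x _ => ?_
  refine mem_closure_of_tendsto (SchauderBasis.tendsto_proj e x)
    (Filter.Eventually.of_forall fun n => ?_)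
  rw [SchauderBasis.proj_apply]
  exact Submodule.sum_mem _ fun i _ => Submodule.smul_mem _ _ (Submodule.subset_span ⟨i, rfl⟩)

variable {s : Ordinal.{0} → ℕ → Ordinal.{0}}

/-- The set splits into the pieces `{m}` and `J`. Having two pieces requires the first number to be
at least 2 when counting from one, that is `1 ≤ m` here. -/
theorem insert_mem_sch_succ (hs : IsLadder s) {a : Ordinal.{0}} (ha : a < Ordinal.omega 1)
    {m : ℕ} (hm : 1 ≤ m) {J : Finset ℕ} (hJ : J ∈ sch s a) (hmJ : ∀ j ∈ J, m < j) :
    insert m J ∈ sch s (a + 1) := by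
  have hr := isReg_sch hs ha
  rw [sch_succ]
  refine mem_familyProd_of_label isReg_schOne (fun x => if x = m then m else m + 1) ?_ ?_ ?_ ?_
  · intro x hx x' hx' hle
    have h1 : m ≤ x := by
      rcases Finset.mem_insert.1 hx with rfl | h
      exacts [le_rfl, (hmJ x h).le]
    dsimp only
    split_ifs <;> omega
  · intro x hx
    rcases Finset.mem_insert.1 hx with rfl | h
    · simp
    · have := hmJ x h
      rw [if_neg (by omega)]
      exact this
  · have hsub : (insert m J).image (fun x => if x = m then m else m + 1) ⊆ {m, m + 1} := by
      intro x hx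
      obtain ⟨y, -, rfl⟩ := Finset.mem_image.1 hx
      split_ifs <;> simp
    intro n hn
    have h1 : m ≤ n := by
      have := hsub hn
      rw [Finset.mem_insert, Finset.mem_singleton] at this
      omega
    have := (Finset.card_le_card hsub).trans Finset.card_le_two
    omega
  · intro t
    by_cases ht : t = m
    · refine hr.mem_of_card_le_one (Finset.card_le_one.2 ?_)
      have key : ∀ x ∈ (insert m J).filter (fun x => (if x = m then m else m + 1) = t), x = m := by
        intro x hx
        have := (Finset.mem_filter.1 hx).2
        by_contra hne
        rw [if_neg hne] at this
        omega
      exact fun x hx y hy => (key x hx).trans (key y hy).symm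
    · refine hr.mono hJ fun x hx => ?_
      obtain ⟨hx, hxt⟩ := Finset.mem_filter.1 hx
      rcases Finset.mem_insert.1 hx with rfl | h
      · rw [if_pos rfl] at hxt
        exact absurd hxt.symm ht
      · exact h

/-- The vectors `Q (g i)`, `i < n`, followed by those of some sequence along the members of `𝓢_a`,
satisfy a lower `ℓ₁` estimate. -/
def HasExtension (Q : ℕ → X) (C : ℝ) (s : Ordinal.{0} → ℕ → Ordinal.{0}) (a : Ordinal.{0})
    (n : ℕ) (g : ℕ → ℕ) : Prop :=
  ∃ (q : ℕ → ℕ) (N : ℕ), ∀ J ∈ sch s a, (∀ j ∈ J, N ≤ j) → ∀ b c : ℕ → ℝ,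
    ∑ i ∈ Finset.range n, |b i| + ∑ j ∈ J, |c j| ≤
      C * ‖∑ i ∈ Finset.range n, b i • Q (g i) + ∑ j ∈ J, c j • Q (q j)‖

variable {Q : ℕ → X} {C : ℝ}

theorem HasExtension.mono (hs : IsLadder s) {a b : Ordinal.{0}} (hab : a ≤ b)
    (hb : b < Ordinal.omega 1) {n : ℕ} {g : ℕ → ℕ} (h : HasExtension Q C s b n g) :
    HasExtension Q C s a n g := by
  obtain ⟨q, N, h⟩ := h
  obtain ⟨k, hk⟩ := exists_tail_sch_subset hs hab hb
  exact ⟨q, max N k, fun J hJ hN => h J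
    (hk J hJ fun j hj => (le_max_right _ _).trans (hN j hj))
    fun j hj => (le_max_left _ _).trans (hN j hj)⟩

/-- The first vector beyond the threshold of the given extension becomes a fixed vector, and the
rest is an extension of order one less. -/
theorem HasExtension.exists_succ (hs : IsLadder s) {a : Ordinal.{0}} (ha : a < Ordinal.omega 1)
    {n : ℕ} {g : ℕ → ℕ} (h : HasExtension Q C s (a + 1) n g) :
    ∃ x, HasExtension Q C s a (n + 1) (Function.update g n x) := by
  obtain ⟨q, N, h⟩ := h
  let m := max N 1
  refine ⟨q m, q, m + 1, fun J hJ hN b c => ?_⟩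
  have hmJ : m ∉ J := fun hm => absurd (hN m hm) (by omega)
  have hc : ∀ j ∈ J, Function.update c m (b n) j = c j := fun j hj =>
    Function.update_of_ne (by have := hN j hj; omega) _ _
  have h1 := h (insert m J)
    (insert_mem_sch_succ hs ha (le_max_right _ _) hJ fun j hj => hN j hj) ?_ b
    (Function.update c m (b n))
  · have e1 : ∑ j ∈ J, |Function.update c m (b n) j| = ∑ j ∈ J, |c j| :=
      Finset.sum_congr rfl fun j hj => by rw [hc j hj]
    have e2 : ∑ j ∈ J, Function.update c m (b n) j • Q (q j) = ∑ j ∈ J, c j • Q (q j) :=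
      Finset.sum_congr rfl fun j hj => by rw [hc j hj]
    have e3 : ∑ i ∈ Finset.range n, b i • Q (Function.update g n (q m) i) =
        ∑ i ∈ Finset.range n, b i • Q (g i) := Finset.sum_congr rfl fun i hi => by
      rw [Function.update_of_ne (Finset.mem_range.1 hi).ne]
    rw [Finset.sum_insert hmJ, Finset.sum_insert hmJ, Function.update_self, e1, e2, ← add_assoc,
      ← add_assoc] at h1
    rwa [Finset.sum_range_succ, Finset.sum_range_succ, Function.update_self, e3]
  · intro j hj
    rcases Finset.mem_insert.1 hj with rfl | hj
    · exact le_max_left _ _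
    · exact (le_max_left N 1).trans ((Nat.le_succ m).trans (hN j hj))

/-- The vectors of an ℓ₁ sequence are chosen one by one, keeping extensions of every countable
order. If each of the countably many candidates failed at some countable ordinal, these ordinals
would have a countable supremum, and the vector produced by an extension of order one more would not
fail. -/
theorem containsEll1_of_hasExtension [CompleteSpace X] (hs : IsLadder s) (hQ : ∀ i, ‖Q i‖ = 1)
    (h : ∀ a < Ordinal.omega 1, HasExtension Q C s a 0 id) : ContainsEll1 X := by
  have hstep : ∀ (n : ℕ) (g : {g : ℕ → ℕ // ∀ a < Ordinal.omega 1, HasExtension Q C s a n g}),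
      ∃ x, ∀ a < Ordinal.omega 1, HasExtension Q C s a (n + 1) (Function.update g.1 n x) := by
    rintro n ⟨g, hg⟩
    by_contra! hcon
    choose a ha hna using hcon
    have hsup : (⨆ x, a x) < Ordinal.omega 1 := Ordinal.iSup_lt_omega_one ha
    obtain ⟨x, hx⟩ := (hg _ (add_lt_omega_one hsup
      (by simpa using natCast_lt_omega_one 1))).exists_succ hs hsup
    exact hna x (hx.mono hs (Ordinal.le_iSup a x) hsup)
  choose x hx using hstep
  let G : ∀ n, {g : ℕ → ℕ // ∀ a < Ordinal.omega 1, HasExtension Q C s a n g} := fun n =>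
    Nat.rec ⟨id, h⟩ (fun n g => ⟨Function.update g.1 n (x n g), hx n g⟩) n
  have hG : ∀ n, (G (n + 1)).1 = Function.update (G n).1 n (x n (G n)) := fun n => rfl
  have hstab : ∀ i n, i < n → (G n).1 i = (G (i + 1)).1 i := by
    intro i n hin
    induction n, hin using Nat.le_induction with
    | base => rfl
    | succ n hn ih => rw [hG, Function.update_of_ne (by omega), ih]
  refine containsEll1_of_lower (y := fun i => Q ((G (i + 1)).1 i)) (fun i => hQ _) (C := C) ?_
  intro n a
  have h0 : (0 : Ordinal.{0}) < Ordinal.omega 1 := by simpa using natCast_lt_omega_one 0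
  obtain ⟨q, N, hq⟩ := (G n).2 0 h0
  have h1 := hq ∅ (isReg_sch hs h0).empty (by simp) a 0
  simp only [Finset.sum_empty, add_zero] at h1
  have h2 : ∑ i ∈ Finset.range n, a i • Q ((G n).1 i) =
      ∑ i ∈ Finset.range n, a i • Q ((G (i + 1)).1 i) := Finset.sum_congr rfl fun i hi => by
    rw [hstab i n (Finset.mem_range.1 hi)]
  rwa [h2] at h1

/-- Separability confines the choices to a countable set: the normalized vectors are replaced by
members of a dense sequence of the sphere within `c / 2`, which halves the lower constant. -/
theorem containsEll1_of_lowerEst [CompleteSpace X] (hs : IsLadder s) (e : SchauderBasis ℝ X)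
    {c : ℝ} (hc : 0 < c) (h : ∀ a < Ordinal.omega 1,
      ∃ w : ℕ → X, (∀ j, w j ≠ 0) ∧ ∃ k, LowerEst w (sch s a) k c) : ContainsEll1 X := by
  have hsep := separableSpace_of_basis e
  have hne : Nonempty (Metric.sphere (0 : X) 1) := by
    obtain ⟨w, hw, -⟩ := h 0 (by simpa using natCast_lt_omega_one 0)
    refine ⟨⟨‖w 0‖⁻¹ • w 0, ?_⟩⟩
    rw [mem_sphere_zero_iff_norm, norm_smul, norm_inv, norm_norm,
      inv_mul_cancel₀ (norm_ne_zero_iff.2 (hw 0))]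
  have hsep' : TopologicalSpace.SeparableSpace (Metric.sphere (0 : X) 1) :=
    (TopologicalSpace.IsSeparable.of_separableSpace _).separableSpace
  let Q : ℕ → Metric.sphere (0 : X) 1 := TopologicalSpace.denseSeq _
  refine containsEll1_of_hasExtension (Q := fun i => (Q i : X)) (C := 2 / c) hs
    (fun i => mem_sphere_zero_iff_norm.1 (Q i).2) fun a ha => ?_
  obtain ⟨w, hw, k, hk⟩ := h a ha
  let v : ℕ → X := fun j => ‖w j‖⁻¹ • w j
  have hv : ∀ j, ‖v j‖ = 1 := fun j => by
    rw [norm_smul, norm_inv, norm_norm, inv_mul_cancel₀ (norm_ne_zero_iff.2 (hw j))]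
  have hq : ∀ j, ∃ i, ‖v j - Q i‖ ≤ c / 2 := by
    intro j
    obtain ⟨i, hi⟩ := (TopologicalSpace.denseRange_denseSeq (Metric.sphere (0 : X) 1)).exists_dist_lt
      ⟨v j, mem_sphere_zero_iff_norm.2 (hv j)⟩ (half_pos hc)
    refine ⟨i, ?_⟩
    rw [Subtype.dist_eq, dist_eq_norm] at hi
    exact hi.le
  choose q hq using hq
  refine ⟨q, k, fun J hJ hN b d => ?_⟩
  simp only [Finset.range_zero, Finset.sum_empty, zero_add]
  have h1 := hk J hJ hN (fun t => t + 1) (fun t _ t' _ hlt => Nat.succ_le_of_lt hlt)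
    (fun j => d j • v j) fun j _ => Submodule.smul_mem _ _ (Submodule.smul_mem _ _
      (Submodule.subset_span ⟨j, ⟨le_rfl, Nat.lt_succ_self j⟩, rfl⟩))
  simp only [norm_smul, hv, mul_one, Real.norm_eq_abs] at h1
  have h2 : ‖∑ j ∈ J, d j • v j‖ ≤ ‖∑ j ∈ J, d j • (Q (q j) : X)‖ + c / 2 * ∑ j ∈ J, |d j| := by
    have h3 : ∑ j ∈ J, d j • v j = ∑ j ∈ J, d j • (Q (q j) : X) +
        ∑ j ∈ J, d j • (v j - (Q (q j) : X)) := by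
      rw [← Finset.sum_add_distrib]
      exact Finset.sum_congr rfl fun j _ => by rw [smul_sub, add_sub_cancel]
    rw [h3]
    refine (norm_add_le _ _).trans (add_le_add le_rfl ((norm_sum_le _ _).trans ?_))
    rw [Finset.mul_sum]
    refine Finset.sum_le_sum fun j _ => ?_
    rw [norm_smul, Real.norm_eq_abs, mul_comm]
    exact mul_le_mul_of_nonneg_right (hq j) (abs_nonneg _)
  rw [div_mul_eq_mul_div, le_div_iff₀ hc]
  linarith

end Tree

/-! ### The least ordinal with exponential decay -/

section Least

variable {X : Type*} [NormedAddCommGroup X] [NormedSpace ℝ X]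
  {w : ℕ → X} {s : Ordinal.{0} → ℕ → Ordinal.{0}} {α : Ordinal.{0}} {D : ℝ}

/-- Stability for all powers of the families `𝓢_{α n}`. -/
def AllStable (s : Ordinal.{0} → ℕ → Ordinal.{0}) (α : Ordinal.{0}) (w : ℕ → X) : Prop :=
  ∀ n m : ℕ, Stable w (famPow (sch s (α * n)) m)

theorem isReg_sch_mul (hs : IsLadder s) (hα : α < Ordinal.omega 1) (n : ℕ) :
    IsReg (sch s (α * n)) :=
  isReg_sch hs (mul_lt_omega_one hα (natCast_lt_omega_one n))

theorem exists_allStable (hs : IsLadder s) (hα : α < Ordinal.omega 1) (hw : ∀ j, w j ≠ 0) :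
    ∃ u, IsBlk 0 u w ∧ AllStable s α u := by
  obtain ⟨u, hu, hst⟩ := exists_stable
    (fun i => famPow (sch s (α * (i.unpair.1 : ℕ))) i.unpair.2)
    (fun i => (isReg_sch_mul hs hα _).pow _) hw
  refine ⟨u, hu, fun n m => ?_⟩
  have := hst (Nat.pair n m)
  rwa [Nat.unpair_pair] at this

theorem AllStable.pow (h : AllStable s α w) (m : ℕ) : Stable w (famPow (sch s α) m) := by
  simpa using h 1 m

theorem AllStable.mul (hs : IsLadder s) (hα : α < Ordinal.omega 1) (h : AllStable s α w) (n : ℕ) :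
    Stable w (sch s (α * n)) := by
  have := h n 1
  rwa [famPow_one (isReg_sch_mul hs hα n)] at this

theorem AllStable.stable (hs : IsLadder s) (hα : α < Ordinal.omega 1) (h : AllStable s α w) :
    Stable w (sch s α) := by
  simpa using h.mul hs hα 1

/-- The countable ordinals whose powers have exponentially decaying lower constants on some
stable block sequence of the basis. -/
def decaySet (s : Ordinal.{0} → ℕ → Ordinal.{0}) (e : SchauderBasis ℝ X) : Set Ordinal.{0} :=
  {α | α < Ordinal.omega 1 ∧
    ∃ w, IsBlk 0 w e.basis ∧ AllStable s α w ∧ Decays w (sch s α)}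

section

variable [CompleteSpace X] (hD : BoundedDistortion X D) (hD1 : 1 ≤ D) {e : SchauderBasis ℝ X}
  (he : IsAsymptoticEll1 e) (hs : IsLadder s)

include hD hD1 he hs

/-- The dichotomy gives the constant `1 / (8 * D ^ 2)` as a supremum; halving it makes it an actual
estimate on a tail, and that tail is taken as the new sequence. -/
theorem exists_lowerEst_of_notMem_decaySet (hα : α < Ordinal.omega 1) (h : α ∉ decaySet s e)
    (hw : IsBlk 0 w e.basis) :
    ∃ v, IsBlk 0 v w ∧ LowerEst v (sch s α) 0 (1 / (16 * D ^ 2)) := by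
  obtain ⟨u, hu, hst⟩ := exists_allStable hs hα fun j => hw.ne_zero (Nat.zero_le j)
  have hue := hu.trans_zero hw
  have h1 := hD.le_lowerConst_of_not_decays hD1 e he hue hs hα (hst.stable hs hα)
    fun hdec => h ⟨hα, u, hue, hst, hdec⟩
  have h2 : 1 / (16 * D ^ 2) < lowerConst u (sch s α) := by
    refine lt_of_lt_of_le (one_div_lt_one_div_of_lt (by positivity) ?_) h1
    have : 0 < D ^ 2 := by positivity
    linarith
  obtain ⟨k, hk⟩ := exists_lowerEst h2
  have hsh : StrictMono fun j : ℕ => j + k := fun a b hab => Nat.add_lt_add_right hab k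
  refine ⟨u ∘ fun j => j + k, (isBlk_comp hsh fun j _ => hue.ne_zero (Nat.zero_le _)).trans_zero hu,
    hk.of_blocks (k := 0) (p := fun j => j + k) hsh (fun j _ => Submodule.subset_span
      ⟨j + k, ⟨le_rfl, hsh (Nat.lt_succ_self j)⟩, rfl⟩)
      (fun A hA _ => (isReg_sch hs hα).image_of_strictMono hA hsh) fun j _ => Nat.le_add_left k j⟩

theorem decaySet_nonempty (he0 : ∀ j, e.basis j ≠ 0) (hX : ¬ ContainsEll1 X) :
    (decaySet s e).Nonempty := by
  by_contra hne
  rw [Set.not_nonempty_iff_eq_empty] at hne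
  refine hX (containsEll1_of_lowerEst hs e (c := 1 / (16 * D ^ 2)) (by positivity) fun a ha => ?_)
  obtain ⟨v, hv, hl⟩ := exists_lowerEst_of_notMem_decaySet hD hD1 he hs ha
    (by rw [hne]; exact Set.notMem_empty a) (isBlk_refl he0)
  exact ⟨v, fun j => hv.ne_zero (Nat.zero_le j), 0, hl⟩

/-- All smaller ordinals carry the uniform estimate `1 / (16 * D ^ 2)` on suitable blocks. A
successor costs one more factor, the asymptotic ℓ₁ constant. At a limit, a diagonal over the ladder
keeps the same constant, since a member from the `n`-th family starts beyond `n`, where the diagonal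
is a block of stage `n`. -/
theorem lowerConst_pos_of_minimal (hα : α < Ordinal.omega 1)
    (hmin : ∀ β < α, β ∉ decaySet s e) (hw : IsBlk 0 w e.basis) (hst : Stable w (sch s α)) :
    0 < lowerConst w (sch s α) := by
  obtain ⟨c₁, hc₁, hl₁⟩ := lowerEst_basis e he
  have hreg := isReg_sch hs hα
  have hw0 : ∀ j, w j ≠ 0 := fun j => hw.ne_zero (Nat.zero_le j)
  have hc : 0 < 1 / (16 * D ^ 2) := by positivity
  have hfin : ∀ {v c}, 0 < c → IsBlk 0 v w → LowerEst v (sch s α) 0 c →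
      0 < lowerConst w (sch s α) := fun hc hv hl =>
    (hc.trans_le (hl.le_lowerConst (k := 0) hreg fun j hj => hv.ne_zero hj)).trans_le (hst 0 _ hv)
  induction α using Ordinal.limitRecOn with
  | zero =>
    refine hfin one_pos (isBlk_refl hw0) ?_
    rw [sch_zero]
    exact lowerEst_singletons
  | add_one β _ =>
    have hβ := lt_add_one β
    obtain ⟨v, hv, hl⟩ := exists_lowerEst_of_notMem_decaySet hD hD1 he hs (hβ.trans hα)
      (hmin β hβ) hw
    have hl₁v : LowerEst v schOne 0 c₁ := hl₁.of_isBlk isReg_schOne (hv.trans_zero hw)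
    refine hfin (mul_pos hc₁ hc) hv ?_
    rw [sch_succ]
    exact hl₁v.prod (isReg_sch hs (hβ.trans hα)) hc₁.le hl
  | limit l hl _ =>
    have hsl := hs l hl hα
    have hstep : ∀ (n : ℕ) (u : {u : ℕ → X // IsBlk 0 u e.basis}),
        ∃ u' : {u : ℕ → X // IsBlk 0 u e.basis}, IsBlk 0 u'.1 u.1 ∧
          LowerEst u'.1 (sch s (s l n)) 0 (1 / (16 * D ^ 2)) := by
      rintro n ⟨u, hu⟩
      obtain ⟨v, hv, hlv⟩ := exists_lowerEst_of_notMem_decaySet hD hD1 he hs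
        ((hsl.2.1 n).trans hα) (hmin _ (hsl.2.1 n)) hu
      exact ⟨⟨v, hv.trans_zero hu⟩, hv, hlv⟩
    choose F hF hFl using hstep
    let U : ℕ → {u : ℕ → X // IsBlk 0 u e.basis} := fun n => Nat.rec ⟨w, hw⟩ (fun n u => F n u) n
    have hU : ∀ n, IsBlk 0 (U (n + 1)).1 (U n).1 := fun n => hF n (U n)
    have hd := isBlk_diagonal (fun n => (U (n + 1)).1) (fun n => hU (n + 1))
      fun j => (U 1).2.ne_zero (Nat.zero_le j)
    refine hfin hc ((hd 0).trans_zero (hU 0)) fun A hA _ => ?_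
    obtain ⟨n, hn, hnA⟩ := (sch_limit hs hl hα).1 hA
    exact (hFl n (U n)).of_isBlk (isReg_sch hs ((hsl.2.1 n).trans hα)) (hd n) A hn
      fun t ht => by simpa using hnA t ht

omit [CompleteSpace X] hD hD1 he in
-- Otherwise `α ≤ β * 2` for some `β < α`, so 𝓢_α embeds into the square of 𝓢_β. Decay of the powers
-- of 𝓢_α at rate `c` then passes to the even powers of 𝓢_β, and supermultiplicativity gives decay
-- at rate `√c`, against minimality.
theorem isPrincipal_add_of_minimal (hα : α < Ordinal.omega 1)
    (hmin : ∀ β < α, β ∉ decaySet s e) (hw : IsBlk 0 w e.basis) (hst : AllStable s α w)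
    (hdec : Decays w (sch s α)) : Ordinal.IsPrincipal (· + ·) α := by
  intro a b ha hb
  by_contra! hle
  set β := max a b with hβdef
  have hβ : β < α := max_lt ha hb
  have hαβ : α ≤ β * ((2 : ℕ) : Ordinal.{0}) := by
    refine hle.trans ?_
    rw [Nat.cast_ofNat, Ordinal.mul_two]
    exact add_le_add (le_max_left a b) (le_max_right a b)
  have hβ1 := hβ.trans hα
  have hrα := isReg_sch hs hα
  have hrβ := isReg_sch hs hβ1
  obtain ⟨v, hv, hvst⟩ := exists_allStable hs hβ1 fun j => hw.ne_zero (Nat.zero_le j)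
  have hv0 : ∀ j, v j ≠ 0 := fun j => hv.ne_zero (Nat.zero_le j)
  refine hmin β hβ ⟨hβ1, v, hv.trans_zero hw, hvst, ?_⟩
  obtain ⟨c, hc0, hc1, hc⟩ := hdec
  have hdom : Dominated (sch s α) (famPow (sch s β) 2) :=
    (dominated_sch_of_le hs hαβ (mul_lt_omega_one hβ1 (natCast_lt_omega_one 2))).trans
      (sch_mul_succ_dominated hs hβ1 2).1
  refine ⟨√c, Real.sqrt_nonneg c, by rw [Real.sqrt_lt' one_pos]; simpa using hc1, fun m hm => ?_⟩
  have h1 : lowerConst v (famPow (sch s β) (2 * m)) ≤ c ^ m := by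
    rw [← famPow_mul hrβ]
    exact ((((hst.pow m).of_isBlk (hrα.pow m) hv).lowerConst_le (hrα.pow m) hv0
      (hdom.pow hrα (hrβ.pow 2) m)).trans (hst.pow m 0 v hv)).trans (hc m hm)
  have h2 : lowerConst v (famPow (sch s β) m) ^ 2 ≤ c ^ m := by
    refine le_trans ?_ h1
    rw [mul_comm, ← famPow_mul hrβ]
    exact lowerConst_pow (k := 0) (hrβ.pow m) (fun j _ => hv0 j) 2
  refine le_of_sq_le_sq ?_ (by positivity)
  rwa [← pow_mul, mul_comm m 2, pow_mul, Real.sq_sqrt hc0]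

end

/-- The rate is the infimum of all admissible bounds; the set of bounds is closed, so the infimum is
one of them and no smaller number is. -/
theorem Decays.exists_rate {𝓕 : Set (Finset ℕ)} (h : Decays w 𝓕) (h𝓕 : IsReg 𝓕)
    (hpos : 0 < lowerConst w 𝓕) : ∃ θ : ℝ, 0 < θ ∧ θ < 1 ∧
      (∀ m, 1 ≤ m → lowerConst w (famPow 𝓕 m) ≤ θ ^ m) ∧
      ∀ c, 0 ≤ c → c < θ → ∃ m, 1 ≤ m ∧ c ^ m < lowerConst w (famPow 𝓕 m) := by
  let S : Set ℝ := {c | 0 ≤ c ∧ ∀ m, 1 ≤ m → lowerConst w (famPow 𝓕 m) ≤ c ^ m}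
  have hbdd : BddBelow S := ⟨0, fun c hc => hc.1⟩
  obtain ⟨c, hc0, hc1, hc⟩ := h
  have hcS : c ∈ S := ⟨hc0, hc⟩
  have hclosed : IsClosed S := by
    have : S = Set.Ici 0 ∩ ⋂ (m : ℕ) (_ : 1 ≤ m), {c | lowerConst w (famPow 𝓕 m) ≤ c ^ m} := by
      ext c
      simp [S]
    rw [this]
    refine isClosed_Ici.inter (isClosed_iInter fun m => isClosed_iInter fun _ => ?_)
    exact isClosed_le continuous_const (continuous_pow m)
  have hmem : sInf S ∈ S := hclosed.csInf_mem ⟨c, hcS⟩ hbdd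
  refine ⟨sInf S, ?_, (csInf_le hbdd hcS).trans_lt hc1, hmem.2, fun d hd0 hd => ?_⟩
  · have := hmem.2 1 le_rfl
    rw [famPow_one h𝓕, pow_one] at this
    exact hpos.trans_le this
  · by_contra! hcon
    exact absurd (csInf_le hbdd (show d ∈ S from ⟨hd0, hcon⟩)) (not_le.2 hd)

end Least

/-! ### Comparison of the norm with admissible sums -/

section Final

variable {X : Type*} [NormedAddCommGroup X] [NormedSpace ℝ X]
  {w : ℕ → X} {f : ℕ → X →L[ℝ] ℝ} {K : ℝ} {s : Ordinal.{0} → ℕ → Ordinal.{0}} {x : X}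

theorem IsBlk.tailClosure_le {v : ℕ → X} {k : ℕ} (hv : IsBlk k v w) :
    tailClosure v k ≤ tailClosure w 0 := by
  obtain ⟨p, hp, hv⟩ := hv
  refine Submodule.topologicalClosure_minimal _ ?_ (Submodule.isClosed_topologicalClosure _)
  rw [Submodule.span_le]
  rintro _ ⟨j, hj, rfl⟩
  exact span_le_tailClosure w (fun _ _ => Nat.zero_le _) (hv j hj).2

theorem CoordSystem.restrict_eq (h : CoordSystem w f K) (hx : x ∈ tailClosure w 0)
    (E : Finset ℕ) : restrict w E x = res w f E x := by
  rw [restrict, res_apply]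
  exact Finset.sum_congr rfl fun i _ => by rw [h.coeff_eq x hx]

theorem CoordSystem.sum_restrict_mem_admSums (h : CoordSystem w f K) (hx : x ∈ tailClosure w 0)
    {b : Ordinal.{0}} {m : ℕ} {l r : Fin m → ℕ} (hlr : IsAdmissible (schreier s b) l r) :
    ∑ i, ‖restrict w (Finset.Icc (l i) (r i)) x‖ ∈ admSums w f (sch s b) x := by
  have hl : StrictMono l := fun i j hij => (hlr.nonempty i).trans_lt (hlr.successive i j hij)
  have hext : ∀ i, Function.extend l (fun i => r i + 1) 0 (l i) = r i + 1 := fun i =>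
    hl.injective.extend_apply _ _ i
  refine ⟨Finset.univ.image l, ?_, Function.extend l (fun i => r i + 1) 0, ?_, ?_⟩
  · have := hlr.mem
    rw [sch, Set.mem_ofPred_eq, Finset.image_image]
    exact this
  · intro t ht t' ht' hlt
    obtain ⟨i, -, rfl⟩ := Finset.mem_image.1 ht
    obtain ⟨j, -, rfl⟩ := Finset.mem_image.1 ht'
    rw [hext]
    exact hlr.successive i j (hl.lt_iff_lt.1 hlt)
  · rw [Finset.sum_image hl.injective.injOn]
    refine Finset.sum_congr rfl fun i _ => ?_
    rw [hext, h.restrict_eq hx]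
    congr 2

theorem CoordSystem.exists_isAdmissible (h : CoordSystem w f K) (hx : x ∈ tailClosure w 0)
    {b : Ordinal.{0}} {t : ℝ} (ht : t ∈ admSums w f (sch s b) x) :
    ∃ (m : ℕ) (l r : Fin m → ℕ), IsAdmissible (schreier s b) l r ∧
      t ≤ ∑ i, ‖restrict w (Finset.Icc (l i) (r i)) x‖ := by
  obtain ⟨A, hA, r, hr, rfl⟩ := ht
  let ι := A.orderEmbOfFin rfl
  have hmem : ∀ i, ι i ∈ A := fun i => Finset.orderEmbOfFin_mem _ rfl i
  -- Half-open intervals may be empty here but admissible closed ones may not; an empty interval is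
  -- replaced by the single point at its start, which can only increase the sum.
  refine ⟨A.card, ι, fun i => max (r (ι i)) (ι i + 1) - 1, ⟨fun i => ?_, fun i j hij => ?_, ?_⟩, ?_⟩
  · have := le_max_right (r (ι i)) (ι i + 1)
    omega
  · have h1 : ι i < ι j := ι.strictMono hij
    have h2 := hr _ (hmem i) _ (hmem j) h1
    have h3 : max (r (ι i)) (ι i + 1) ≤ ι j := max_le h2 h1
    have := le_max_right (r (ι i)) (ι i + 1)
    omega
  · rw [sch, Set.mem_ofPred_eq] at hA
    have h1 : Finset.univ.image ι = A := Finset.image_orderEmbOfFin_univ A rfl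
    rw [← h1, Finset.image_image] at hA
    exact hA
  · rw [← sum_orderEmbOfFin A]
    refine Finset.sum_le_sum fun i _ => ?_
    rw [h.restrict_eq hx]
    rcases le_or_gt (r (ι i)) (ι i) with hle | hlt
    · rw [Finset.Ico_eq_empty (not_lt.2 hle)]
      simp [res_apply]
    · refine le_of_eq ?_
      congr 3
      ext j
      have h1 : max (r (ι i)) (ι i + 1) = r (ι i) := max_eq_left hlt
      simp only [Finset.mem_Ico, Finset.mem_Icc, h1]
      change ι i ≤ j ∧ j < r (ι i) ↔ ι i ≤ j ∧ j ≤ r (ι i) - 1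
      omega

theorem admissibleSup_le (h : CoordSystem w f K) (hx : x ∈ tailClosure w 0) {b : Ordinal.{0}}
    {t B : ℝ} (hB : ∀ σ ∈ admSums w f (sch s b) x, t * σ ≤ B) :
    admissibleSup (schreier s b) w t x ≤ ENNReal.ofReal B :=
  iSup_le fun _ => iSup_le fun _ => iSup_le fun _ => iSup_le fun hlr =>
    ENNReal.ofReal_le_ofReal (hB _ (h.sum_restrict_mem_admSums hx hlr))

theorem le_admissibleSup (h : CoordSystem w f K) (hx : x ∈ tailClosure w 0) {b : Ordinal.{0}}
    {t σ : ℝ} (ht : 0 ≤ t) (hσ : σ ∈ admSums w f (sch s b) x) :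
    ENNReal.ofReal (t * σ) ≤ admissibleSup (schreier s b) w t x := by
  obtain ⟨m, l, r, hlr, hle⟩ := h.exists_isAdmissible hx hσ
  refine (ENNReal.ofReal_le_ofReal (mul_le_mul_of_nonneg_left hle ht)).trans ?_
  exact le_iSup_of_le m (le_iSup_of_le l (le_iSup_of_le r (le_iSup_of_le hlr le_rfl)))

/-- The constants leave room: (5/2)(11/10) = 11/4 and (5/2)/(9/10) = 25/9 are both below 4. -/
theorem admissibleSup_estimates (h : CoordSystem w f K) (hx : x ∈ tailClosure w 0)
    {b : Ordinal.{0}} {t D : ℝ} (ht : 0 < t) (hD : 1 ≤ D)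
    (h1 : ∀ σ ∈ admSums w f (sch s b) x, σ ≤ 5 / 2 * D * (11 / 10 / t) * ‖x‖)
    (h2 : ∀ B, (∀ σ ∈ admSums w f (sch s b) x, σ ≤ B) → 9 / 10 / t * ‖x‖ ≤ 5 / 2 * D * B) :
    admissibleSup (schreier s b) w t x ≤ ENNReal.ofReal (4 * D * ‖x‖) ∧
      ‖x‖ₑ ≤ ENNReal.ofReal (4 * D) * admissibleSup (schreier s b) w t x := by
  have hx0 := norm_nonneg x
  have hup : admissibleSup (schreier s b) w t x ≤ ENNReal.ofReal (4 * D * ‖x‖) := by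
    refine admissibleSup_le h hx fun σ hσ => ?_
    have h3 := mul_le_mul_of_nonneg_left (h1 σ hσ) ht.le
    have h4 : t * (5 / 2 * D * (11 / 10 / t) * ‖x‖) = 11 / 4 * (D * ‖x‖) := by
      field_simp
      ring
    have h5 : 0 ≤ D * ‖x‖ := by positivity
    linarith
  refine ⟨hup, ?_⟩
  set S := admissibleSup (schreier s b) w t x with hS
  have hfin : S ≠ ⊤ := (hup.trans_lt ENNReal.ofReal_lt_top).ne
  have h3 := h2 (S.toReal / t) fun σ hσ => by
    rw [le_div_iff₀ ht, mul_comm]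
    exact (ENNReal.ofReal_le_iff_le_toReal hfin).1 (le_admissibleSup h hx ht.le hσ)
  have h4 : ‖x‖ ≤ 4 * D * S.toReal := by
    have h5 : 9 / 10 * ‖x‖ ≤ 5 / 2 * D * S.toReal := by
      rw [div_mul_eq_mul_div, mul_div_assoc', div_le_div_iff_of_pos_right ht] at h3
      exact h3
    have h6 : 0 ≤ D * S.toReal := mul_nonneg (by linarith) ENNReal.toReal_nonneg
    linarith
  calc ‖x‖ₑ = ENNReal.ofReal ‖x‖ := (ofReal_norm x).symm
    _ ≤ ENNReal.ofReal (4 * D * S.toReal) := ENNReal.ofReal_le_ofReal h4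
    _ = _ := by rw [ENNReal.ofReal_mul (by linarith), ENNReal.ofReal_toReal hfin]

/-- At every multiple of the ordinal `α` with exact rate of decay `θ`, the admissible sums are
comparable to `θ⁻ⁿ` times the norm on some block sequence. -/
theorem BoundedDistortion.exists_rate_estimates [CompleteSpace X] {D : ℝ}
    (hD : BoundedDistortion X D) (hD1 : 1 ≤ D) (e : SchauderBasis ℝ X)
    (he : IsAsymptoticEll1 e) (hw : IsBlk 0 w e.basis)
    (h : CoordSystem w f K) (hs : IsLadder s) {α : Ordinal.{0}} (hα : α < Ordinal.omega 1)
    (hst : AllStable s α w) (hpos : 0 < lowerConst w (sch s α)) {θ : ℝ} (hθ0 : 0 < θ)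
    (hθ1 : θ < 1) (hle : ∀ m, 1 ≤ m → lowerConst w (famPow (sch s α) m) ≤ θ ^ m)
    (hge : ∀ c, 0 ≤ c → c < θ → ∃ m, 1 ≤ m ∧ c ^ m < lowerConst w (famPow (sch s α) m))
    {n : ℕ} (hn : 1 ≤ n) {u : ℕ → X} (hu : IsBlk 0 u w) :
    ∃ z, IsBlk 0 z u ∧ ∀ x ∈ tailClosure z 0,
      (∀ t ∈ admSums w f (sch s (α * n)) x, t ≤ 5 / 2 * D * (11 / 10 / θ ^ n) * ‖x‖) ∧
      ∀ B, (∀ t ∈ admSums w f (sch s (α * n)) x, t ≤ B) →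
        9 / 10 / θ ^ n * ‖x‖ ≤ 5 / 2 * D * B := by
  have hw0 : ∀ j, w j ≠ 0 := fun j => hw.ne_zero (Nat.zero_le j)
  obtain ⟨c₁, hc₁, hl₁⟩ := lowerEst_basis e he
  have hl₁ : LowerEst w schOne 0 c₁ := hl₁.of_isBlk isReg_schOne hw
  have hr := isReg_sch hs hα
  have hrn := isReg_sch_mul hs hα n
  obtain ⟨hd1, hd2⟩ := sch_mul_succ_dominated hs hα n
  have hposn : 0 < lowerConst w (sch s (α * n)) :=
    ((pow_pos hpos n).trans_le (lowerConst_pow (k := 0) hr (fun j _ => hw0 j) n)).trans_le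
      ((hst.mul hs hα n).lowerConst_le hrn hw0 hd1)
  have hlen : lowerConst w (sch s (α * n)) ≤ θ ^ n :=
    ((hst.pow n).lowerConst_le (hr.pow n) hw0 hd2).trans (hle n hn)
  have hθn : 0 < θ ^ n := pow_pos hθ0 n
  have hn0 : (0 : ℝ) < n := by exact_mod_cast hn
  have hκ : (1 : ℝ) ≤ 11 / 10 / θ ^ n := by
    rw [le_div_iff₀ hθn, one_mul]
    exact (pow_le_one₀ hθ0.le hθ1.le).trans (by norm_num)
  refine hD.exists_sch_estimates hD1 e hw h hs hc₁ hl₁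
    (mul_lt_omega_one hα (natCast_lt_omega_one n)) (hst.mul hs hα n) hposn
    (by positivity) ?_ hκ ?_ hu
  · rw [div_mul_eq_mul_div, div_lt_one hθn]
    linarith
  · have hδ : 1 / (22 * (n : ℝ)) ≤ 1 := by
      rw [div_le_one (by positivity)]
      have : (1 : ℝ) ≤ n := by exact_mod_cast hn
      linarith
    have hδ0 : 0 < 1 / (22 * (n : ℝ)) := by positivity
    -- By Bernoulli the `n`-th power of the correction is at least 21/22, and (11/10)(21/22) > 1,
    -- which is what makes `κ ^ m` times the constants unbounded.
    obtain ⟨m, hm, hlt⟩ := hge (θ * (1 - 1 / (22 * n))) (mul_nonneg hθ0.le (by linarith))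
      (by nlinarith)
    have hc0 : 0 ≤ θ * (1 - 1 / (22 * n)) := mul_nonneg hθ0.le (by linarith)
    refine exists_le_pow_mul_lowerConst hrn hw0 (pow_nonneg hc0 n) (by positivity) ?_ hm ?_
    · have h1 := one_add_mul_le_pow (a := -(1 / (22 * (n : ℝ)))) (by linarith) n
      have h2 : (n : ℝ) * -(1 / (22 * (n : ℝ))) = -(1 / 22) := by field_simp
      rw [h2, ← sub_eq_add_neg, ← sub_eq_add_neg] at h1
      rw [mul_pow, ← mul_assoc, div_mul_cancel₀ _ hθn.ne']
      linarith
    -- The exponents `m` and `n` are interchanged through the powers of 𝓢_α; stability then passes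
    -- from powers of the `n`-fold power of 𝓢_α to powers of 𝓢_{α·n}.
    · calc ((θ * (1 - 1 / (22 * n))) ^ n) ^ m = ((θ * (1 - 1 / (22 * n))) ^ m) ^ n := by
            rw [← pow_mul, ← pow_mul, mul_comm n m]
        _ ≤ lowerConst w (famPow (sch s α) m) ^ n :=
            pow_le_pow_left₀ (pow_nonneg hc0 m) hlt.le n
        _ ≤ lowerConst w (famPow (famPow (sch s α) m) n) :=
            lowerConst_pow (k := 0) (hr.pow m) (fun j _ => hw0 j) n
        _ = lowerConst w (famPow (famPow (sch s α) n) m) := by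
            rw [famPow_mul hr, famPow_mul hr, mul_comm]
        _ ≤ lowerConst w (famPow (sch s (α * n)) m) :=
            (hst n m).lowerConst_le (hrn.pow m) hw0 (hd1.pow hrn (hr.pow n) m)

/-- The `j`-th term of `z` is taken from stage `j + 1`, so the terms of number at least `k` are
blocks of the stage belonging to each `n ≤ k`. -/
theorem exists_diagonal_block {w : ℕ → X} (hw : ∀ j, w j ≠ 0)
    {P : ℕ → X → Prop} (hP : ∀ n, ∀ u, IsBlk 0 u w →
      ∃ z, IsBlk 0 z u ∧ ∀ x ∈ tailClosure z 0, P (n + 1) x) :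
    ∃ z, IsBlk 0 z w ∧ ∀ k, ∀ x ∈ tailSpan z k, ∀ n ∈ Set.Icc 1 k, P n x := by
  have hstep : ∀ (n : ℕ) (u : {u : ℕ → X // IsBlk 0 u w}), ∃ u' : {u : ℕ → X // IsBlk 0 u w},
      IsBlk 0 u'.1 u.1 ∧ ∀ x ∈ tailClosure u'.1 0, P (n + 1) x := by
    rintro n ⟨u, hu⟩
    obtain ⟨z, hz, hPz⟩ := hP n u hu
    exact ⟨⟨z, hz.trans_zero hu⟩, hz, hPz⟩
  choose F hF hFP using hstep
  let U : ℕ → {u : ℕ → X // IsBlk 0 u w} := fun n =>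
    Nat.rec ⟨w, isBlk_refl hw⟩ (fun n u => F n u) n
  have hd := isBlk_diagonal (fun n => (U (n + 1)).1) (fun n => hF (n + 1) (U (n + 1)))
    fun j => (U 1).2.ne_zero (Nat.zero_le j)
  refine ⟨fun j => (U (j + 1)).1 j, (hd 0).trans_zero (hF 0 (U 0)), fun k x hx n hn => ?_⟩
  obtain ⟨n, rfl⟩ := Nat.exists_eq_add_of_le' hn.1
  refine hFP n (U n) x ((hd n).tailClosure_le ?_)
  refine Submodule.topologicalClosure_mono (Submodule.span_mono (Set.image_mono fun i hi => ?_)) hx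
  exact Nat.le_of_succ_le_succ (hn.2.trans hi)

end Final

end AsymptoticEll1

end

/-! ### Assembly of the theorem -/

open AsymptoticEll1
theorem theorem6p10 {X : Type*} [NormedAddCommGroup X] [NormedSpace ℝ X] [CompleteSpace X]
    (s : Ordinal.{0} → ℕ → Ordinal.{0}) (hs : IsLadder s)
    (e : SchauderBasis ℝ X) (he : IsAsymptoticEll1 e)
    (D : ℝ) (hD : BoundedDistortion X D) (hX : ¬ ContainsEll1 X) :
    ∃ w : ℕ → X, IsBlockBasis w e.basis ∧
    ∃ α β₀ : Ordinal.{0}, β₀ < Ordinal.omega 1 ∧ α = Ordinal.omega0 ^ β₀ ∧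
    ∃ θ : ℝ, 0 < θ ∧ θ < 1 ∧
    ∃ z : ℕ → X, IsBlockBasis z w ∧
      ∀ k : ℕ, 1 ≤ k → ∀ x ∈ tailSpan z k,
        ENNReal.ofReal (1 / (4 * D)) *
            (⨆ n ∈ Set.Icc 1 k, admissibleSup (schreier s (α * (n : Ordinal.{0}))) w (θ ^ n) x)
          ≤ ‖x‖ₑ ∧
        ‖x‖ₑ ≤ ENNReal.ofReal (4 * D) *
            (⨅ n ∈ Set.Icc 1 k,
              admissibleSup (schreier s (α * (n : Ordinal.{0}))) w (θ ^ n) x) := by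
  have he0 : ∀ j, e.basis j ≠ 0 := fun j => e.linearIndependent.ne_zero j
  have hD1 : 1 ≤ D := hD.one_le fun hfin =>
    not_finite_iff_infinite.2 inferInstance e.linearIndependent.finite
  obtain ⟨α, ⟨hα, w, hw, hst, hdec⟩, hmin⟩ :=
    wellFounded_lt.has_min _ (decaySet_nonempty hD hD1 he hs he0 hX)
  have hmin : ∀ β < α, β ∉ decaySet s e := fun β hβ hmem => hmin β hmem hβ
  have hw0 : ∀ j, w j ≠ 0 := fun j => hw.ne_zero (Nat.zero_le j)
  have hpos := lowerConst_pos_of_minimal hD hD1 he hs hα hmin hw (hst.stable hs hα)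
  have hr := isReg_sch hs hα
  obtain ⟨θ, hθ0, hθ1, hle, hge⟩ := hdec.exists_rate hr hpos
  -- The singletons have lower constant 1, so they cannot decay.
  have hα0 : α ≠ 0 := by
    rintro rfl
    have h1 := hle 1 le_rfl
    rw [famPow_one hr, pow_one, sch_zero] at h1
    have h2 : 1 ≤ lowerConst w singletons := LowerEst.le_lowerConst (k := 0) (l := 0)
      isReg_singletons (fun j _ => hw0 j) lowerEst_singletons
    linarith
  obtain ⟨β₀, hβ₀⟩ := (Ordinal.isPrincipal_add_iff_zero_or_omega0_opow.1
    (isPrincipal_add_of_minimal hs hα hmin hw hst hdec)).resolve_left hα0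
  obtain ⟨f, K, h⟩ := exists_coordSystem e hw
  -- Membership in the closed span of `w` is carried along because restrictions and coordinates
  -- refer to `w`, not to `z`.
  obtain ⟨z, hz, hPz⟩ := exists_diagonal_block hw0 (P := fun n x => x ∈ tailClosure w 0 ∧
      (∀ t ∈ admSums w f (sch s (α * (n : ℕ))) x, t ≤ 5 / 2 * D * (11 / 10 / θ ^ n) * ‖x‖) ∧
      ∀ B, (∀ t ∈ admSums w f (sch s (α * (n : ℕ))) x, t ≤ B) →
        9 / 10 / θ ^ n * ‖x‖ ≤ 5 / 2 * D * B) fun n u hu => by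
    obtain ⟨z, hz, hest⟩ := hD.exists_rate_estimates hD1 e he hw h hs hα hst hpos hθ0 hθ1 hle hge
      (Nat.le_add_left 1 n) hu
    exact ⟨z, hz, fun x hx => ⟨(hz.trans_zero hu).tailClosure_le hx, hest x hx⟩⟩
  refine ⟨w, hw.isBlockBasis, α, β₀, ?_, hβ₀.symm, θ, hθ0, hθ1, z, hz.isBlockBasis,
    fun k hk x hx => ?_⟩
  · refine lt_of_le_of_lt ?_ hα
    rw [← hβ₀]
    exact Ordinal.right_le_opow β₀ Ordinal.one_lt_omega0
  · have hest : ∀ n ∈ Set.Icc 1 k, _ := fun n hn =>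
      admissibleSup_estimates h (hPz k x hx n hn).1 (pow_pos hθ0 n) hD1 (hPz k x hx n hn).2.1
        (hPz k x hx n hn).2.2
    have h4D : ENNReal.ofReal (4 * D) ≠ 0 := by
      rw [ne_eq, ENNReal.ofReal_eq_zero]
      linarith
    constructor
    · calc _ ≤ ENNReal.ofReal (1 / (4 * D)) * ENNReal.ofReal (4 * D * ‖x‖) := by
            gcongr
            exact iSup₂_le fun n hn => (hest n hn).1
        _ = ‖x‖ₑ := by
            rw [← ENNReal.ofReal_mul (by positivity), ← mul_assoc,
              one_div_mul_cancel (by positivity), one_mul, ofReal_norm]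
    · rw [mul_comm, ← ENNReal.div_le_iff h4D ENNReal.ofReal_ne_top]
      refine le_iInf₂ fun n hn => ?_
      rw [ENNReal.div_le_iff h4D ENNReal.ofReal_ne_top, mul_comm]
      exact (hest n hn).2
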